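/- Let $G(x)=-\tfrac12 e^{-|x|}$ and consider the Burgers--Poisson equation $$u_t+\Big(\frac{u^2}{2}\Big)_x=[G*u]_x,\qquad u(0,\cdot)=\bar u .\tag{BP}$$ A weak entropy solution of (BP) is a function $u\in L^1_{loc}([0,\infty)\times\mathbb R)\cap L^\infty_{loc}((0,\infty),L^\infty(\mathbb R))$ such that $t\mapsto u(t,\cdot)$ is continuous from $[0,\infty)$ into $L^1(\mathbb R)$ with $u(0,\cdot)=\bar u$, and such that for all $k\in\mathbb R$ and all $0\le\phi\in C^1_c((0,\infty)\times\mathbb R)$ $$\iint\Big[|u-k|\phi_t+\mathrm{sign}(u-k)\Big(\frac{u^2}{2}-\frac{k^2}{2}\Big)\phi_x+\mathrm{sign}(u-k)\,[G_x*u(t,\cdot)](x)\,\phi\Big]\,dx\,dt\ \ge 0 .$$ Corollary. Let $\bar u\in C^1(\mathbb R)\cap L^1(\mathbb R)$, $\bar u\not\equiv 0$, be such that $m=\inf_{x\in\mathbb R}\bar u'(x)$ is finite, let $M=\|\bar u\|_{L^1(\mathbb R)}$, and let $u$ be a weak entropy solution of (BP) with initial data $\bar u$. For $T\in\mathbb R$,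 say that $u$ is $C^1$ on $[0,T)$ if there is a $C^1$ function on $[0,T)\times\mathbb R$ (up to $t=0$) which for every $t\in[0,T)$ agrees with $u(t,\cdot)$ almost everywhere; then $u$ is identified with this function there. Say that $u_x$ stays bounded on $[0,T)$ if $u_x$ is bounded below on $[0,T)\times\mathbb R$, is bounded on $[\tau,T)\times\mathbb R$ for every $\tau>0$, and, in case $\bar u'$ is bounded above, is bounded on $[0,T)\times\mathbb R$. (i) Let $$T^-=\ln\left(1+\frac{1}{\sqrt{|m|+3M}}\left(\frac{\pi}{2}-\arctan\left(\frac{|m|}{\sqrt{2M}}\right)\right)\right).$$ Then $u$ is $C^1$ on $[0,T^-)$ and $u_x$ stays bounded on $[0,T^-)$. (ii) Suppose that $m<-1-\sqrt{\tfrac52M+1}$ and let $$T^+=\frac{2}{\left|2m+1+2\sqrt{|m|+\tfrac52M+\tfrac14}\right|}.$$ Then $u_x$ becomes unbounded before $T^+$: there is $t^*\in(0,T^+)$ such that $u$ is $C^1$ on $[0,t^*)$, $u_x$ stays bounded on $[0,T)$ for every $T<t^*$, and $$\inf_{x\in\mathbb R}u_x(t,x)\to-\infty\qquad\text{as }t\uparrow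 t^* .$$ -/

import Mathlib

open Set Filter Topology MeasureTheory

noncomputable section

/-- The kernel `G(x) = -e^{-|x|}/2` of the Poisson equation `φ'' - φ = u` on the line. -/
def bpKernel (x : ℝ) : ℝ := -(1 / 2) * Real.exp (-|x|)

/-- The nonlocal source `[G_x * v](x)`. (The value of `deriv bpKernel` at the kink `0`
does not affect the integral.) -/
def bpSource (v : ℝ → ℝ) (x : ℝ) : ℝ :=
  ∫ y, deriv bpKernel (x - y) * v y

/-- `u` (written `u t x`) is a weak entropy solution on `[0,∞) × ℝ` of the Burgers--Poisson
equation `u_t + (u²/2)_x = [G * u]_x` with initial data `ubar`. -/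
structure IsWeakEntropySolution (ubar : ℝ → ℝ) (u : ℝ → ℝ → ℝ) : Prop where
  /-- `u ∈ L¹_loc([0,∞) × ℝ)` -/
  locallyIntegrable :
    LocallyIntegrableOn (fun p : ℝ × ℝ => u p.1 p.2) (Ici 0 ×ˢ univ) volume
  /-- `u ∈ L^∞_loc((0,∞), L^∞(ℝ))` -/
  locallyBounded : ∀ a b : ℝ, 0 < a → ∃ C : ℝ,
    ∀ᵐ p : ℝ × ℝ ∂(volume.restrict (Icc a b ×ˢ univ)), |u p.1 p.2| ≤ C
  /-- `t ↦ u(t,·)` takes values in `L¹(ℝ)` ... -/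
  integrable : ∀ t : ℝ, 0 ≤ t → Integrable (u t) volume
  /-- ... and is continuous into `L¹(ℝ)` -/
  continuous_L1 : ∀ s : ℝ, 0 ≤ s →
    Tendsto (fun t => ∫ x, |u t x - u s x|) (𝓝[Ici 0] s) (𝓝 0)
  /-- the initial condition -/
  initial : u 0 =ᵐ[volume] ubar
  /-- the Kruzkov entropy inequality against test functions `φ ∈ C¹_c((0,∞) × ℝ)`, `φ ≥ 0` -/
  entropy : ∀ (k : ℝ) (φ : ℝ × ℝ → ℝ), ContDiff ℝ 1 φ → HasCompactSupport φ →
    tsupport φ ⊆ Ioi 0 ×ˢ univ → (∀ p, 0 ≤ φ p) →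
    0 ≤ ∫ p : ℝ × ℝ in Ioi 0 ×ˢ univ,
      (|u p.1 p.2 - k| * fderiv ℝ φ p (1, 0)
        + Real.sign (u p.1 p.2 - k) * (u p.1 p.2 ^ 2 / 2 - k ^ 2 / 2) * fderiv ℝ φ p (0, 1)
        + Real.sign (u p.1 p.2 - k) * bpSource (u p.1) p.2 * φ p)

/-- `w` is a `C¹` version of `u` on `[0,T) × ℝ`: `w` is `C¹` there (up to `t = 0`) and
`w(t,·) = u(t,·)` almost everywhere, for every `t ∈ [0,T)`. -/
def IsC1VersionOn (u w : ℝ → ℝ → ℝ) (T : ℝ) : Prop :=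
  ContDiffOn ℝ 1 (fun p : ℝ × ℝ => w p.1 p.2) (Ico 0 T ×ˢ univ) ∧
    ∀ t ∈ Ico 0 T, u t =ᵐ[volume] w t

/-- The slope `w_x` stays bounded on `[0,T)`. It is bounded below on `[0,T) × ℝ` and bounded on
`[τ,T) × ℝ` for all `τ > 0`; if the initial slope is bounded above, then it is bounded on the whole
of `[0,T) × ℝ`. (The initial slope itself need not be bounded above, which is why an upper bound
up to `t = 0` needs this proviso.) -/
def SlopeBoundedOn (ubar : ℝ → ℝ) (w : ℝ → ℝ → ℝ) (T : ℝ) : Prop :=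
  (∃ K : ℝ, ∀ t ∈ Ico 0 T, ∀ x, -K ≤ deriv (w t) x) ∧
  (∀ τ : ℝ, 0 < τ → ∃ K : ℝ, ∀ t ∈ Ico τ T, ∀ x, |deriv (w t) x| ≤ K) ∧
  (BddAbove (range (deriv ubar)) → ∃ K : ℝ, ∀ t ∈ Ico 0 T, ∀ x, |deriv (w t) x| ≤ K)

/-- The lower bound `T⁻` for the breaking time. -/
def lowerTime (m M : ℝ) : ℝ :=
  Real.log (1 + 1 / √(|m| + 3 * M) * (Real.pi / 2 - Real.arctan (|m| / √(2 * M))))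

/-- The upper bound `T⁺` for the breaking time. -/
def upperTime (m M : ℝ) : ℝ :=
  2 / |2 * m + 1 + 2 * √(|m| + 5 / 2 * M + 1 / 4)|

end

/-! Along a characteristic the slope `q = u_x` solves `q' = S_x - q²`, where `S = G_x * u` is the
source and `S_x = u + G * u`. Since `|G| ≤ 1/2`, `|S_x| ≤ ‖u‖_∞ + ‖u‖₁/2`, and wave breaking is
decided by a scalar Riccati comparison. Put `μ = |m|`. Kruzkov's comparison with the zero solution
gives `‖u(t)‖₁ ≤ M eᵗ`, and comparison with `±k(t)` shows that `‖u(t)‖_∞` grows at rate at most `M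
eᵗ/2`. An integrable function with slope at least `-μ` has a triangle under its graph, so `‖ubar‖_∞
≤ √(2μM) ≤ μ + M/2`. Altogether `|S_x| ≤ F(t) = μ + M eᵗ` (`sourceSlopeBound`).

For (i), if `Y' ≥ Y² + F` and `Y(0) = μ`, then `u_x ≥ -Y` and characteristics do not cross while `Y`
exists; a tangent in the variable `eᵗ` is such a `Y` and outlives `T⁻`
(`exists_riccati_supersolution`). For (ii), if `Z' ≤ Z² - F`, a slope that is once below `-Z` stays
below it; an explicit `Z` explodes at `log (1 + T⁺) < T⁺` (`riccati_subsolution`).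

The main work is to show that the weak solution is classical for as long as this comparison permits.
The source is treated as given. Kruzkov's inequality is extended from constants to `C¹` functions
`w` (`entropy_of_contDiffOn`), which yields weak-strong stability in shrinking cones
(`integral_abs_sub_le`). A priori `S` is only Lipschitz in `x`, so it is first averaged over length
`δ`; the resulting classical solutions are `O(δ)`-close to `u` in `L¹_loc` and have uniform slope
bounds at positive times, hence converge locally uniformly and `u` has a continuous version
(`exists_continuous_version`). Then `S` is `C¹` in `x`, the method of characteristics applies to `S`
itself, and stability with zero error identifies `u` with the classical solution
(`exists_classical_version`).

Finally, the breaking time is the supremum of the times up to which `u` is regular. If slopes were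
bounded below close to that time, restarting would extend the solution by a uniform amount; so the
slope becomes very negative at some earlier time, and Riccati comparison keeps it so
(`slope_blowup`). -/

/-! ### Global flows of Lipschitz vector fields in the plane -/

theorem norm_le_gronwallBound_of_symm_interval {E : Type*} [NormedAddCommGroup E] [NormedSpace ℝ E]
    {f f' : ℝ → E} {δ K ε T : ℝ}
    (hf : ∀ t ∈ Icc (-T) T, HasDerivWithinAt f (f' t) (Icc (-T) T) t) (h0 : ‖f 0‖ ≤ δ)
    (hb : ∀ t ∈ Icc (-T) T, ‖f' t‖ ≤ K * ‖f t‖ + ε) :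
    ∀ t ∈ Icc (-T) T, ‖f t‖ ≤ gronwallBound δ K ε |t| := by
  intro t ht
  have hT : 0 ≤ T := by linarith [ht.1, ht.2]
  have hc : ContinuousOn f (Icc (-T) T) := fun t ht => (hf t ht).continuousWithinAt
  rcases le_total 0 t with h | h
  · have := norm_le_gronwallBound_of_norm_deriv_right_le (f := f) (f' := f') (a := 0) (b := T)
      (δ := δ) (K := K) (ε := ε) (hc.mono (Icc_subset_Icc_left (by linarith)))
      (fun x hx => (hf x ⟨by linarith [hx.1], hx.2.le⟩).mono_of_mem_nhdsWithin
        (mem_of_superset (Icc_mem_nhdsGE hx.2) (Icc_subset_Icc_left (by linarith [hx.1])))) h0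
      (fun x hx => hb x ⟨by linarith [hx.1], hx.2.le⟩) t ⟨h, ht.2⟩
    simpa [abs_of_nonneg h] using this
  · have := norm_le_gronwallBound_of_norm_deriv_right_le (f := fun s => f (-s))
      (f' := fun s => -f' (-s)) (a := 0) (b := T)
      (δ := δ) (K := K) (ε := ε)
      (hc.comp continuous_neg.continuousOn fun x hx => ⟨by linarith [hx.2], by linarith [hx.1]⟩)
      (fun x hx => by
        have h1 := hf (-x) ⟨by linarith [hx.2], by linarith [hx.1]⟩
        have h2 : HasDerivWithinAt (fun s : ℝ => -s) (-1) (Icc (-T) T) x :=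
          (hasDerivAt_neg x).hasDerivWithinAt
        have h3 := h1.scomp x h2 (fun y hy => ⟨by linarith [hy.2], by linarith [hy.1]⟩)
        have h4 := h3.mono_of_mem_nhdsWithin
          (mem_of_superset (Icc_mem_nhdsGE hx.2) (Icc_subset_Icc_left (by linarith [hx.1])))
        simpa [Function.comp_def] using h4) (by simpa using h0)
      (fun x hx => by
        simpa using hb (-x) ⟨by linarith [hx.2], by linarith [hx.1]⟩) (-t)
        ⟨by linarith, by linarith [ht.1]⟩
    simpa [abs_of_nonpos h] using this

theorem lipschitzWith_clamp (R : ℝ) :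
    LipschitzWith 1 (fun p : ℝ × ℝ => (max (-R) (min R p.1), max (-R) (min R p.2))) := by
  have h : LipschitzWith 1 (fun x : ℝ => max (-R) (min R x)) :=
    (LipschitzWith.id.const_min R).const_max (-R)
  simpa using (h.comp LipschitzWith.prod_fst).prodMk (h.comp LipschitzWith.prod_snd)

/-- Picard–Lindelöf wants a bounded field. Clamping the state to the box of radius `R` bounds it
without increasing the Lipschitz constant, and `R` is the Gronwall bound for the clamped equation,
so the solution never feels the clamp. -/
theorem exists_solution_symm_interval {v : ℝ → ℝ × ℝ → ℝ × ℝ} {K : NNReal}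
    (hv : ∀ t, LipschitzWith K (v t)) (hc : Continuous fun p : ℝ × ℝ × ℝ => v p.1 p.2)
    (x₀ : ℝ × ℝ) {T : ℝ} (hT : 0 ≤ T) :
    ∃ γ : ℝ → ℝ × ℝ, γ 0 = x₀ ∧
      ∀ t ∈ Icc (-T) T, HasDerivWithinAt γ (v t (γ t)) (Icc (-T) T) t := by
  obtain ⟨B, hB⟩ : ∃ B, ∀ t ∈ Icc (-T) T, ‖v t 0‖ ≤ B :=
    isCompact_Icc.exists_bound_of_continuousOn
      (hc.comp (continuous_id.prodMk continuous_const)).continuousOn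
  have hB0 : 0 ≤ B := (norm_nonneg _).trans (hB 0 ⟨by linarith, hT⟩)
  set R := gronwallBound ‖x₀‖ K B T with hR
  have hR0 : 0 ≤ R := by
    have := gronwallBound_mono (norm_nonneg x₀) hB0 K.2 hT
    rw [gronwallBound_x0] at this
    exact (norm_nonneg _).trans this
  set cl : ℝ × ℝ → ℝ × ℝ := fun p => (max (-R) (min R p.1), max (-R) (min R p.2)) with hcl
  have hcl1 : LipschitzWith 1 cl := lipschitzWith_clamp R
  have hcl0 : cl 0 = 0 := by simp [hcl, hR0]
  have hcln : ∀ p, ‖cl p‖ ≤ ‖p‖ := fun p => by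
    have := hcl1.dist_le_mul p 0
    simpa [hcl0] using this
  have hclR : ∀ p, ‖cl p‖ ≤ R := fun p => by
    simp only [hcl, Prod.norm_def, Real.norm_eq_abs, sup_le_iff, abs_le]
    exact ⟨⟨le_max_left _ _, neg_le_self hR0, min_le_left _ _⟩,
      le_max_left _ _, neg_le_self hR0, min_le_left _ _⟩
  have hvn : ∀ t ∈ Icc (-T) T, ∀ p, ‖v t p‖ ≤ K * ‖p‖ + B := fun t ht p => by
    have h1 := (hv t).dist_le_mul p 0
    rw [dist_eq_norm, dist_zero_right] at h1
    have h2 := norm_le_norm_add_norm_sub' (v t p) (v t 0)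
    linarith [hB t ht]
  have hlip : ∀ t, LipschitzWith K (fun p => v t (cl p)) := fun t => by
    simpa [Function.comp_def] using (hv t).comp hcl1
  let L : NNReal := ⟨K * R + B, by positivity⟩
  -- A curve of speed at most `L` cannot leave the ball of radius `L * T` within time `T`, so the
  -- whole interval is admissible.
  have hPL : IsPicardLindelof (fun t p => v t (cl p)) (tmin := -T) (tmax := T)
      ⟨0, by linarith, hT⟩ x₀ (L * ⟨T, hT⟩) 0 L K :=
    { lipschitzOnWith := fun t _ => (hlip t).lipschitzOnWith
      continuousOn := fun x _ =>
        (hc.comp (continuous_id.prodMk continuous_const)).continuousOn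
      norm_le := fun t ht x _ => (hvn t ht _).trans (by
        change _ ≤ K * R + B
        gcongr
        exact hclR x)
      mul_max_le := by
        simp only [sub_zero, sub_neg_eq_add, zero_add, max_self, NNReal.coe_zero]
        exact le_rfl }
  obtain ⟨γ, h0, hγ⟩ := hPL.exists_eq_forall_mem_Icc_hasDerivWithinAt₀
  refine ⟨γ, h0, fun t ht => ?_⟩
  have hbd := norm_le_gronwallBound_of_symm_interval hγ (h0 ▸ le_rfl : ‖γ 0‖ ≤ ‖x₀‖)
    (K := K) (ε := B) (fun t ht => (hvn t ht _).trans (by gcongr; exact hcln _)) t ht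
  have hbR : ‖γ t‖ ≤ R := hbd.trans (gronwallBound_mono (norm_nonneg _) hB0 K.2 (abs_le.2 ht))
  have : cl (γ t) = γ t := by
    simp only [Prod.norm_def, Real.norm_eq_abs, sup_le_iff, abs_le] at hbR
    ext <;> simp [hcl, hbR]
  simpa [this] using hγ t ht

theorem exists_global_solution {v : ℝ → ℝ × ℝ → ℝ × ℝ} {K : NNReal}
    (hv : ∀ t, LipschitzWith K (v t)) (hc : Continuous fun p : ℝ × ℝ × ℝ => v p.1 p.2)
    (x₀ : ℝ × ℝ) :
    ∃ γ : ℝ → ℝ × ℝ, γ 0 = x₀ ∧ ∀ t, HasDerivAt γ (v t (γ t)) t := by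
  choose g g0 hg using fun n : ℕ =>
    exists_solution_symm_interval hv hc x₀ (T := (n : ℝ) + 1) (by positivity)
  have hg' : ∀ n : ℕ, ∀ t ∈ Ioo (-((n : ℝ) + 1)) (n + 1), HasDerivAt (g n) (v t (g n t)) t :=
    fun n t ht => (hg n t ⟨ht.1.le, ht.2.le⟩).hasDerivAt (Icc_mem_nhds ht.1 ht.2)
  have hmono : ∀ n m : ℕ, n ≤ m → EqOn (g n) (g m) (Ioo (-((n : ℝ) + 1)) (n + 1)) := by
    intro n m hnm
    have hnm' : (n : ℝ) ≤ m := by exact_mod_cast hnm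
    have hn : (0 : ℝ) ≤ n := n.cast_nonneg
    refine ODE_solution_unique_of_mem_Ioo (v := v) (K := K) (s := fun _ => univ) (t₀ := 0)
      (fun t _ => (hv t).lipschitzOnWith) ⟨by linarith, by linarith⟩
      (fun t ht => ⟨hg' n t ht, trivial⟩)
      (fun t ht => ⟨hg' m t ⟨by linarith [ht.1], by linarith [ht.2]⟩, trivial⟩)
      (by rw [g0, g0])
  refine ⟨fun t => g ⌈|t|⌉₊ t, g0 _, fun t => ?_⟩
  set N := ⌈|t|⌉₊ + 1 with hN
  -- Near `t` the glued curve is the single solution `g N`, so derivatives can be read off there.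
  have key : ∀ s : ℝ, |s| < N → g ⌈|s|⌉₊ s = g N s := fun s hs => by
    have h2 : ⌈|s|⌉₊ ≤ N := Nat.ceil_le.2 hs.le
    have h3 := Nat.le_ceil |s|
    have h4 := abs_le.1 h3
    exact hmono _ _ h2 ⟨by linarith [h4.1], by linarith [h4.2]⟩
  have htN : |t| < N := by
    have := Nat.le_ceil |t|
    rw [hN]; push_cast; linarith
  have hev : (fun t => g ⌈|t|⌉₊ t) =ᶠ[𝓝 t] g N := by
    filter_upwards [continuous_abs.continuousAt.eventually_lt_const htN] with s hs using key s hs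
  have h1 := abs_lt.1 htN
  have := (hg' N t ⟨by linarith [h1.1], by linarith [h1.2]⟩).congr_of_eventuallyEq hev
  simpa only [key t htN] using this

/-- Only the trajectory of the reference parameter `q` is used to measure how much the field
changes: it is compact on `[-T, T]`, so the change is uniformly below `δ` for nearby parameters, and
Gronwall turns `δ` into `ε / 2`. -/
theorem continuous_solution_family {P : Type*} [TopologicalSpace P] {v : P → ℝ → ℝ × ℝ → ℝ × ℝ}
    {K : NNReal} (hv : ∀ p t, LipschitzWith K (v p t))
    (hc : Continuous fun q : P × ℝ × ℝ × ℝ => v q.1 q.2.1 q.2.2)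
    {γ : P → ℝ → ℝ × ℝ} (h0 : Continuous fun p => γ p 0)
    (hγ : ∀ p t, HasDerivAt (γ p) (v p t (γ p t)) t) :
    Continuous fun q : P × ℝ => γ q.1 q.2 := by
  have hγc : ∀ p, Continuous (γ p) := fun p =>
    continuous_iff_continuousAt.2 fun t => (hγ p t).continuousAt
  rw [continuous_iff_continuousAt]
  rintro ⟨q, t₀⟩
  set T := |t₀| + 1 with hTdef
  have hT : 0 ≤ T := by positivity
  rw [ContinuousAt, Metric.tendsto_nhds]
  intro ε hε
  obtain ⟨δ, hδ, hδε⟩ : ∃ δ > 0, gronwallBound δ K δ T < ε / 2 := by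
    have hcont : Tendsto (fun δ : ℝ => gronwallBound δ K δ T) (𝓝[>] 0) (𝓝 0) := by
      have : Continuous fun δ : ℝ => gronwallBound δ K δ T := by
        by_cases hK : (K : ℝ) = 0
        · simp only [hK, gronwallBound_K0]; fun_prop
        · simp only [gronwallBound_of_K_ne_0 hK]; fun_prop
      have h := this.tendsto 0
      rw [gronwallBound_ε0_δ0] at h
      exact h.mono_left nhdsWithin_le_nhds
    obtain ⟨δ, h1, h2⟩ := ((hcont.eventually_lt_const (half_pos hε)).and
      self_mem_nhdsWithin).exists
    exact ⟨δ, h2, h1⟩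
  have hsup : ∀ᶠ p in 𝓝 q, ∀ t ∈ Icc (-T) T,
      ‖v p t (γ q t) - v q t (γ q t)‖ < δ := by
    refine isCompact_Icc.eventually_forall_of_forall_eventually fun t _ => ?_
    have hcc : Continuous fun z : P × ℝ => ‖v z.1 z.2 (γ q z.2) - v q z.2 (γ q z.2)‖ := by
      have h1 : Continuous fun z : P × ℝ => γ q z.2 := (hγc q).comp continuous_snd
      exact ((hc.comp (continuous_fst.prodMk (continuous_snd.prodMk h1))).sub
        (hc.comp (continuous_const.prodMk (continuous_snd.prodMk h1)))).norm
    have h2 := hcc.tendsto (q, t)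
    simp only [sub_self, norm_zero] at h2
    exact h2.eventually_lt_const hδ
  have hinit : ∀ᶠ p in 𝓝 q, ‖γ p 0 - γ q 0‖ < δ := by
    have h1 : Continuous fun p => ‖γ p 0 - γ q 0‖ := (h0.sub continuous_const).norm
    have h2 := h1.tendsto q
    simp only [sub_self, norm_zero] at h2
    exact h2.eventually_lt_const hδ
  have hunif : ∀ᶠ p in 𝓝 q, ∀ t ∈ Icc (-T) T, ‖γ p t - γ q t‖ < ε / 2 := by
    filter_upwards [hsup, hinit] with p hp1 hp2 t ht
    have h3 := norm_le_gronwallBound_of_symm_interval (f := fun t => γ p t - γ q t)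
      (f' := fun t => v p t (γ p t) - v q t (γ q t)) (δ := δ) (K := K) (ε := δ) (T := T)
      (fun t _ => ((hγ p t).sub (hγ q t)).hasDerivWithinAt) hp2.le (fun t ht => by
        have h4 := (hv p t).dist_le_mul (γ p t) (γ q t)
        rw [dist_eq_norm, dist_eq_norm] at h4
        calc _ = ‖(v p t (γ p t) - v p t (γ q t)) + (v p t (γ q t) - v q t (γ q t))‖ := by
              congr 1; abel
          _ ≤ _ := norm_add_le _ _
          _ ≤ _ := add_le_add h4 (hp1 t ht).le) t ht
    exact (h3.trans (gronwallBound_mono hδ.le hδ.le K.2 (abs_le.2 ht))).trans_lt hδε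
  have htc : ∀ᶠ t in 𝓝 t₀, t ∈ Icc (-T) T ∧ ‖γ q t - γ q t₀‖ < ε / 2 := by
    refine Filter.Eventually.and ?_ ?_
    · have h5 := abs_lt.1 (show |t₀| < T by rw [hTdef]; linarith)
      exact Icc_mem_nhds h5.1 h5.2
    · have h1 : Continuous fun t => ‖γ q t - γ q t₀‖ := ((hγc q).sub continuous_const).norm
      have h2 := h1.tendsto t₀
      simp only [sub_self, norm_zero] at h2
      exact h2.eventually_lt_const (half_pos hε)
  rw [nhds_prod_eq]
  filter_upwards [hunif.prod_mk htc] with z hz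
  rw [dist_eq_norm]
  calc _ = ‖(γ z.1 z.2 - γ q z.2) + (γ q z.2 - γ q t₀)‖ := by congr 1; abel
    _ ≤ _ := norm_add_le _ _
    _ < ε / 2 + ε / 2 := add_lt_add (hz.1 _ hz.2.1) hz.2.2
    _ = ε := add_halves ε


/-! ### The characteristic flow and its dependence on the label -/

theorem hasFDerivAt_of_partials {f f₁ f₂ : ℝ → ℝ → ℝ}
    (h₁ : ∀ t x, HasDerivAt (fun t => f t x) (f₁ t x) t) (h₂ : ∀ t x, HasDerivAt (f t) (f₂ t x) x)
    (c₁ : Continuous fun p : ℝ × ℝ => f₁ p.1 p.2) (c₂ : Continuous fun p : ℝ × ℝ => f₂ p.1 p.2)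
    (p : ℝ × ℝ) :
    HasFDerivAt (fun p : ℝ × ℝ => f p.1 p.2)
      ((f₁ p.1 p.2) • ContinuousLinearMap.fst ℝ ℝ ℝ + (f₂ p.1 p.2) • ContinuousLinearMap.snd ℝ ℝ ℝ)
      p := by
  have key := hasStrictFDerivAt_uncurry_coprod (𝕜 := ℝ) (u := p) (f := f)
    (f₁ := fun t x => ContinuousLinearMap.toSpanSingleton ℝ (f₁ t x))
    (f₂ := fun t x => ContinuousLinearMap.toSpanSingleton ℝ (f₂ t x))
    (Eventually.of_forall fun v => (h₁ v.1 v.2).hasFDerivAt)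
    (Eventually.of_forall fun v => (h₂ v.1 v.2).hasFDerivAt)
    (((ContinuousLinearMap.toSpanSingletonCLE (𝕜 := ℝ) (E := ℝ)).continuous.comp c₁).continuousAt)
    (((ContinuousLinearMap.toSpanSingletonCLE (𝕜 := ℝ) (E := ℝ)).continuous.comp c₂).continuousAt)
  refine key.hasFDerivAt.congr_fderiv ?_
  ext <;> simp [Function.HasUncurry.uncurry]

theorem contDiff_one_of_partials {f f₁ f₂ : ℝ → ℝ → ℝ}
    (h₁ : ∀ t x, HasDerivAt (fun t => f t x) (f₁ t x) t) (h₂ : ∀ t x, HasDerivAt (f t) (f₂ t x) x)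
    (c₁ : Continuous fun p : ℝ × ℝ => f₁ p.1 p.2) (c₂ : Continuous fun p : ℝ × ℝ => f₂ p.1 p.2) :
    ContDiff ℝ 1 (fun p : ℝ × ℝ => f p.1 p.2) := by
  have h := hasFDerivAt_of_partials h₁ h₂ c₁ c₂
  rw [contDiff_one_iff_fderiv]
  refine ⟨fun p => (h p).differentiableAt, ?_⟩
  rw [show fderiv ℝ (fun p : ℝ × ℝ => f p.1 p.2) = _ from funext fun p => (h p).fderiv]
  fun_prop

/-- The characteristic flow of `w_t + w w_x = r`, `w(0,·) = f`, together with the derivatives of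
position and velocity with respect to the label. -/
structure IsBurgersFlow (r r' : ℝ → ℝ → ℝ) (f : ℝ → ℝ) (X W J V : ℝ → ℝ → ℝ) : Prop where
  X_zero : ∀ α, X 0 α = α
  W_zero : ∀ α, W 0 α = f α
  J_zero : ∀ α, J 0 α = 1
  V_zero : ∀ α, V 0 α = deriv f α
  X_time : ∀ t α, HasDerivAt (fun t => X t α) (W t α) t
  W_time : ∀ t α, HasDerivAt (fun t => W t α) (r t (X t α)) t
  J_time : ∀ t α, HasDerivAt (fun t => J t α) (V t α) t
  V_time : ∀ t α, HasDerivAt (fun t => V t α) (r' t (X t α) * J t α) t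
  X_label : ∀ t α, HasDerivAt (X t) (J t α) α
  W_label : ∀ t α, HasDerivAt (W t) (V t α) α
  X_cont : Continuous fun p : ℝ × ℝ => X p.1 p.2
  W_cont : Continuous fun p : ℝ × ℝ => W p.1 p.2
  J_cont : Continuous fun p : ℝ × ℝ => J p.1 p.2
  V_cont : Continuous fun p : ℝ × ℝ => V p.1 p.2

/-- Hadamard's formula: the difference quotient becomes an integral that remains meaningful, and
jointly continuous, on the diagonal `y = x`. -/
theorem sub_eq_mul_integral_deriv {g g' : ℝ → ℝ} (hg : ∀ x, HasDerivAt g (g' x) x)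
    (hc : Continuous g') (x y : ℝ) :
    g y - g x = (y - x) * ∫ θ in (0 : ℝ)..1, g' (x + θ * (y - x)) := by
  have h1 : ∀ θ ∈ uIcc (0 : ℝ) 1, HasDerivAt (fun θ => g (x + θ * (y - x)))
      (g' (x + θ * (y - x)) * (y - x)) θ := fun θ _ => by
    have : HasDerivAt (fun θ : ℝ => x + θ * (y - x)) (y - x) θ := by
      simpa using ((hasDerivAt_id θ).mul_const (y - x)).const_add x
    exact (hg _).comp θ this
  have h2 := intervalIntegral.integral_eq_sub_of_hasDerivAt h1
    (Continuous.intervalIntegrable (by fun_prop) _ _)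
  rw [intervalIntegral.integral_mul_const] at h2
  simp only [one_mul, zero_mul, add_zero, add_sub_cancel] at h2
  rw [← h2, mul_comm]

/-- Differentiability in the label is obtained from difference quotients. By Hadamard's formula they
solve a linear system whose coefficient and initial value depend continuously on the pair of labels,
including equal labels. Its solution `D (α, β)` is thus continuous up to the diagonal, and its
diagonal values are `J` and `V`. -/
theorem exists_isBurgersFlow {r r' : ℝ → ℝ → ℝ} (hr : Continuous fun p : ℝ × ℝ => r p.1 p.2)
    (hr' : Continuous fun p : ℝ × ℝ => r' p.1 p.2) (hd : ∀ t x, HasDerivAt (r t) (r' t x) x)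
    {K : NNReal} (hK : ∀ t x, |r' t x| ≤ K) {f : ℝ → ℝ} (hf : ContDiff ℝ 1 f) :
    ∃ X W J V : ℝ → ℝ → ℝ, IsBurgersFlow r r' f X W J V := by
  have hlip : ∀ t, LipschitzWith K (r t) := fun t =>
    lipschitzWith_of_nnnorm_deriv_le (fun x => (hd t x).differentiableAt) fun x => by
      rw [(hd t x).deriv, ← NNReal.coe_le_coe]; exact hK t x
  set v : ℝ → ℝ × ℝ → ℝ × ℝ := fun t p => (p.2, r t p.1) with hv
  have hvl : ∀ t, LipschitzWith (max 1 K) (v t) := fun t => by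
    have h := (LipschitzWith.prod_snd (α := ℝ) (β := ℝ)).prodMk
      ((hlip t).comp (LipschitzWith.prod_fst (α := ℝ) (β := ℝ)))
    simpa using h
  have hvc : Continuous fun p : ℝ × ℝ × ℝ => v p.1 p.2 := by
    have h1 : Continuous fun p : ℝ × ℝ × ℝ => r p.1 p.2.1 :=
      hr.comp (continuous_fst.prodMk continuous_snd.fst)
    exact continuous_snd.snd.prodMk h1
  choose Γ Γ0 hΓ using fun α : ℝ => exists_global_solution hvl hvc (α, f α)
  have hfc : Continuous f := hf.continuous
  have Γc : Continuous fun q : ℝ × ℝ => Γ q.1 q.2 :=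
    continuous_solution_family (v := fun _ => v) (fun _ => hvl)
      (hvc.comp (continuous_snd)) (by simp only [Γ0]; fun_prop) hΓ
  set X : ℝ → ℝ → ℝ := fun t α => (Γ α t).1 with hX
  set W : ℝ → ℝ → ℝ := fun t α => (Γ α t).2 with hW
  have Xt : ∀ t α, HasDerivAt (fun t => X t α) (W t α) t := fun t α =>
    ((ContinuousLinearMap.fst ℝ ℝ ℝ).hasFDerivAt.comp_hasDerivAt t (hΓ α t))
  have Wt : ∀ t α, HasDerivAt (fun t => W t α) (r t (X t α)) t := fun t α =>
    ((ContinuousLinearMap.snd ℝ ℝ ℝ).hasFDerivAt.comp_hasDerivAt t (hΓ α t))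
  have Xc : Continuous fun q : ℝ × ℝ => X q.1 q.2 := (Γc.comp continuous_swap).fst
  have Wc : Continuous fun q : ℝ × ℝ => W q.1 q.2 := (Γc.comp continuous_swap).snd
  -- the linear equation for difference quotients
  set a : ℝ × ℝ → ℝ → ℝ := fun q t => ∫ θ in (0 : ℝ)..1, r' t (X t q.1 + θ * (X t q.2 - X t q.1))
    with ha
  set b : ℝ × ℝ → ℝ := fun q => ∫ θ in (0 : ℝ)..1, deriv f (q.1 + θ * (q.2 - q.1)) with hb
  have hdf : Continuous (deriv f) := hf.continuous_deriv le_rfl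
  have hac : Continuous fun z : (ℝ × ℝ) × ℝ => a z.1 z.2 := by
    refine intervalIntegral.continuous_parametric_intervalIntegral_of_continuous'
      (f := fun (z : (ℝ × ℝ) × ℝ) θ => r' z.2 (X z.2 z.1.1 + θ * (X z.2 z.1.2 - X z.2 z.1.1))) ?_ 0 1
    have e1 : Continuous fun z : ((ℝ × ℝ) × ℝ) × ℝ => X z.1.2 z.1.1.1 :=
      Xc.comp (continuous_fst.snd.prodMk continuous_fst.fst.fst)
    have e2 : Continuous fun z : ((ℝ × ℝ) × ℝ) × ℝ => X z.1.2 z.1.1.2 :=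
      Xc.comp (continuous_fst.snd.prodMk continuous_fst.fst.snd)
    exact hr'.comp (continuous_fst.snd.prodMk (e1.add (continuous_snd.mul (e2.sub e1))))
  have hbc : Continuous b := by
    refine intervalIntegral.continuous_parametric_intervalIntegral_of_continuous'
      (f := fun (q : ℝ × ℝ) θ => deriv f (q.1 + θ * (q.2 - q.1))) ?_ 0 1
    exact hdf.comp (by fun_prop)
  have haK : ∀ q t, |a q t| ≤ K := fun q t => by
    have := intervalIntegral.norm_integral_le_of_norm_le_const (a := (0 : ℝ)) (b := 1) (C := K)
      (f := fun θ => r' t (X t q.1 + θ * (X t q.2 - X t q.1))) fun θ _ => hK _ _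
    simpa using this
  set l : ℝ × ℝ → ℝ → ℝ × ℝ → ℝ × ℝ := fun q t p => (p.2, a q t * p.1) with hl
  have hll : ∀ q t, LipschitzWith (max 1 K) (l q t) := fun q t => by
    have h1 : LipschitzWith K fun y : ℝ => a q t * y := by
      refine LipschitzWith.of_dist_le_mul fun y z => ?_
      rw [Real.dist_eq, Real.dist_eq, ← mul_sub, abs_mul]
      gcongr
      exact haK q t
    have h := (LipschitzWith.prod_snd (α := ℝ) (β := ℝ)).prodMk
      (h1.comp (LipschitzWith.prod_fst (α := ℝ) (β := ℝ)))
    simpa using h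
  have hlc : Continuous fun z : (ℝ × ℝ) × ℝ × ℝ × ℝ => l z.1 z.2.1 z.2.2 := by
    have h1 : Continuous fun z : (ℝ × ℝ) × ℝ × ℝ × ℝ => a z.1 z.2.1 :=
      hac.comp (continuous_fst.prodMk continuous_snd.fst)
    exact continuous_snd.snd.snd.prodMk (h1.mul continuous_snd.snd.fst)
  choose D D0 hD using fun q : ℝ × ℝ => exists_global_solution (hll q)
    (hlc.comp (continuous_const.prodMk continuous_id)) (1, b q)
  have Dc : Continuous fun z : (ℝ × ℝ) × ℝ => D z.1 z.2 :=
    continuous_solution_family hll hlc (by simp only [D0]; fun_prop) hD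
  -- Both sides solve the linear system with the same data; multiplying by `q.2 - q.1` instead of
  -- dividing keeps the diagonal included.
  have hdiff : ∀ q : ℝ × ℝ, (fun t => (X t q.2 - X t q.1, W t q.2 - W t q.1))
      = fun t => (q.2 - q.1) • D q t := fun q => by
    refine ODE_solution_unique_univ (v := l q) (K := max 1 K) (s := fun _ => univ) (t₀ := 0)
      (fun t => (hll q t).lipschitzOnWith) (fun t => ⟨?_, trivial⟩) (fun t => ⟨?_, trivial⟩) ?_
    · refine HasDerivAt.prodMk ((Xt t q.2).sub (Xt t q.1)) ?_
      refine ((Wt t q.2).sub (Wt t q.1)).congr_deriv ?_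
      rw [sub_eq_mul_integral_deriv (hd t)
        (hr'.comp (continuous_const.prodMk continuous_id)) (X t q.1) (X t q.2), mul_comm]
    · refine ((hD q t).const_smul (q.2 - q.1)).congr_deriv ?_
      ext <;> simp [hl]; ring
    · have := sub_eq_mul_integral_deriv (fun x => (hf.differentiable one_ne_zero x).hasDerivAt) hdf q.1 q.2
      simp only [hX, hW, Γ0, D0, Prod.smul_mk, smul_eq_mul, mul_one]
      rw [this]
  have hXq : ∀ t α β, X t β - X t α = (β - α) * (D (α, β) t).1 := fun t α β => by
    simpa using congrArg Prod.fst (congrFun (hdiff (α, β)) t)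
  have hWq : ∀ t α β, W t β - W t α = (β - α) * (D (α, β) t).2 := fun t α β => by
    simpa using congrArg Prod.snd (congrFun (hdiff (α, β)) t)
  have hquot : ∀ (g : ℝ → ℝ) (d : ℝ → ℝ) (α : ℝ), Continuous d →
      (∀ β, g β - g α = (β - α) * d β) → HasDerivAt g (d α) α := fun g d α hdc h => by
    rw [hasDerivAt_iff_tendsto_slope]
    refine ((hdc.tendsto α).mono_left nhdsWithin_le_nhds).congr' ?_
    filter_upwards [self_mem_nhdsWithin] with β hβ
    have : β - α ≠ 0 := sub_ne_zero.2 hβ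
    rw [slope_def_field, h β]
    field_simp
  have Jc : Continuous fun p : ℝ × ℝ => D (p.2, p.2) p.1 :=
    Dc.comp ((continuous_snd.prodMk continuous_snd).prodMk continuous_fst)
  have aq : ∀ t α, a (α, α) t = r' t (X t α) := fun t α => by simp [ha]
  refine ⟨X, W, fun t α => (D (α, α) t).1, fun t α => (D (α, α) t).2,
    { X_zero := fun α => by simp [hX, Γ0]
      W_zero := fun α => by simp [hW, Γ0]
      J_zero := fun α => by simp [D0]
      V_zero := fun α => by simp [D0, hb]
      X_time := Xt
      W_time := Wt
      J_time := fun t α => 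
        (ContinuousLinearMap.fst ℝ ℝ ℝ).hasFDerivAt.comp_hasDerivAt t (hD (α, α) t)
      V_time := fun t α => by
        rw [← aq]
        exact (ContinuousLinearMap.snd ℝ ℝ ℝ).hasFDerivAt.comp_hasDerivAt t (hD (α, α) t)
      X_label := fun t α => hquot (X t) (fun β => (D (α, β) t).1) α
        ((Dc.comp ((continuous_const.prodMk continuous_id).prodMk continuous_const)).fst)
        (hXq t α)
      W_label := fun t α => hquot (W t) (fun β => (D (α, β) t).2) α
        ((Dc.comp ((continuous_const.prodMk continuous_id).prodMk continuous_const)).snd)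
        (hWq t α)
      X_cont := Xc
      W_cont := Wc
      J_cont := Jc.fst
      V_cont := Jc.snd }⟩


/-! ### Riccati comparison along characteristics -/

/-- The barrier `ε e^((C+1)(t-a))` has strictly larger derivative wherever `P` touches it, so `P`
stays below, and `ε → 0`. The differential inequality is needed only where `P > 0`. -/
theorem nonpos_of_deriv_le_mul {P P' : ℝ → ℝ} {a b C : ℝ} (hc : ContinuousOn P (Icc a b))
    (hd : ∀ t ∈ Ico a b, HasDerivWithinAt P (P' t) (Ici t) t) (ha : P a ≤ 0)
    (hb : ∀ t ∈ Ico a b, 0 < P t → P' t ≤ C * P t) : ∀ t ∈ Icc a b, P t ≤ 0 := by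
  intro t ht
  have key : ∀ ε > 0, P t ≤ ε * Real.exp ((C + 1) * (t - a)) := fun ε hε => by
    have hB : ∀ s, HasDerivAt (fun s => ε * Real.exp ((C + 1) * (s - a)))
        (ε * (Real.exp ((C + 1) * (s - a)) * (C + 1))) s := fun s => by
      have : HasDerivAt (fun s => (C + 1) * (s - a)) (C + 1) s := by
        simpa using ((hasDerivAt_id s).sub_const a).const_mul (C + 1)
      exact this.exp.const_mul ε
    refine image_le_of_deriv_right_lt_deriv_boundary' hc hd (by simp; linarith)
      (fun s _ => (hB s).continuousAt.continuousWithinAt)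
      (fun s _ => (hB s).hasDerivWithinAt) (fun s hs h => ?_) ht
    have hpos : 0 < ε * Real.exp ((C + 1) * (s - a)) := by positivity
    have := hb s hs (h ▸ hpos)
    rw [h] at this
    linarith
  have hlim : Tendsto (fun ε : ℝ => ε * Real.exp ((C + 1) * (t - a))) (𝓝[>] 0) (𝓝 0) := by
    have : Continuous fun ε : ℝ => ε * Real.exp ((C + 1) * (t - a)) := by fun_prop
    simpa using (this.tendsto 0).mono_left nhdsWithin_le_nhds
  exact ge_of_tendsto hlim (by filter_upwards [self_mem_nhdsWithin] with ε hε using key ε hε)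

namespace IsBurgersFlow

variable {r r' : ℝ → ℝ → ℝ} {f : ℝ → ℝ} {X W J V : ℝ → ℝ → ℝ}

theorem time_continuous (h : IsBurgersFlow r r' f X W J V) (α : ℝ) :
    Continuous (fun t => X t α) ∧ Continuous (fun t => J t α) ∧ Continuous (fun t => V t α) :=
  ⟨continuous_iff_continuousAt.2 fun t => (h.X_time t α).continuousAt,
    continuous_iff_continuousAt.2 fun t => (h.J_time t α).continuousAt,
    continuous_iff_continuousAt.2 fun t => (h.V_time t α).continuousAt⟩

/-- The sign of `V + Z J` is preserved when `Z` is a subsolution of the Riccati equation. -/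
theorem add_mul_nonpos (h : IsBurgersFlow r r' f X W J V) {Z Z' : ℝ → ℝ} {a b α : ℝ}
    (hZ : ∀ t ∈ Icc a b, HasDerivAt Z (Z' t) t) (hJ : ∀ t ∈ Ico a b, 0 ≤ J t α)
    (hsub : ∀ t ∈ Ico a b, r' t (X t α) + Z' t - Z t ^ 2 ≤ 0)
    (ha : V a α + Z a * J a α ≤ 0) : ∀ t ∈ Icc a b, V t α + Z t * J t α ≤ 0 := by
  obtain ⟨hXc, hJc, hVc⟩ := h.time_continuous α
  have hZc : ContinuousOn Z (Icc a b) := fun t ht => (hZ t ht).continuousAt.continuousWithinAt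
  obtain ⟨C, hC⟩ := isCompact_Icc.exists_bound_of_continuousOn hZc
  refine nonpos_of_deriv_le_mul (C := C)
    (P' := fun t => r' t (X t α) * J t α + (Z' t * J t α + Z t * V t α))
    (hVc.continuousOn.add (hZc.mul hJc.continuousOn))
    (fun t ht => ((h.V_time t α).add ((hZ t ⟨ht.1, ht.2.le⟩).mul (h.J_time t α))).hasDerivWithinAt)
    ha fun t ht hP => ?_
  -- The derivative of `V + Z J` is `Z (V + Z J) + (r' + Z' - Z²) J`. Working with `V` and `J`
  -- instead of the slope `V / J` keeps the system linear and avoids division.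
  have h1 := mul_nonneg_of_nonpos_of_nonpos (hsub t ht) (neg_nonpos.2 (hJ t ht))
  have h2 : Z t ≤ C := (le_abs_self _).trans (hC t ⟨ht.1, ht.2.le⟩)
  have h3 := mul_le_mul_of_nonneg_right h2 hP.le
  nlinarith

theorem add_mul_nonneg (h : IsBurgersFlow r r' f X W J V) {Z Z' : ℝ → ℝ} {a b α : ℝ}
    (hZ : ∀ t ∈ Icc a b, HasDerivAt Z (Z' t) t) (hJ : ∀ t ∈ Ico a b, 0 ≤ J t α)
    (hsup : ∀ t ∈ Ico a b, 0 ≤ r' t (X t α) + Z' t - Z t ^ 2)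
    (ha : 0 ≤ V a α + Z a * J a α) : ∀ t ∈ Icc a b, 0 ≤ V t α + Z t * J t α := by
  obtain ⟨hXc, hJc, hVc⟩ := h.time_continuous α
  have hZc : ContinuousOn Z (Icc a b) := fun t ht => (hZ t ht).continuousAt.continuousWithinAt
  obtain ⟨C, hC⟩ := isCompact_Icc.exists_bound_of_continuousOn hZc
  have key := nonpos_of_deriv_le_mul (C := C) (P := fun t => -(V t α + Z t * J t α))
    (P' := fun t => -(r' t (X t α) * J t α + (Z' t * J t α + Z t * V t α)))
    (hVc.continuousOn.add (hZc.mul hJc.continuousOn)).neg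
    (fun t ht => ((h.V_time t α).add
      ((hZ t ⟨ht.1, ht.2.le⟩).mul (h.J_time t α))).neg.hasDerivWithinAt)
    (by linarith) fun t ht hP => by
      have h1 := mul_nonneg (hsup t ht) (hJ t ht)
      have h2 : Z t ≤ C := (le_abs_self _).trans (hC t ⟨ht.1, ht.2.le⟩)
      have h3 := mul_le_mul_of_nonneg_right h2 hP.le
      nlinarith
  intro t ht
  linarith [key t ht]

/-- As long as a supersolution of the Riccati equation exists, characteristics do not cross. -/
theorem J_pos (h : IsBurgersFlow r r' f X W J V) {Y Y' : ℝ → ℝ} {T α : ℝ}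
    (hY : ∀ t ∈ Icc 0 T, HasDerivAt Y (Y' t) t)
    (hsup : ∀ t ∈ Icc 0 T, 0 ≤ r' t (X t α) + Y' t - Y t ^ 2)
    (hf : -Y 0 ≤ deriv f α) : ∀ t ∈ Icc 0 T, 0 < J t α := by
  obtain ⟨hXc, hJc, hVc⟩ := h.time_continuous α
  have hYc : ContinuousOn Y (Icc 0 T) := fun t ht => (hY t ht).continuousAt.continuousWithinAt
  obtain ⟨C, hC⟩ := isCompact_Icc.exists_bound_of_continuousOn hYc
  by_contra! hcon
  obtain ⟨t, ht, htJ⟩ := hcon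
  have hcomp : IsCompact (Icc 0 T ∩ {t | J t α ≤ 0}) :=
    isCompact_Icc.inter_right (isClosed_le hJc continuous_const)
  obtain ⟨t₁, ⟨ht₁, hJ₁⟩, hmin⟩ := hcomp.exists_isLeast ⟨t, ht, htJ⟩
  have hpos : ∀ s ∈ Ico 0 t₁, 0 ≤ J s α := fun s hs => by
    by_contra! hneg
    exact absurd (hmin ⟨⟨hs.1, hs.2.le.trans ht₁.2⟩, hneg.le⟩) (not_le.2 hs.2)
  have hsub : Icc 0 t₁ ⊆ Icc 0 T := Icc_subset_Icc_right ht₁.2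
  have hP := h.add_mul_nonneg (fun s hs => hY s (hsub hs)) hpos
    (fun s hs => hsup s (hsub ⟨hs.1, hs.2.le⟩)) (by rw [h.V_zero, h.J_zero]; linarith)
  have hC0 : 0 ≤ C := (norm_nonneg _).trans (hC 0 ⟨le_rfl, ht₁.1.trans ht₁.2⟩)
  -- Up to the first time `t₁` at which `J ≤ 0`, `J' = V ≥ -Y J ≥ -C J`, hence `J ≥ e^(-C s) > 0`,
  -- also at `t₁`: a contradiction.
  have hE : ∀ s, HasDerivAt (fun s => Real.exp (-C * s)) (Real.exp (-C * s) * (-C)) s := fun s => by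
    have : HasDerivAt (fun s => -C * s) (-C) s := by simpa using (hasDerivAt_id s).const_mul (-C)
    exact this.exp
  have hexp := nonpos_of_deriv_le_mul (C := 0) (a := 0) (b := t₁)
    (P := fun s => Real.exp (-C * s) - J s α)
    (P' := fun s => Real.exp (-C * s) * (-C) - V s α)
    (by fun_prop) (fun s _ => ((hE s).sub (h.J_time s α)).hasDerivWithinAt)
    (by simp [h.J_zero]) (fun s hs hQ => by
      have h1 := hP s ⟨hs.1, hs.2.le⟩
      have h2 : Y s ≤ C := (le_abs_self _).trans (hC s (hsub ⟨hs.1, hs.2.le⟩))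
      have h3 := mul_le_mul_of_nonneg_right h2 (hpos s hs)
      have h4 := mul_nonneg hC0 hQ.le
      nlinarith) t₁ ⟨ht₁.1, le_rfl⟩
  have := Real.exp_pos (-C * t₁)
  have : J t₁ α ≤ 0 := hJ₁
  linarith

theorem abs_W_sub_le (h : IsBurgersFlow r r' f X W J V) {B : ℝ} (hr : ∀ t x, |r t x| ≤ B)
    {t : ℝ} (ht : 0 ≤ t) (α : ℝ) : |W t α - f α| ≤ B * t := by
  have h1 := norm_image_sub_le_of_norm_deriv_le_segment' (f := fun t => W t α) (a := 0) (b := t)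
    (C := B) (fun s _ => (h.W_time s α).hasDerivWithinAt) (fun s _ => hr _ _) t ⟨ht, le_rfl⟩
  simpa [h.W_zero] using h1

theorem abs_W_le (h : IsBurgersFlow r r' f X W J V) {B C : ℝ} (hr : ∀ t x, |r t x| ≤ B)
    (hf : ∀ x, |f x| ≤ C) {t : ℝ} (ht : 0 ≤ t) (α : ℝ) : |W t α| ≤ C + B * t := by
  have h1 := h.abs_W_sub_le hr ht α
  have h2 := abs_sub_abs_le_abs_sub (W t α) (f α)
  linarith [hf α]

theorem abs_X_sub_le (h : IsBurgersFlow r r' f X W J V) {B C : ℝ} (hr : ∀ t x, |r t x| ≤ B)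
    (hf : ∀ x, |f x| ≤ C) {t : ℝ} (ht : 0 ≤ t) (α : ℝ) : |X t α - α| ≤ (C + B * t) * t := by
  have hB : 0 ≤ B := (abs_nonneg _).trans (hr 0 0)
  have := norm_image_sub_le_of_norm_deriv_le_segment' (f := fun t => X t α) (a := 0) (b := t)
    (C := C + B * t) (fun s _ => (h.X_time s α).hasDerivWithinAt) (fun s hs => by
      refine (h.abs_W_le hr hf hs.1 α).trans ?_
      gcongr
      exact hs.2.le) t ⟨ht, le_rfl⟩
  simpa [h.X_zero] using this

/-- The flow moves points by a bounded distance, so `X t` has the limits of the identity at `±∞`. -/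
theorem surjective_X (h : IsBurgersFlow r r' f X W J V) {B C : ℝ} (hr : ∀ t x, |r t x| ≤ B)
    (hf : ∀ x, |f x| ≤ C) {t : ℝ} (ht : 0 ≤ t) : Function.Surjective (X t) := by
  have h1 := h.abs_X_sub_le hr hf ht
  have hc : Continuous (X t) := continuous_iff_continuousAt.2 fun α => (h.X_label t α).continuousAt
  refine hc.surjective ?_ ?_
  · refine tendsto_atTop_mono (f := fun α => α - (C + B * t) * t) (fun α => ?_)
      (tendsto_atTop_add_const_right _ _ tendsto_id)
    have := (abs_le.1 (h1 α)).1
    linarith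
  · refine tendsto_atBot_mono (f := fun α => α + (C + B * t) * t) (fun α => ?_)
      (tendsto_atBot_add_const_right _ _ tendsto_id)
    have := (abs_le.1 (h1 α)).2
    linarith

end IsBurgersFlow

/-! ### Classical solutions by the method of characteristics -/

/-- The derivative of `(t, α) ↦ (t, X t α)` as an equivalence. -/
noncomputable def shearEquiv (a b : ℝ) (hb : b ≠ 0) : (ℝ × ℝ) ≃L[ℝ] (ℝ × ℝ) :=
  ContinuousLinearEquiv.equivOfInverse
    ((ContinuousLinearMap.fst ℝ ℝ ℝ).prod
      (a • ContinuousLinearMap.fst ℝ ℝ ℝ + b • ContinuousLinearMap.snd ℝ ℝ ℝ))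
    ((ContinuousLinearMap.fst ℝ ℝ ℝ).prod
      (b⁻¹ • (ContinuousLinearMap.snd ℝ ℝ ℝ - a • ContinuousLinearMap.fst ℝ ℝ ℝ)))
    (fun p => by ext <;> simp; field_simp)
    (fun p => by ext <;> simp; field_simp; ring)

/-- `w` is a classical solution of `w_t + w w_x = r` on `[0,T] × ℝ` with `w(0,·) = f`. -/
structure IsClassicalSolution (r : ℝ → ℝ → ℝ) (f : ℝ → ℝ) (T : ℝ) (w : ℝ → ℝ → ℝ) : Prop where
  contDiffOn : ContDiffOn ℝ 1 (fun p : ℝ × ℝ => w p.1 p.2) (Icc 0 T ×ˢ univ)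
  initial : w 0 = f
  pde : ∀ t ∈ Ioo 0 T, ∀ x, fderiv ℝ (fun p : ℝ × ℝ => w p.1 p.2) (t, x) (1, 0)
    + w t x * fderiv ℝ (fun p : ℝ × ℝ => w p.1 p.2) (t, x) (0, 1) = r t x

/-- Slopes of `w` below a subsolution of the Riccati equation `Z' = Z² - F` stay below it. -/
def SlopePropagates (F : ℝ → ℝ) (T : ℝ) (w : ℝ → ℝ → ℝ) : Prop :=
  ∀ (Z Z' : ℝ → ℝ) (t₁ t₂ : ℝ), 0 ≤ t₁ → t₁ ≤ t₂ → t₂ < T →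
    (∀ t ∈ Icc t₁ t₂, HasDerivAt Z (Z' t) t ∧ Z' t ≤ Z t ^ 2 - F t) →
    (∃ x, deriv (w t₁) x ≤ -Z t₁) → ∃ x, deriv (w t₂) x ≤ -Z t₂

/-- While the supersolution `Y` exists, `J > 0`, so `X t` is a bijection and `w t` is `W t` composed
with its inverse. Since `w_x J = V` along the flow, every slope bound is a sign statement about `V +
Z J` for a suitable barrier `Z`. -/
theorem exists_isClassicalSolution {r r' : ℝ → ℝ → ℝ}
    (hr : Continuous fun p : ℝ × ℝ => r p.1 p.2)
    (hr' : Continuous fun p : ℝ × ℝ => r' p.1 p.2) (hd : ∀ t x, HasDerivAt (r t) (r' t x) x)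
    {K : ℝ} (hK : ∀ t x, |r' t x| ≤ K) {B : ℝ} (hB : ∀ t x, |r t x| ≤ B)
    {f : ℝ → ℝ} (hf : ContDiff ℝ 1 f) {C : ℝ} (hC : ∀ x, |f x| ≤ C)
    {F Y Y' : ℝ → ℝ} {T : ℝ} (hF : ∀ t ∈ Icc 0 T, ∀ x, |r' t x| ≤ F t)
    (hY : ∀ t ∈ Icc 0 T, HasDerivAt Y (Y' t) t ∧ Y t ^ 2 + F t ≤ Y' t)
    (hY0 : ∀ x, -Y 0 ≤ deriv f x) :
    ∃ w : ℝ → ℝ → ℝ, IsClassicalSolution r f T w ∧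
      (∀ t ∈ Icc 0 T, ∀ x, ∃ α, |x - α| ≤ (C + B * t) * t ∧ |w t x - f α| ≤ B * t) ∧
      (∀ t ∈ Icc 0 T, ∀ x, -Y t ≤ deriv (w t) x) ∧
      (∀ k, 0 ≤ k → (∀ t ∈ Icc 0 T, F t ≤ k ^ 2) →
        (∀ t ∈ Ioc 0 T, ∀ x, deriv (w t) x ≤ 1 / t + k) ∧
        ((∀ x, deriv f x ≤ k) → ∀ t ∈ Icc 0 T, ∀ x, deriv (w t) x ≤ k)) ∧
      SlopePropagates F T w := by
  have hK0 : 0 ≤ K := (abs_nonneg _).trans (hK 0 0)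
  have hB0 : 0 ≤ B := (abs_nonneg _).trans (hB 0 0)
  obtain ⟨X, W, J, V, h⟩ := exists_isBurgersFlow hr hr' hd (K := ⟨K, hK0⟩) hK hf
  have hrl : ∀ t ∈ Icc 0 T, ∀ x, r' t x ≤ F t := fun t ht x => (le_abs_self _).trans (hF t ht x)
  have hrg : ∀ t ∈ Icc 0 T, ∀ x, -F t ≤ r' t x := fun t ht x => (abs_le.1 (hF t ht x)).1
  have hsup : ∀ α, ∀ t ∈ Icc 0 T, 0 ≤ r' t (X t α) + Y' t - Y t ^ 2 := fun α t ht => by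
    linarith [(hY t ht).2, hrg t ht (X t α)]
  have hJ : ∀ t ∈ Icc 0 T, ∀ α, 0 < J t α := fun t ht α =>
    h.J_pos (fun t ht => (hY t ht).1) (hsup α) (hY0 α) t ht
  have hsurj : ∀ t ∈ Icc 0 T, Function.Surjective (X t) := fun t ht => h.surjective_X hB hC ht.1
  have hinj : ∀ t ∈ Icc 0 T, Function.Injective (X t) := fun t ht =>
    (strictMono_of_deriv_pos fun α => by rw [(h.X_label t α).deriv]; exact hJ t ht α).injective
  set A : ℝ → ℝ → ℝ := fun t => Function.invFun (X t) with hA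
  have hXA : ∀ t ∈ Icc 0 T, ∀ x, X t (A t x) = x := fun t ht x =>
    Function.rightInverse_invFun (hsurj t ht) x
  have hAX : ∀ t ∈ Icc 0 T, ∀ α, A t (X t α) = α := fun t ht α =>
    Function.leftInverse_invFun (hinj t ht) α
  set w : ℝ → ℝ → ℝ := fun t x => W t (A t x) with hw
  have hwX : ∀ t ∈ Icc 0 T, ∀ α, w t (X t α) = W t α := fun t ht α => by
    simp only [hw, hAX t ht]
  have hX1 : ContDiff ℝ 1 fun p : ℝ × ℝ => X p.1 p.2 :=
    contDiff_one_of_partials h.X_time h.X_label h.W_cont h.J_cont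
  have hrX : Continuous fun p : ℝ × ℝ => r p.1 (X p.1 p.2) :=
    hr.comp (continuous_fst.prodMk h.X_cont)
  have hW1 : ContDiff ℝ 1 fun p : ℝ × ℝ => W p.1 p.2 :=
    contDiff_one_of_partials h.W_time h.W_label hrX h.V_cont
  have hcd : ContDiffOn ℝ 1 (fun p : ℝ × ℝ => w p.1 p.2) (Icc 0 T ×ˢ univ) := by
    rintro ⟨t, x⟩ ⟨ht, -⟩
    obtain ⟨α, rfl⟩ := hsurj t ht x
    have hne := (hJ t ht α).ne'
    -- The flow exists for all real times, so the inverse function theorem applies on a full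
    -- neighbourhood even when `t` is `0` or `T`; this gives `C¹` regularity up to the endpoints.
    set Θ : ℝ × ℝ → ℝ × ℝ := fun p => (p.1, X p.1 p.2) with hΘ
    have hΘ1 : ContDiffAt ℝ 1 Θ (t, α) := (contDiff_fst.prodMk hX1).contDiffAt
    have hΘd : HasFDerivAt Θ (shearEquiv (W t α) (J t α) hne : (ℝ × ℝ) →L[ℝ] (ℝ × ℝ)) (t, α) :=
      hasFDerivAt_fst.prodMk (hasFDerivAt_of_partials h.X_time h.X_label h.W_cont h.J_cont (t, α))
    set L := hΘ1.localInverse hΘd one_ne_zero with hL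
    have hL1 : ContDiffAt ℝ 1 L (t, X t α) := hΘ1.to_localInverse hΘd one_ne_zero
    have hLr : ∀ᶠ q in 𝓝 (t, X t α), Θ (L q) = q :=
      (hΘ1.hasStrictFDerivAt' hΘd one_ne_zero).eventually_right_inverse
    have hLv : L (t, X t α) = (t, α) := hΘ1.localInverse_apply_image hΘd one_ne_zero
    have h1 : ContDiffAt ℝ 1 (fun q => W (L q).1 (L q).2) (t, X t α) :=
      ContDiffAt.comp (g := fun p : ℝ × ℝ => W p.1 p.2) (f := L) (t, X t α) hW1.contDiffAt hL1
    have hcongr : ∀ q : ℝ × ℝ, q.1 ∈ Icc 0 T → Θ (L q) = q → w q.1 q.2 = W (L q).1 (L q).2 := by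
      intro q hq1 hq
      have e1 : (L q).1 = q.1 := show (Θ (L q)).1 = q.1 by rw [hq]
      have e2 : X (L q).1 (L q).2 = q.2 := show (Θ (L q)).2 = q.2 by rw [hq]
      rw [← e2, e1, hwX q.1 hq1]
    refine h1.contDiffWithinAt.congr_of_eventuallyEq ?_
      (hcongr (t, X t α) ht (by rw [hLv]))
    filter_upwards [mem_nhdsWithin_of_mem_nhds hLr, self_mem_nhdsWithin] with q hq hq'
    exact hcongr q hq'.1 hq
  have hdw : ∀ t ∈ Icc 0 T, ∀ α, deriv (w t) (X t α) * J t α = V t α := fun t ht α => by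
    have h1 : DifferentiableAt ℝ (w t) (X t α) := by
      have h2 := (hcd (t, X t α) ⟨ht, trivial⟩).differentiableWithinAt one_ne_zero
      have h3 : DifferentiableWithinAt ℝ (fun x : ℝ => (t, x)) univ (X t α) := by fun_prop
      have h4 := DifferentiableWithinAt.comp (X t α) h2 h3 (fun x _ => ⟨ht, trivial⟩)
      simpa [Function.comp_def, differentiableWithinAt_univ] using h4
    have h5 := h1.hasDerivAt.comp α (h.X_label t α)
    have h6 : (w t ∘ X t) = W t := funext fun β => hwX t ht β
    rw [h6] at h5
    exact h5.unique (h.W_label t α)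
  refine ⟨w, ⟨hcd, ?_, fun t ht x => ?_⟩,
    fun t ht x => ⟨A t x,
      by simpa only [hXA t ht] using h.abs_X_sub_le hB hC ht.1 (A t x), h.abs_W_sub_le hB ht.1 _⟩, fun t ht x => ?_, fun k hk hFk =>
    ⟨fun t ht x => ?_, fun hfk t ht x => ?_⟩, ?_⟩
  · funext x
    by_cases hT : 0 ≤ T
    · have := hwX 0 ⟨le_rfl, hT⟩ x
      rwa [h.X_zero, h.W_zero] at this
    · have hX0 : X 0 = id := funext h.X_zero
      have : Function.invFun (X 0) x = x := by
        rw [hX0]; exact Function.leftInverse_invFun Function.injective_id x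
      simp only [hw, hA, this, h.W_zero]
  · have ht' : t ∈ Icc 0 T := ⟨ht.1.le, ht.2.le⟩
    obtain ⟨α, rfl⟩ := hsurj t ht' x
    have hnhds : Icc (0 : ℝ) T ×ˢ (univ : Set ℝ) ∈ 𝓝 (t, X t α) :=
      prod_mem_nhds (Icc_mem_nhds ht.1 ht.2) univ_mem
    have h1 := ((hcd (t, X t α) ⟨ht', trivial⟩).contDiffAt hnhds).differentiableAt one_ne_zero
    have h2 : HasDerivAt (fun s => (s, X s α)) (1, W t α) t := (hasDerivAt_id t).prodMk (h.X_time t α)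
    have h3 := h1.hasFDerivAt.comp_hasDerivAt t h2
    have h4 : (fun s => W s α) =ᶠ[𝓝 t] ((fun p : ℝ × ℝ => w p.1 p.2) ∘ fun s => (s, X s α)) := by
      filter_upwards [Icc_mem_nhds ht.1 ht.2] with s hs using (hwX s hs α).symm
    have h5 := (h3.congr_of_eventuallyEq h4).unique (h.W_time t α)
    rw [hwX t ht' α, ← h5, show ((1 : ℝ), W t α) = (1, 0) + W t α • (0, 1) by simp, map_add,
      map_smul, smul_eq_mul]
  · obtain ⟨α, rfl⟩ := hsurj t ht x
    have h1 := h.add_mul_nonneg (fun t ht => (hY t ht).1)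
      (fun t ht => (hJ t ⟨ht.1, ht.2.le⟩ α).le) (fun t ht => hsup α t ⟨ht.1, ht.2.le⟩)
      (by rw [h.V_zero, h.J_zero]; linarith [hY0 α]) t ht
    rw [← hdw t ht α, ← add_mul] at h1
    linarith [nonneg_of_mul_nonneg_left h1 (hJ t ht α)]
  · have ht' : t ∈ Icc 0 T := ⟨ht.1.le, ht.2⟩
    obtain ⟨α, rfl⟩ := hsurj t ht' x
    obtain ⟨hXc, hJc, hVc⟩ := h.time_continuous α
    -- The bound `1 / t + k` multiplied by `t J`: this removes the singularity, and the function
    -- starts at `-J = -1`. Its derivative is at most `-k P - 2 k J`.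
    have h1 := nonpos_of_deriv_le_mul (C := 0) (a := 0) (b := t)
      (P := fun s => s * V s α - (1 + k * s) * J s α)
      (P' := fun s => (1 * V s α + s * (r' s (X s α) * J s α))
        - (k * J s α + (1 + k * s) * V s α))
      (by fun_prop)
      (fun s _ => by
        have e1 : HasDerivAt (fun s : ℝ => 1 + k * s) k s := by
          simpa using ((hasDerivAt_id s).const_mul k).const_add 1
        exact (((hasDerivAt_id s).mul (h.V_time s α)).sub
          (e1.mul (h.J_time s α))).hasDerivWithinAt)
      (by simp [h.J_zero]) (fun s hs hP => by
        have hs' : s ∈ Icc 0 T := ⟨hs.1, hs.2.le.trans ht.2⟩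
        have e1 : r' s (X s α) ≤ k ^ 2 := (hrl s hs' _).trans (hFk s hs')
        have e2 := hJ s hs' α
        have e3 : s * (r' s (X s α) * J s α) ≤ s * (k ^ 2 * J s α) := by
          have := hs.1
          gcongr
        have e4 := mul_nonneg hk hP.le
        have e5 := mul_nonneg hk e2.le
        nlinarith) t ⟨ht.1.le, le_rfl⟩
    have hJt := hJ t ht' α
    have ht0 : 0 < t := ht.1
    have h2 : (t * deriv (w t) (X t α) - (1 + k * t)) * J t α ≤ 0 := by
      have := hdw t ht' α
      rw [sub_mul, mul_assoc, this]; exact h1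
    have h3 : t * deriv (w t) (X t α) - (1 + k * t) ≤ 0 := nonpos_of_mul_nonpos_left h2 hJt
    rw [show 1 / t + k = (1 + k * t) / t by field_simp, le_div_iff₀ ht0]
    linarith
  · obtain ⟨α, rfl⟩ := hsurj t ht x
    -- The constant `k` is an upper barrier for the slope because `r' ≤ F ≤ k²`.
    have h1 := h.add_mul_nonpos (Z := fun _ => -k) (Z' := fun _ => 0) (a := 0) (b := T)
      (fun t _ => hasDerivAt_const t _)
      (fun t ht => (hJ t ⟨ht.1, ht.2.le⟩ α).le)
      (fun t ht => by
        have := hrl t ⟨ht.1, ht.2.le⟩ (X t α)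
        have := hFk t ⟨ht.1, ht.2.le⟩
        nlinarith)
      (by rw [h.V_zero, h.J_zero]; linarith [hfk α]) t ht
    rw [← hdw t ht α, ← add_mul] at h1
    linarith [nonpos_of_mul_nonpos_left h1 (hJ t ht α)]
  · rintro Z Z' t₁ t₂ h0 h12 h2T hZ ⟨x, hx⟩
    have ht₁ : t₁ ∈ Icc 0 T := ⟨h0, h12.trans h2T.le⟩
    have ht₂ : t₂ ∈ Icc 0 T := ⟨h0.trans h12, h2T.le⟩
    have hsub : Icc t₁ t₂ ⊆ Icc 0 T := Icc_subset_Icc h0 h2T.le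
    obtain ⟨α, rfl⟩ := hsurj t₁ ht₁ x
    refine ⟨X t₂ α, ?_⟩
    have h1 := h.add_mul_nonpos (fun t ht => (hZ t ht).1)
      (fun t ht => (hJ t (hsub ⟨ht.1, ht.2.le⟩) α).le)
      (fun t ht => by
        have := hrl t (hsub ⟨ht.1, ht.2.le⟩) (X t α)
        have := (hZ t ⟨ht.1, ht.2.le⟩).2
        linarith)
      (by
        rw [← hdw t₁ ht₁ α, ← add_mul]
        exact mul_nonpos_of_nonpos_of_nonneg (by linarith) (hJ t₁ ht₁ α).le) t₂ ⟨h12, le_rfl⟩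
    rw [← hdw t₂ ht₂ α, ← add_mul] at h1
    linarith [nonpos_of_mul_nonpos_left h1 (hJ t₂ ht₂ α)]


/-! ### The kernel, the source and its Lipschitz bound -/

theorem measurable_realSign : Measurable Real.sign :=
  Measurable.ite (measurableSet_lt measurable_id measurable_const) measurable_const
    (Measurable.ite (measurableSet_lt measurable_const measurable_id) measurable_const
      measurable_const)

theorem abs_realSign_le (x : ℝ) : |Real.sign x| ≤ 1 := by
  rcases Real.sign_apply_eq x with h | h | h <;> simp [h]

/-- The formula holds at the kink as well: there `deriv` takes its default value `0`, which agrees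
with `Real.sign 0`. -/
theorem deriv_bpKernel (z : ℝ) : deriv bpKernel z = Real.sign z * (Real.exp (-|z|) / 2) := by
  rcases lt_trichotomy z 0 with h | rfl | h
  · have h1 : HasDerivAt (fun z : ℝ => -(1 / 2) * Real.exp z) (-(1 / 2) * Real.exp z) z :=
      (Real.hasDerivAt_exp z).const_mul _
    have h2 : bpKernel =ᶠ[𝓝 z] fun z : ℝ => -(1 / 2) * Real.exp z := by
      filter_upwards [Iio_mem_nhds h] with y hy
      simp [bpKernel, abs_of_neg (mem_Iio.1 hy)]
    rw [h2.deriv_eq, h1.deriv, Real.sign_of_neg h, abs_of_neg h]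
    simp; ring
  · rw [Real.sign_zero, zero_mul]
    refine deriv_zero_of_not_differentiableAt fun hd => ?_
    -- If the kernel were differentiable at `0`, so would be `-log (-2 G) = |·|`.
    have h1 : DifferentiableAt ℝ (fun z : ℝ => -Real.log (-2 * bpKernel z)) 0 := by
      refine ((hd.const_mul (-2)).log ?_).neg
      simp [bpKernel]
    have h2 : (fun z : ℝ => -Real.log (-2 * bpKernel z)) = fun z => |z| := by
      funext z
      simp [bpKernel, ← mul_assoc]
    rw [h2] at h1
    exact not_differentiableAt_abs_zero h1
  · have h1 : HasDerivAt (fun z : ℝ => -(1 / 2) * Real.exp (-z)) (-(1 / 2) * (Real.exp (-z) * -1)) z :=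
      ((hasDerivAt_neg z).exp).const_mul _
    have h2 : bpKernel =ᶠ[𝓝 z] fun z : ℝ => -(1 / 2) * Real.exp (-z) := by
      filter_upwards [Ioi_mem_nhds h] with y hy
      simp [bpKernel, abs_of_pos (mem_Ioi.1 hy)]
    rw [h2.deriv_eq, h1.deriv, Real.sign_of_pos h, abs_of_pos h]
    ring

theorem measurable_deriv_bpKernel : Measurable (deriv bpKernel) := measurable_deriv _

theorem abs_deriv_bpKernel_le (z : ℝ) : |deriv bpKernel z| ≤ Real.exp (-|z|) / 2 := by
  rw [deriv_bpKernel, abs_mul, abs_of_nonneg (a := Real.exp (-|z|) / 2) (by positivity)]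
  exact mul_le_of_le_one_left (by positivity) (abs_realSign_le z)

theorem exp_neg_abs_le_one (z : ℝ) : Real.exp (-|z|) ≤ 1 := by simp

theorem abs_deriv_bpKernel_le_half (z : ℝ) : |deriv bpKernel z| ≤ 1 / 2 :=
  (abs_deriv_bpKernel_le z).trans (by linarith [exp_neg_abs_le_one z])

theorem integrable_exp_neg_abs : Integrable (fun z : ℝ => Real.exp (-|z|)) := by
  rw [← integrableOn_univ, ← Iic_union_Ioi (a := (0 : ℝ)), integrableOn_union]
  constructor
  · refine (integrableOn_exp_Iic 0).congr_fun (fun z hz => ?_) measurableSet_Iic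
    simp [abs_of_nonpos (mem_Iic.1 hz)]
  · refine (integrableOn_exp_neg_Ioi 0).congr_fun (fun z hz => ?_) measurableSet_Ioi
    simp [abs_of_pos (mem_Ioi.1 hz)]

theorem integral_exp_neg_abs : ∫ z : ℝ, Real.exp (-|z|) = 2 := by
  have h := integral_comp_abs (f := fun z => Real.exp (-z))
  rw [h, integral_exp_neg_Ioi_zero, mul_one]

theorem integrable_deriv_bpKernel : Integrable (deriv bpKernel) :=
  (integrable_exp_neg_abs.div_const 2).mono' measurable_deriv_bpKernel.aestronglyMeasurable
    (Eventually.of_forall abs_deriv_bpKernel_le)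

theorem integral_abs_deriv_bpKernel_le : ∫ z, |deriv bpKernel z| ≤ 1 := by
  calc _ ≤ ∫ z : ℝ, Real.exp (-|z|) / 2 :=
        integral_mono integrable_deriv_bpKernel.abs (integrable_exp_neg_abs.div_const 2)
          abs_deriv_bpKernel_le
    _ = 1 := by rw [integral_div, integral_exp_neg_abs]; norm_num

section Source

variable {v v' : ℝ → ℝ}

theorem integrable_bpSource_integrand (hv : Integrable v) (x : ℝ) :
    Integrable fun y => deriv bpKernel (x - y) * v y :=
  hv.bdd_mul (c := 1 / 2)
    (measurable_deriv_bpKernel.comp (measurable_const.sub measurable_id)).aestronglyMeasurable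
    (Eventually.of_forall fun y => abs_deriv_bpKernel_le_half (x - y))

theorem abs_bpSource_le (hv : Integrable v) (x : ℝ) : |bpSource v x| ≤ (∫ y, |v y|) / 2 := by
  calc |bpSource v x| ≤ ∫ y, |deriv bpKernel (x - y) * v y| := abs_integral_le_integral_abs
    _ ≤ ∫ y, |v y| / 2 := by
        refine integral_mono (integrable_bpSource_integrand hv x).abs (hv.abs.div_const 2)
          fun y => ?_
        simp only [abs_mul]
        have := mul_le_mul_of_nonneg_right (abs_deriv_bpKernel_le_half (x - y)) (abs_nonneg (v y))
        linarith
    _ = _ := integral_div _ _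

theorem bpSource_sub (hv : Integrable v) (hv' : Integrable v') (x : ℝ) :
    bpSource (fun y => v y - v' y) x = bpSource v x - bpSource v' x := by
  simp only [bpSource, mul_sub]
  exact integral_sub (integrable_bpSource_integrand hv x) (integrable_bpSource_integrand hv' x)

theorem abs_bpSource_sub_le (hv : Integrable v) (hv' : Integrable v') (x : ℝ) :
    |bpSource v x - bpSource v' x| ≤ (∫ y, |v y - v' y|) / 2 := by
  rw [← bpSource_sub hv hv']
  exact abs_bpSource_le (hv.sub hv') x

theorem bpSource_congr_ae (h : v =ᵐ[volume] v') (x : ℝ) : bpSource v x = bpSource v' x :=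
  integral_congr_ae (by filter_upwards [h] with y hy; rw [hy])

theorem continuous_bpSource (hv : Integrable v) : Continuous (bpSource v) := by
  rw [continuous_iff_continuousAt]
  intro x
  refine continuousAt_of_dominated (bound := fun y => 1 / 2 * |v y|)
    (Eventually.of_forall fun x => (integrable_bpSource_integrand hv x).aestronglyMeasurable)
    (Eventually.of_forall fun x => Eventually.of_forall fun y => ?_) (hv.abs.const_mul _) ?_
  · rw [norm_mul]
    exact mul_le_mul_of_nonneg_right (abs_deriv_bpKernel_le_half _) (abs_nonneg _)
  -- The kernel derivative jumps only where `y = x`, a null set of `y`.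
  · have : ∀ᵐ y : ℝ, y ≠ x := by simp [ae_iff]
    filter_upwards [this] with y hy
    have h1 : ContinuousAt (deriv bpKernel) (x - y) := by
      have hne : x - y ≠ 0 := sub_ne_zero.2 hy.symm
      have h2 : ContinuousAt (fun z : ℝ => Real.sign (x - y) * (Real.exp (-|z|) / 2)) (x - y) := by
        fun_prop
      refine h2.congr ?_
      rcases hne.lt_or_gt with h | h
      · filter_upwards [Iio_mem_nhds h] with z hz
        rw [deriv_bpKernel, Real.sign_of_neg h, Real.sign_of_neg hz]
      · filter_upwards [Ioi_mem_nhds h] with z hz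
        rw [deriv_bpKernel, Real.sign_of_pos h, Real.sign_of_pos hz]
    exact (ContinuousAt.comp (g := deriv bpKernel) (f := fun x => x - y) h1 (by fun_prop)).mul
      continuousAt_const

theorem integrable_bpSource_prod (hv : Integrable v) :
    Integrable (fun p : ℝ × ℝ => deriv bpKernel (p.1 - p.2) * v p.2) (volume.prod volume) := by
  have := hv.convolution_integrand (ContinuousLinearMap.mul ℝ ℝ) integrable_deriv_bpKernel
    (μ := volume)
  refine this.congr (Eventually.of_forall fun p => ?_)
  simp [mul_comm]

theorem integrable_bpSource (hv : Integrable v) : Integrable (bpSource v) :=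
  (integrable_bpSource_prod hv).integral_prod_left

/-- Young's inequality with `‖G'‖₁ ≤ 1`; this constant is the growth rate of the `L¹` norm. -/
theorem integral_abs_bpSource_le (hv : Integrable v) : ∫ x, |bpSource v x| ≤ ∫ x, |v x| := by
  have hp := (integrable_bpSource_prod hv).norm
  calc ∫ x, |bpSource v x| ≤ ∫ x, ∫ y, ‖deriv bpKernel (x - y) * v y‖ :=
        integral_mono (integrable_bpSource hv).abs hp.integral_prod_left
          fun x => norm_integral_le_integral_norm (fun y => deriv bpKernel (x - y) * v y)
    _ = ∫ y, ∫ x, ‖deriv bpKernel (x - y) * v y‖ := integral_integral_swap hp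
    _ ≤ ∫ y, |v y| := by
        refine integral_mono hp.integral_prod_right hv.abs fun y => ?_
        simp only [norm_mul, Real.norm_eq_abs]
        rw [integral_mul_const, integral_sub_right_eq_self (fun x => |deriv bpKernel x|) y]
        exact mul_le_of_le_one_left (abs_nonneg _) integral_abs_deriv_bpKernel_le

theorem abs_exp_neg_abs_sub_le (z w : ℝ) :
    |Real.exp (-|z|) - Real.exp (-|w|)| ≤ |z - w| := by
  have key : ∀ a b : ℝ, 0 ≤ a → a ≤ b → |Real.exp (-a) - Real.exp (-b)| ≤ b - a := by
    intro a b ha hab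
    have h1 : Real.exp (-b) ≤ Real.exp (-a) := Real.exp_le_exp.2 (by linarith)
    rw [abs_of_nonneg (by linarith)]
    have h2 := Real.add_one_le_exp (-(b - a))
    have h3 : Real.exp (-b) = Real.exp (-a) * Real.exp (-(b - a)) := by
      rw [← Real.exp_add]; congr 1; ring
    have h4 : Real.exp (-a) ≤ 1 := by simpa using ha
    have h5 := Real.exp_pos (-a)
    rw [h3]
    nlinarith
  rcases le_total |z| |w| with h | h
  · refine (key _ _ (abs_nonneg _) h).trans ?_
    rw [abs_sub_comm]; exact abs_sub_abs_le_abs_sub _ _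
  · rw [abs_sub_comm]
    exact (key _ _ (abs_nonneg _) h).trans (abs_sub_abs_le_abs_sub _ _)

/-- For `y` between `x` and `x'` the two kernel values differ by at most `1`, which costs `C` times
the distance. For the other `y` no jump is crossed and `e^(-|z|)/2` is `1/2`-Lipschitz, which costs
half the `L¹` norm. No continuity of `v` is needed. -/
theorem abs_bpSource_sub_le_mul (hv : Integrable v) {C : ℝ} (hC : ∀ᵐ y, |v y| ≤ C) {x x' : ℝ}
    (hx : x ≤ x') :
    |bpSource v x' - bpSource v x| ≤ (C + (∫ y, |v y|) / 2) * (x' - x) := by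
  have hd : bpSource v x' - bpSource v x
      = ∫ y, (deriv bpKernel (x' - y) - deriv bpKernel (x - y)) * v y := by
    simp only [bpSource, sub_mul]
    exact (integral_sub (integrable_bpSource_integrand hv x')
      (integrable_bpSource_integrand hv x)).symm
  have hint : Integrable (fun y => (deriv bpKernel (x' - y) - deriv bpKernel (x - y)) * v y) := by
    simp only [sub_mul]
    exact (integrable_bpSource_integrand hv x').sub (integrable_bpSource_integrand hv x)
  have hi1 : Integrable (indicator (Icc x x') fun _ => C) := by
    rw [integrable_indicator_iff measurableSet_Icc]
    exact integrableOn_const (by simp) (by simp)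
  have hi2 : Integrable fun y => (x' - x) / 2 * |v y| := hv.abs.const_mul _
  rw [hd]
  calc _ ≤ ∫ y, |(deriv bpKernel (x' - y) - deriv bpKernel (x - y)) * v y| :=
        abs_integral_le_integral_abs
    _ ≤ ∫ y, (indicator (Icc x x') (fun _ => C) y + (x' - x) / 2 * |v y|) := by
        refine integral_mono_ae hint.abs (hi1.add hi2) ?_
        filter_upwards [hC] with y hy
        rw [abs_mul]
        by_cases hmem : y ∈ Icc x x'
        · rw [indicator_of_mem hmem]
          have h1 := abs_sub (deriv bpKernel (x' - y)) (deriv bpKernel (x - y))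
          have h2 := abs_deriv_bpKernel_le_half (x' - y)
          have h3 := abs_deriv_bpKernel_le_half (x - y)
          have h4 : |deriv bpKernel (x' - y) - deriv bpKernel (x - y)| * |v y| ≤ 1 * |v y| := by
            gcongr
            linarith
          have h5 : 0 ≤ (x' - x) / 2 * |v y| := by
            have := sub_nonneg.2 hx
            positivity
          linarith
        · rw [indicator_of_notMem hmem, zero_add]
          gcongr
          have hs : Real.sign (x' - y) = Real.sign (x - y) := by
            rw [mem_Icc, not_and_or, not_le, not_le] at hmem
            rcases hmem with h | h
            · rw [Real.sign_of_pos (by linarith), Real.sign_of_pos (by linarith)]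
            · rw [Real.sign_of_neg (by linarith), Real.sign_of_neg (by linarith)]
          rw [deriv_bpKernel, deriv_bpKernel, hs, ← mul_sub, abs_mul]
          have h1 := abs_exp_neg_abs_sub_le (x' - y) (x - y)
          rw [show x' - y - (x - y) = x' - x by ring, abs_of_nonneg (sub_nonneg.2 hx)] at h1
          have h2 : |Real.exp (-|x' - y|) / 2 - Real.exp (-|x - y|) / 2| ≤ (x' - x) / 2 := by
            rw [← sub_div, abs_div, abs_two]
            linarith
          exact (mul_le_of_le_one_left (abs_nonneg _) (abs_realSign_le _)).trans h2
    _ = _ := by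
        rw [integral_add hi1 hi2, integral_indicator measurableSet_Icc, setIntegral_const,
          integral_const_mul]
        simp only [Measure.real, Real.volume_Icc, smul_eq_mul]
        rw [ENNReal.toReal_ofReal (sub_nonneg.2 hx)]
        ring

/-- The potential `G * v`. -/
noncomputable def bpPotential (v : ℝ → ℝ) (x : ℝ) : ℝ := ∫ y, bpKernel (x - y) * v y

theorem continuous_bpKernel : Continuous bpKernel := by
  unfold bpKernel; fun_prop

theorem abs_bpKernel_le (z : ℝ) : |bpKernel z| ≤ 1 / 2 := by
  rw [bpKernel, abs_mul, Real.abs_exp]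
  have := exp_neg_abs_le_one z
  norm_num

theorem integrable_bpPotential_integrand (hv : Integrable v) (x : ℝ) :
    Integrable fun y => bpKernel (x - y) * v y :=
  hv.bdd_mul (c := 1 / 2)
    (continuous_bpKernel.comp (continuous_const.sub continuous_id)).aestronglyMeasurable
    (Eventually.of_forall fun y => abs_bpKernel_le (x - y))

theorem abs_bpPotential_le (hv : Integrable v) (x : ℝ) :
    |bpPotential v x| ≤ (∫ y, |v y|) / 2 := by
  calc |bpPotential v x| ≤ ∫ y, |bpKernel (x - y) * v y| := abs_integral_le_integral_abs
    _ ≤ ∫ y, |v y| / 2 := by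
        refine integral_mono (integrable_bpPotential_integrand hv x).abs (hv.abs.div_const 2)
          fun y => ?_
        simp only [abs_mul]
        have := mul_le_mul_of_nonneg_right (abs_bpKernel_le (x - y)) (abs_nonneg (v y))
        linarith
    _ = _ := integral_div _ _

theorem abs_bpPotential_sub_le (hv : Integrable v) (hv' : Integrable v') (x : ℝ) :
    |bpPotential v x - bpPotential v' x| ≤ (∫ y, |v y - v' y|) / 2 := by
  have h : bpPotential (fun y => v y - v' y) x = bpPotential v x - bpPotential v' x := by
    simp only [bpPotential, mul_sub]
    exact integral_sub (integrable_bpPotential_integrand hv x)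
      (integrable_bpPotential_integrand hv' x)
  rw [← h]
  exact abs_bpPotential_le (hv.sub hv') x

theorem continuous_bpPotential (hv : Integrable v) : Continuous (bpPotential v) := by
  refine continuous_of_dominated (bound := fun y => 1 / 2 * |v y|)
    (fun x => (integrable_bpPotential_integrand hv x).aestronglyMeasurable)
    (fun x => Eventually.of_forall fun y => ?_) (hv.abs.const_mul _)
    (Eventually.of_forall fun y => ?_)
  · rw [norm_mul]
    exact mul_le_mul_of_nonneg_right (abs_bpKernel_le _) (abs_nonneg _)
  · exact (continuous_bpKernel.comp (continuous_id.sub continuous_const)).mul continuous_const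

/-- This is `G'' = δ₀ + G`. Splitting at `x` writes the source as `(e^(-x) A - e^x B) / 2` with
half-line integrals `A` and `B`; differentiating the exponentials gives the potential, and
differentiating `A` and `B` gives `v x / 2` each. -/
theorem hasDerivAt_bpSource (hv : Integrable v) (hc : Continuous v) (x : ℝ) :
    HasDerivAt (bpSource v) (v x + bpPotential v x) x := by
  have hA : ∀ x, IntegrableOn (fun y => Real.exp y * v y) (Iic x) := fun x =>
    hv.integrableOn.bdd_mul (c := Real.exp x) Real.continuous_exp.aestronglyMeasurable
      (by
        filter_upwards [ae_restrict_mem measurableSet_Iic] with y hy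
        rw [Real.norm_eq_abs, Real.abs_exp]; exact Real.exp_le_exp.2 hy)
  have hB : ∀ x, IntegrableOn (fun y => Real.exp (-y) * v y) (Ioi x) := fun x =>
    hv.integrableOn.bdd_mul (c := Real.exp (-x))
      (Real.continuous_exp.comp continuous_neg).aestronglyMeasurable
      (by
        filter_upwards [ae_restrict_mem measurableSet_Ioi] with y hy
        rw [Real.norm_eq_abs, Real.abs_exp]
        exact Real.exp_le_exp.2 (neg_le_neg (le_of_lt hy)))
  set A : ℝ → ℝ := fun x => ∫ y in Iic x, Real.exp y * v y with hAdef
  set B : ℝ → ℝ := fun x => ∫ y in Ioi x, Real.exp (-y) * v y with hBdef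
  have hsplit : ∀ (k : ℝ → ℝ → ℝ) x, Integrable (fun y => k x y * v y) →
      ∫ y, k x y * v y = (∫ y in Iic x, k x y * v y) + ∫ y in Ioi x, k x y * v y := fun k x hk => by
    rw [← setIntegral_univ, ← Iic_union_Ioi (a := x),
      setIntegral_union (Iic_disjoint_Ioi le_rfl) measurableSet_Ioi hk.integrableOn hk.integrableOn]
  have hne : ∀ x : ℝ, ∀ᵐ y : ℝ ∂(volume.restrict (Iic x)), y ≠ x := fun x =>
    ae_restrict_of_ae (by simp [ae_iff])
  have hS : ∀ x, bpSource v x = (Real.exp (-x) * A x - Real.exp x * B x) / 2 := fun x => by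
    rw [bpSource, hsplit (fun x y => deriv bpKernel (x - y)) x (integrable_bpSource_integrand hv x)]
    have e1 : ∫ y in Iic x, deriv bpKernel (x - y) * v y = Real.exp (-x) / 2 * A x := by
      rw [hAdef, ← integral_const_mul]
      refine integral_congr_ae ?_
      filter_upwards [hne x, ae_restrict_mem measurableSet_Iic] with y hy hy'
      have : 0 < x - y := sub_pos.2 (lt_of_le_of_ne hy' hy)
      rw [deriv_bpKernel, Real.sign_of_pos this, abs_of_pos this,
        show -(x - y) = -x + y by ring, Real.exp_add]
      ring
    have e2 : ∫ y in Ioi x, deriv bpKernel (x - y) * v y = -(Real.exp x / 2) * B x := by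
      rw [hBdef, ← integral_const_mul]
      refine setIntegral_congr_fun measurableSet_Ioi fun y hy => ?_
      have : x - y < 0 := sub_neg.2 hy
      simp only [deriv_bpKernel, Real.sign_of_neg this, abs_of_neg this]
      rw [show -(-(x - y)) = x + -y by ring, Real.exp_add]
      ring
    rw [e1, e2]; ring
  have hP : bpPotential v x = -(Real.exp (-x) * A x + Real.exp x * B x) / 2 := by
    rw [bpPotential, hsplit (fun x y => bpKernel (x - y)) x (integrable_bpPotential_integrand hv x)]
    have e1 : ∫ y in Iic x, bpKernel (x - y) * v y = -(Real.exp (-x) / 2) * A x := by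
      rw [hAdef, ← integral_const_mul]
      refine setIntegral_congr_fun measurableSet_Iic fun y hy => ?_
      have : 0 ≤ x - y := sub_nonneg.2 hy
      simp only [bpKernel, abs_of_nonneg this]
      rw [show -(x - y) = -x + y by ring, Real.exp_add]
      ring
    have e2 : ∫ y in Ioi x, bpKernel (x - y) * v y = -(Real.exp x / 2) * B x := by
      rw [hBdef, ← integral_const_mul]
      refine setIntegral_congr_fun measurableSet_Ioi fun y hy => ?_
      have : x - y < 0 := sub_neg.2 hy
      simp only [bpKernel, abs_of_neg this]
      rw [show -(-(x - y)) = x + -y by ring, Real.exp_add]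
      ring
    rw [e1, e2]; ring
  have hcA : Continuous fun y => Real.exp y * v y := by fun_prop
  have hcB : Continuous fun y => Real.exp (-y) * v y := by fun_prop
  have hA' : HasDerivAt A (Real.exp x * v x) x := by
    have h1 := (intervalIntegral.integral_hasDerivAt_right (hcA.intervalIntegrable 0 x)
      (hcA.stronglyMeasurableAtFilter _ _) hcA.continuousAt).const_add (A 0)
    refine h1.congr_of_eventuallyEq (Eventually.of_forall fun z => ?_)
    have := intervalIntegral.integral_Iic_sub_Iic (hA 0) (hA z)
    simp only [hAdef]
    linarith
  have hB' : HasDerivAt B (-(Real.exp (-x) * v x)) x := by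
    have h1 := (intervalIntegral.integral_hasDerivAt_right (hcB.intervalIntegrable 0 x)
      (hcB.stronglyMeasurableAtFilter _ _) hcB.continuousAt).const_sub (B 0)
    refine h1.congr_of_eventuallyEq (Eventually.of_forall fun z => ?_)
    have := intervalIntegral.integral_interval_add_Ioi (hB 0) (hB z)
    simp only [hBdef]
    linarith
  have hfun : bpSource v = fun x => (Real.exp (-x) * A x - Real.exp x * B x) / 2 := funext hS
  rw [hfun]
  have he : HasDerivAt (fun x : ℝ => Real.exp (-x)) (Real.exp (-x) * -1) x := (hasDerivAt_neg x).exp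
  refine (((he.mul hA').sub ((Real.hasDerivAt_exp x).mul hB')).div_const 2).congr_deriv ?_
  rw [hP]
  have hee : Real.exp (-x) * Real.exp x = 1 := by rw [← Real.exp_add]; simp
  linear_combination v x * hee

end Source

section SourceFamily

variable {u : ℝ → ℝ → ℝ} {ubar : ℝ → ℝ}

/-- The source depends on the slice through its `L¹` norm, uniformly in `x`, so time continuity in
`L¹` and continuity of each single slice combine to joint continuity. -/
theorem IsWeakEntropySolution.continuousOn_bpSource (hu : IsWeakEntropySolution ubar u) :
    ContinuousOn (fun p : ℝ × ℝ => bpSource (u p.1) p.2) (Ici 0 ×ˢ univ) := by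
  rintro ⟨t, x⟩ ⟨ht, -⟩
  have h1 : Tendsto (fun p : ℝ × ℝ => bpSource (u p.1) p.2 - bpSource (u t) p.2)
      (𝓝[Ici 0 ×ˢ univ] (t, x)) (𝓝 0) := by
    have h2 : Tendsto (fun p : ℝ × ℝ => (∫ y, |u p.1 y - u t y|) / 2)
        (𝓝[Ici 0 ×ˢ univ] (t, x)) (𝓝 0) := by
      have h3 := (hu.continuous_L1 t ht).div_const 2
      rw [zero_div] at h3
      refine h3.comp ?_
      rw [nhdsWithin_prod_eq]
      exact tendsto_fst
    refine squeeze_zero_norm' ?_ h2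
    filter_upwards [self_mem_nhdsWithin] with p hp
    exact abs_bpSource_sub_le (hu.integrable _ hp.1) (hu.integrable _ ht) _
  have h4 : Tendsto (fun p : ℝ × ℝ => bpSource (u t) p.2) (𝓝[Ici 0 ×ˢ univ] (t, x))
      (𝓝 (bpSource (u t) x)) :=
    (((continuous_bpSource (hu.integrable t ht)).comp continuous_snd).tendsto (t, x)).mono_left
      nhdsWithin_le_nhds
  have h5 := h1.add h4
  simp only [sub_add_cancel, zero_add] at h5
  exact h5

theorem IsWeakEntropySolution.continuousOn_bpPotential (hu : IsWeakEntropySolution ubar u) :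
    ContinuousOn (fun p : ℝ × ℝ => bpPotential (u p.1) p.2) (Ici 0 ×ˢ univ) := by
  rintro ⟨t, x⟩ ⟨ht, -⟩
  have h1 : Tendsto (fun p : ℝ × ℝ => bpPotential (u p.1) p.2 - bpPotential (u t) p.2)
      (𝓝[Ici 0 ×ˢ univ] (t, x)) (𝓝 0) := by
    have h2 : Tendsto (fun p : ℝ × ℝ => (∫ y, |u p.1 y - u t y|) / 2)
        (𝓝[Ici 0 ×ˢ univ] (t, x)) (𝓝 0) := by
      have h3 := (hu.continuous_L1 t ht).div_const 2
      rw [zero_div] at h3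
      refine h3.comp ?_
      rw [nhdsWithin_prod_eq]
      exact tendsto_fst
    refine squeeze_zero_norm' ?_ h2
    filter_upwards [self_mem_nhdsWithin] with p hp
    exact abs_bpPotential_sub_le (hu.integrable _ hp.1) (hu.integrable _ ht) _
  have h4 : Tendsto (fun p : ℝ × ℝ => bpPotential (u t) p.2) (𝓝[Ici 0 ×ˢ univ] (t, x))
      (𝓝 (bpPotential (u t) x)) :=
    (((continuous_bpPotential (hu.integrable t ht)).comp continuous_snd).tendsto (t, x)).mono_left
      nhdsWithin_le_nhds
  have h5 := h1.add h4
  simp only [sub_add_cancel, zero_add] at h5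
  exact h5

end SourceFamily


/-! ### Mollified modulus and sign -/

/-- A sequence of even bumps on the line shrinking to the origin. -/
noncomputable def shrinkingBump (n : ℕ) : ContDiffBump (0 : ℝ) :=
  ⟨1 / (2 * (n + 1)), 1 / (n + 1), by positivity, by
    apply one_div_lt_one_div_of_lt
    · positivity
    · linarith [n.cast_nonneg (α := ℝ)]⟩

/-- The `n`-th mollifier. -/
noncomputable def mollifier (n : ℕ) : ℝ → ℝ := (shrinkingBump n).normed volume

theorem mollifier_nonneg (n : ℕ) (z : ℝ) : 0 ≤ mollifier n z := (shrinkingBump n).nonneg_normed z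

theorem contDiff_mollifier (n : ℕ) : ContDiff ℝ 1 (mollifier n) :=
  (shrinkingBump n).contDiff_normed (n := 1)

theorem hasCompactSupport_mollifier (n : ℕ) : HasCompactSupport (mollifier n) :=
  (shrinkingBump n).hasCompactSupport_normed

theorem integral_mollifier (n : ℕ) : ∫ z, mollifier n z = 1 := (shrinkingBump n).integral_normed

theorem integrable_mollifier (n : ℕ) : Integrable (mollifier n) :=
  (shrinkingBump n).integrable_normed

theorem mollifier_neg (n : ℕ) (z : ℝ) : mollifier n (-z) = mollifier n z :=
  (shrinkingBump n).normed_neg z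

theorem shrinkingBump_rOut_le_one (n : ℕ) : (shrinkingBump n).rOut ≤ 1 := by
  change 1 / ((n : ℝ) + 1) ≤ 1
  rw [div_le_one (by positivity)]
  linarith [n.cast_nonneg (α := ℝ)]

theorem abs_lt_one_of_mollifier_ne_zero {n : ℕ} {z : ℝ} (h : mollifier n z ≠ 0) : |z| < 1 := by
  have h1 : z ∈ Function.support (mollifier n) := h
  rw [mollifier, ContDiffBump.support_normed_eq, mem_ball_zero_iff] at h1
  exact h1.trans_le (shrinkingBump_rOut_le_one n)

theorem abs_le_one_of_deriv_mollifier_ne_zero {n : ℕ} {z : ℝ} (h : deriv (mollifier n) z ≠ 0) :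
    |z| ≤ 1 := by
  have h1 : z ∈ tsupport (mollifier n) := support_deriv_subset h
  rw [mollifier, ContDiffBump.tsupport_normed_eq, mem_closedBall_zero_iff] at h1
  exact h1.trans (shrinkingBump_rOut_le_one n)

theorem integrable_mul_mollifier {g : ℝ → ℝ} (hg : Measurable g) {C : ℝ}
    (hC : ∀ z, |z| < 1 → |g z| ≤ C) (n : ℕ) : Integrable fun z => g z * mollifier n z := by
  refine ((integrable_mollifier n).const_mul C).mono'
    (hg.aestronglyMeasurable.mul (contDiff_mollifier n).continuous.aestronglyMeasurable)
    (Eventually.of_forall fun z => ?_)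
  rw [Real.norm_eq_abs, abs_mul, abs_of_nonneg (mollifier_nonneg n z)]
  by_cases h : mollifier n z = 0
  · simp [h]
  · exact mul_le_mul_of_nonneg_right (hC z (abs_lt_one_of_mollifier_ne_zero h))
      (mollifier_nonneg n z)

theorem abs_integral_mul_mollifier_le {g : ℝ → ℝ} (hg : Measurable g) {C : ℝ}
    (hC : ∀ z, |z| < 1 → |g z| ≤ C) (n : ℕ) : |∫ z, g z * mollifier n z| ≤ C := by
  calc _ ≤ ∫ z, |g z * mollifier n z| := abs_integral_le_integral_abs
    _ ≤ ∫ z, C * mollifier n z := by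
        refine integral_mono (integrable_mul_mollifier hg hC n).abs
          ((integrable_mollifier n).const_mul C) fun z => ?_
        simp only
        rw [abs_mul, abs_of_nonneg (mollifier_nonneg n z)]
        by_cases h : mollifier n z = 0
        · simp [h]
        · exact mul_le_mul_of_nonneg_right (hC z (abs_lt_one_of_mollifier_ne_zero h))
            (mollifier_nonneg n z)
    _ = C := by rw [integral_const_mul, integral_mollifier, mul_one]

theorem tendsto_integral_mul_mollifier {g : ℝ → ℝ} (hg : Measurable g) (hc : ContinuousAt g 0) :
    Tendsto (fun n => ∫ z, g z * mollifier n z) atTop (𝓝 (g 0)) := by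
  have hr : Tendsto (fun n => (shrinkingBump n).rOut) atTop (𝓝 0) :=
    tendsto_one_div_add_atTop_nhds_zero_nat
  have h1 : Tendsto (fun z : ℝ => g (-z)) (𝓝 0) (𝓝 (g 0)) := by
    have : ContinuousAt (fun z : ℝ => g (-z)) 0 :=
      ContinuousAt.comp (g := g) (by simpa using hc) continuous_neg.continuousAt
    simpa [ContinuousAt] using this
  have h2 := ContDiffBump.convolution_tendsto_right (μ := volume) (φ := shrinkingBump)
    (g := fun _ z => g (-z)) (k := fun _ => 0) (x₀ := 0) (z₀ := g 0) hr
    (Eventually.of_forall fun _ => (hg.comp measurable_neg).aestronglyMeasurable)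
    (h1.comp tendsto_snd) tendsto_const_nhds
  refine h2.congr fun n => ?_
  simp only [MeasureTheory.convolution, ContinuousLinearMap.lsmul_apply, smul_eq_mul, zero_sub,
    neg_neg]
  exact integral_congr_ae (Eventually.of_forall fun z => mul_comm _ _)

/-- The mollified modulus. -/
noncomputable def mollAbs (n : ℕ) (c : ℝ) : ℝ := ∫ z, |c - z| * mollifier n z

/-- The first moment of the mollified modulus. -/
noncomputable def mollMoment (n : ℕ) (c : ℝ) : ℝ := ∫ z, |c - z| * z * mollifier n z

/-- The mollified sign. -/
noncomputable def mollSign (n : ℕ) (c : ℝ) : ℝ := ∫ z, Real.sign (c - z) * mollifier n z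

theorem measurable_sign_sub (c : ℝ) : Measurable fun z : ℝ => Real.sign (c - z) :=
  measurable_realSign.comp (measurable_const.sub measurable_id)

theorem abs_mollAbs_le (n : ℕ) (c : ℝ) : |mollAbs n c| ≤ |c| + 1 :=
  abs_integral_mul_mollifier_le (by fun_prop) (fun z hz => by
    rw [abs_abs]; linarith [abs_sub c z]) n

theorem abs_mollMoment_le (n : ℕ) (c : ℝ) : |mollMoment n c| ≤ |c| + 1 :=
  abs_integral_mul_mollifier_le (by fun_prop) (fun z hz => by
    rw [abs_mul, abs_abs]
    have h1 := abs_sub c z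
    have h2 := mul_le_mul_of_nonneg_left hz.le (abs_nonneg (c - z))
    linarith) n

theorem abs_mollSign_le (n : ℕ) (c : ℝ) : |mollSign n c| ≤ 1 :=
  abs_integral_mul_mollifier_le (measurable_sign_sub c) (fun _ _ => abs_realSign_le _) n

theorem tendsto_mollAbs (c : ℝ) : Tendsto (fun n => mollAbs n c) atTop (𝓝 |c|) := by
  have := tendsto_integral_mul_mollifier (g := fun z => |c - z|) (by fun_prop) (by fun_prop)
  simpa [mollAbs, mollMoment] using this

theorem tendsto_mollMoment (c : ℝ) : Tendsto (fun n => mollMoment n c) atTop (𝓝 0) := by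
  have := tendsto_integral_mul_mollifier (g := fun z => |c - z| * z) (by fun_prop) (by fun_prop)
  simpa [mollAbs, mollMoment] using this

theorem tendsto_mollSign (c : ℝ) : Tendsto (fun n => mollSign n c) atTop (𝓝 (Real.sign c)) := by
  rcases eq_or_ne c 0 with rfl | hc
  -- Evenness of the mollifier makes the value at `0` exactly `Real.sign 0 = 0`, so the mollified
  -- signs converge everywhere, with no exceptional set where `u = w`.
  · have : ∀ n, mollSign n 0 = 0 := fun n => by
      have h1 : mollSign n 0 = -mollSign n 0 := by
        conv_lhs => rw [mollSign, ← integral_neg_eq_self]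
        rw [mollSign, ← integral_neg]
        refine integral_congr_ae (Eventually.of_forall fun z => ?_)
        simp only [mollifier_neg, zero_sub, neg_neg, Real.sign_neg, neg_mul]
      linarith
    simp [this]
  · have hcont : ContinuousAt (fun z : ℝ => Real.sign (c - z)) 0 := by
      refine (continuousAt_const (y := Real.sign c)).congr ?_
      have h2 : ContinuousAt (fun z : ℝ => c - z) 0 := by fun_prop
      rcases hc.lt_or_gt with h | h
      · filter_upwards [h2.eventually_lt_const (by simpa using h)] with z hz
        rw [Real.sign_of_neg h, Real.sign_of_neg hz]
      · filter_upwards [h2.eventually_const_lt (by simpa using h)] with z hz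
        rw [Real.sign_of_pos h, Real.sign_of_pos hz]
    simpa [mollSign] using tendsto_integral_mul_mollifier (measurable_sign_sub c) hcont

/-- Integration by parts on each side of `c`, where the boundary term `(c - z) h z` vanishes. -/
theorem integral_abs_sub_mul_deriv {h : ℝ → ℝ} (hh : ContDiff ℝ 1 h) (hs : HasCompactSupport h)
    (c : ℝ) : ∫ z, |c - z| * deriv h z = ∫ z, Real.sign (c - z) * h z := by
  have hg : ContDiff ℝ 1 fun z => (c - z) * h z := (contDiff_const.sub contDiff_id).mul hh
  have hgs : HasCompactSupport fun z => (c - z) * h z := hs.mul_left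
  have hd : ∀ z, deriv (fun z => (c - z) * h z) z = (c - z) * deriv h z - h z := fun z => by
    have h1 : HasDerivAt (fun z => c - z) (-1) z := (hasDerivAt_id z).const_sub c
    refine ((h1.mul (hh.differentiable one_ne_zero z).hasDerivAt).congr_deriv ?_).deriv
    ring
  have e1 := HasCompactSupport.integral_Iic_deriv_eq hg hgs c
  have e2 := HasCompactSupport.integral_Ioi_deriv_eq hg hgs c
  simp only [hd, sub_self, zero_mul, neg_zero] at e1 e2
  have hi1 : Integrable fun z => (c - z) * deriv h z :=
    Continuous.integrable_of_hasCompactSupport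
      ((continuous_const.sub continuous_id).mul (hh.continuous_deriv le_rfl)) hs.deriv.mul_left
  have hi2 : Integrable h := hh.continuous.integrable_of_hasCompactSupport hs
  rw [integral_sub hi1.integrableOn hi2.integrableOn] at e1 e2
  have hsplit : ∀ g : ℝ → ℝ, Integrable g → ∫ z, g z = (∫ z in Iic c, g z) + ∫ z in Ioi c, g z :=
    fun g hg => by
      rw [← setIntegral_univ, ← Iic_union_Ioi (a := c),
        setIntegral_union (Iic_disjoint_Ioi le_rfl) measurableSet_Ioi hg.integrableOn
          hg.integrableOn]
  have hi3 : Integrable fun z => |c - z| * deriv h z := by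
    refine (hi1.norm).mono' ?_ (Eventually.of_forall fun z => ?_)
    · exact ((continuous_const.sub continuous_id).abs.mul
        (hh.continuous_deriv le_rfl)).aestronglyMeasurable
    · simp
  have hi4 : Integrable fun z => Real.sign (c - z) * h z :=
    hi2.bdd_mul (c := 1) (measurable_sign_sub c).aestronglyMeasurable
      (Eventually.of_forall fun z => abs_realSign_le _)
  rw [hsplit _ hi3, hsplit _ hi4]
  have f1 : ∫ z in Iic c, |c - z| * deriv h z = ∫ z in Iic c, (c - z) * deriv h z :=
    setIntegral_congr_fun measurableSet_Iic fun z hz => by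
      simp only [abs_of_nonneg (sub_nonneg.2 (mem_Iic.1 hz))]
  have f2 : ∫ z in Ioi c, |c - z| * deriv h z = -∫ z in Ioi c, (c - z) * deriv h z := by
    rw [← integral_neg]
    exact setIntegral_congr_fun measurableSet_Ioi fun z hz => by
      simp only [abs_of_neg (sub_neg.2 (mem_Ioi.1 hz)), neg_mul]
  have f3 : ∫ z in Iic c, Real.sign (c - z) * h z = ∫ z in Iic c, h z := by
    refine integral_congr_ae ?_
    filter_upwards [ae_restrict_of_ae (show ∀ᵐ z : ℝ, z ≠ c by simp [ae_iff]),
      ae_restrict_mem measurableSet_Iic] with z hz hz'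
    rw [Real.sign_of_pos (sub_pos.2 (lt_of_le_of_ne hz' hz)), one_mul]
  have f4 : ∫ z in Ioi c, Real.sign (c - z) * h z = -∫ z in Ioi c, h z := by
    rw [← integral_neg]
    exact setIntegral_congr_fun measurableSet_Ioi fun z hz => by
      simp only [Real.sign_of_neg (sub_neg.2 (mem_Ioi.1 hz)), neg_mul, one_mul]
  rw [f1, f2, f3, f4]
  linarith

theorem integral_abs_sub_mul_deriv_mollifier (n : ℕ) (c : ℝ) :
    ∫ z, |c - z| * deriv (mollifier n) z = mollSign n c :=
  integral_abs_sub_mul_deriv (contDiff_mollifier n) (hasCompactSupport_mollifier n) c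

theorem integrable_abs_sub_mul_deriv_mollifier (n : ℕ) (c : ℝ) :
    Integrable fun z => |c - z| * deriv (mollifier n) z :=
  Continuous.integrable_of_hasCompactSupport
    ((continuous_const.sub continuous_id).abs.mul ((contDiff_mollifier n).continuous_deriv le_rfl))
    (hasCompactSupport_mollifier n).deriv.mul_left

theorem integrable_abs_sub_mul_id_mul_deriv_mollifier (n : ℕ) (c : ℝ) :
    Integrable fun z => |c - z| * z * deriv (mollifier n) z :=
  Continuous.integrable_of_hasCompactSupport
    (((continuous_const.sub continuous_id).abs.mul continuous_id).mul
      ((contDiff_mollifier n).continuous_deriv le_rfl))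
    (hasCompactSupport_mollifier n).deriv.mul_left

theorem integrable_mollAbs (n : ℕ) (c : ℝ) : Integrable fun z => |c - z| * mollifier n z :=
  integrable_mul_mollifier (C := |c| + 1) (by fun_prop) (fun z hz => by
    rw [abs_abs]; linarith [abs_sub c z]) n

theorem integrable_mollMoment (n : ℕ) (c : ℝ) :
    Integrable fun z => |c - z| * z * mollifier n z :=
  integrable_mul_mollifier (C := |c| + 1) (by fun_prop) (fun z hz => by
    rw [abs_mul, abs_abs]
    have h1 := abs_sub c z
    have h2 := mul_le_mul_of_nonneg_left hz.le (abs_nonneg (c - z))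
    linarith) n

theorem integrable_mollSign (n : ℕ) (c : ℝ) :
    Integrable fun z => Real.sign (c - z) * mollifier n z :=
  integrable_mul_mollifier (C := 1) (measurable_sign_sub c) (fun _ _ => abs_realSign_le _) n

theorem realSign_mul_self (x : ℝ) : Real.sign x * x = |x| := by
  rcases lt_trichotomy x 0 with h | rfl | h
  · rw [Real.sign_of_neg h, abs_of_neg h]; ring
  · simp
  · rw [Real.sign_of_pos h, abs_of_pos h]; ring

/-- Integration by parts against `z` times the mollifier, with `z sign (c - z) = c sign (c - z) - |c
- z|`. -/
theorem integral_abs_sub_mul_id_mul_deriv_mollifier (n : ℕ) (c : ℝ) :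
    ∫ z, |c - z| * z * deriv (mollifier n) z = c * mollSign n c - 2 * mollAbs n c := by
  have h1 := integral_abs_sub_mul_deriv (h := fun z => z * mollifier n z)
    (contDiff_id.mul (contDiff_mollifier n)) (hasCompactSupport_mollifier n).mul_left c
  have hd : ∀ z, deriv (fun z => z * mollifier n z) z = mollifier n z + z * deriv (mollifier n) z :=
    fun z => by
      refine (((hasDerivAt_id z).mul
        ((contDiff_mollifier n).differentiable one_ne_zero z).hasDerivAt).congr_deriv ?_).deriv
      simp
  have e1 : ∫ z, |c - z| * deriv (fun z => z * mollifier n z) z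
      = mollAbs n c + ∫ z, |c - z| * z * deriv (mollifier n) z := by
    rw [mollAbs, ← integral_add (integrable_mollAbs n c)
      (integrable_abs_sub_mul_id_mul_deriv_mollifier n c)]
    refine integral_congr_ae (Eventually.of_forall fun z => ?_)
    simp only [hd]; ring
  have e2 : ∫ z, Real.sign (c - z) * (z * mollifier n z) = c * mollSign n c - mollAbs n c := by
    rw [mollSign, mollAbs, ← integral_const_mul, ← integral_sub
      ((integrable_mollSign n c).const_mul c) (integrable_mollAbs n c)]
    refine integral_congr_ae (Eventually.of_forall fun z => ?_)
    simp only [← realSign_mul_self (c - z)]; ring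
  linarith


/-! ### Kruzkov's inequality against a `C¹` function -/

theorem realSign_mul_sq_sub_sq (v k : ℝ) :
    Real.sign (v - k) * (v ^ 2 / 2 - k ^ 2 / 2) = |v - k| * ((v + k) / 2) := by
  rw [← realSign_mul_self]; ring

/-- The substitution `z = k - w`, `c = v - w` turns the flux into `|c - z| (v + w + z) / 2`, so the
integral over `k` is an exact combination of the mollified modulus, its first moment and the
mollified sign. -/
theorem integral_mollified_entropy (n : ℕ) (v w A B S φ a b : ℝ) :
    ∫ k, (|v - k| * (A * mollifier n (k - w) - φ * (deriv (mollifier n) (k - w) * a))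
      + Real.sign (v - k) * (v ^ 2 / 2 - k ^ 2 / 2)
        * (B * mollifier n (k - w) - φ * (deriv (mollifier n) (k - w) * b))
      + Real.sign (v - k) * S * (φ * mollifier n (k - w)))
    = A * mollAbs n (v - w) + B * ((v + w) / 2 * mollAbs n (v - w) + mollMoment n (v - w) / 2)
      + (S - a) * φ * mollSign n (v - w)
      - φ * b * (v * mollSign n (v - w) - mollAbs n (v - w)) := by
  set c := v - w with hc
  set g : ℝ → ℝ := fun z =>
    (A + B * ((v + w) / 2)) * (|c - z| * mollifier n z) + B / 2 * (|c - z| * z * mollifier n z)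
    + (-(φ * a) - φ * b * ((v + w) / 2)) * (|c - z| * deriv (mollifier n) z)
    + -(φ * b / 2) * (|c - z| * z * deriv (mollifier n) z)
    + S * φ * (Real.sign (c - z) * mollifier n z) with hg
  have e1 : ∫ k, g (k - w) = ∫ z, g z := integral_sub_right_eq_self g w
  have e2 : ∫ z, g z = (A + B * ((v + w) / 2)) * mollAbs n c + B / 2 * mollMoment n c
      + (-(φ * a) - φ * b * ((v + w) / 2)) * mollSign n c
      + -(φ * b / 2) * (c * mollSign n c - 2 * mollAbs n c) + S * φ * mollSign n c := by
    rw [hg, integral_add, integral_add, integral_add, integral_add, integral_const_mul,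
      integral_const_mul, integral_const_mul, integral_const_mul, integral_const_mul,
      integral_abs_sub_mul_deriv_mollifier, integral_abs_sub_mul_id_mul_deriv_mollifier,
      ← mollAbs, ← mollMoment, ← mollSign]
    · exact (integrable_mollAbs n c).const_mul _
    · exact (integrable_mollMoment n c).const_mul _
    · exact ((integrable_mollAbs n c).const_mul _).add ((integrable_mollMoment n c).const_mul _)
    · exact (integrable_abs_sub_mul_deriv_mollifier n c).const_mul _
    · exact (((integrable_mollAbs n c).const_mul _).add
        ((integrable_mollMoment n c).const_mul _)).add
        ((integrable_abs_sub_mul_deriv_mollifier n c).const_mul _)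
    · exact (integrable_abs_sub_mul_id_mul_deriv_mollifier n c).const_mul _
    · exact ((((integrable_mollAbs n c).const_mul _).add
        ((integrable_mollMoment n c).const_mul _)).add
        ((integrable_abs_sub_mul_deriv_mollifier n c).const_mul _)).add
        ((integrable_abs_sub_mul_id_mul_deriv_mollifier n c).const_mul _)
    · exact (integrable_mollSign n c).const_mul _
  refine Eq.trans (integral_congr_ae (Eventually.of_forall fun k => ?_)) (e1.trans (e2.trans ?_))
  · simp only [hg, realSign_mul_sq_sub_sq, show c - (k - w) = v - k by rw [hc]; ring]
    ring
  · rw [hc]; ring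

section TestFunctions

variable {ψ : ℝ → ℝ} {φ w : ℝ × ℝ → ℝ} {U : Set (ℝ × ℝ)}

/-- Although `w` is `C¹` only on `U`, the product is `C¹` everywhere because it vanishes off the
support of `φ`. -/
theorem contDiff_mul_comp_sub (hU : IsOpen U) (hψ : ContDiff ℝ 1 ψ) (hφ : ContDiff ℝ 1 φ)
    (hs : tsupport φ ⊆ U) (hw : ContDiffOn ℝ 1 w U) (k : ℝ) :
    ContDiff ℝ 1 fun p => φ p * ψ (k - w p) := by
  rw [contDiff_iff_contDiffAt]
  intro p
  by_cases hp : p ∈ tsupport φ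
  · exact hφ.contDiffAt.mul (hψ.contDiffAt.comp p
      (contDiffAt_const.sub (hw.contDiffAt (hU.mem_nhds (hs hp)))))
  · refine (contDiffAt_const (c := (0 : ℝ))).congr_of_eventuallyEq ?_
    filter_upwards [notMem_tsupport_iff_eventuallyEq.1 hp] with q hq
    simp [hq]

theorem fderiv_mul_comp_sub (hU : IsOpen U) (hψ : ContDiff ℝ 1 ψ) (hφ : ContDiff ℝ 1 φ)
    (hs : tsupport φ ⊆ U) (hw : ContDiffOn ℝ 1 w U) (k : ℝ) (p e : ℝ × ℝ) :
    fderiv ℝ (fun p => φ p * ψ (k - w p)) p e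
      = fderiv ℝ φ p e * ψ (k - w p) - φ p * (deriv ψ (k - w p) * fderiv ℝ w p e) := by
  by_cases hp : p ∈ tsupport φ
  · have h1 : HasFDerivAt w (fderiv ℝ w p) p :=
      ((hw.contDiffAt (hU.mem_nhds (hs hp))).differentiableAt one_ne_zero).hasFDerivAt
    have h2 : HasFDerivAt (fun p => k - w p) (-fderiv ℝ w p) p := h1.const_sub k
    have h3 := (hψ.differentiable one_ne_zero (k - w p)).hasDerivAt.comp_hasFDerivAt p h2
    have h4 := (hφ.differentiable one_ne_zero p).hasFDerivAt.mul h3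
    have h5 : fderiv ℝ (fun p => φ p * ψ (k - w p)) p = _ := h4.fderiv
    rw [h5]
    simp
    ring
  · have h1 : (fun p => φ p * ψ (k - w p)) =ᶠ[𝓝 p] fun _ => 0 := by
      filter_upwards [notMem_tsupport_iff_eventuallyEq.1 hp] with q hq
      simp [hq]
    have h2 : φ =ᶠ[𝓝 p] fun _ => 0 := notMem_tsupport_iff_eventuallyEq.1 hp
    rw [h1.fderiv_eq, h2.fderiv_eq, h2.eq_of_nhds]
    simp

theorem continuous_fderiv_mul_comp_sub (hU : IsOpen U) (hψ : ContDiff ℝ 1 ψ) (hφ : ContDiff ℝ 1 φ)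
    (hs : tsupport φ ⊆ U) (hw : ContDiffOn ℝ 1 w U) (e : ℝ × ℝ) :
    Continuous fun q : ℝ × ℝ × ℝ => fderiv ℝ φ q.2 e * ψ (q.1 - w q.2)
      - φ q.2 * (deriv ψ (q.1 - w q.2) * fderiv ℝ w q.2 e) := by
  rw [continuous_iff_continuousAt]
  rintro ⟨k, p⟩
  by_cases hp : p ∈ tsupport φ
  · have hpU := hU.mem_nhds (hs hp)
    have c1 : ContinuousAt (fun q : ℝ × ℝ × ℝ => w q.2) (k, p) :=
      ContinuousAt.comp (g := w) (hw.contDiffAt hpU).continuousAt continuousAt_snd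
    have c2 : ContinuousAt (fun q : ℝ × ℝ × ℝ => fderiv ℝ w q.2 e) (k, p) :=
      ContinuousAt.comp (g := fun p => fderiv ℝ w p e) (x := (k, p))
        (((hw.continuousOn_fderiv_of_isOpen hU le_rfl).continuousAt hpU).clm_apply
          continuousAt_const) continuousAt_snd
    have c3 : Continuous fun q : ℝ × ℝ × ℝ => fderiv ℝ φ q.2 e :=
      ((hφ.continuous_fderiv one_ne_zero).comp continuous_snd).clm_apply continuous_const
    have c4 : ContinuousAt (fun q : ℝ × ℝ × ℝ => q.1 - w q.2) (k, p) := continuousAt_fst.sub c1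
    have c5 : ContinuousAt (fun q : ℝ × ℝ × ℝ => ψ (q.1 - w q.2)) (k, p) :=
      ContinuousAt.comp (g := ψ) hψ.continuous.continuousAt c4
    have c6 : ContinuousAt (fun q : ℝ × ℝ × ℝ => deriv ψ (q.1 - w q.2)) (k, p) :=
      ContinuousAt.comp (g := deriv ψ) (hψ.continuous_deriv le_rfl).continuousAt c4
    exact (c3.continuousAt.mul c5).sub
      ((hφ.continuous.comp continuous_snd).continuousAt.mul (c6.mul c2))
  · refine (continuousAt_const (y := (0 : ℝ))).congr ?_
    have h2 := (notMem_tsupport_iff_eventuallyEq.1 hp).eventuallyEq_nhds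
    have h3 : ∀ᶠ q : ℝ × ℝ × ℝ in 𝓝 (k, p), φ =ᶠ[𝓝 q.2] 0 :=
      (continuous_snd.tendsto ((k, p) : ℝ × ℝ × ℝ)).eventually h2
    filter_upwards [h3] with q hq
    have : fderiv ℝ φ q.2 = 0 := by rw [hq.fderiv_eq]; simp
    simp [this, hq.eq_of_nhds]

theorem continuous_mul_comp_sub (hU : IsOpen U) (hψ : ContDiff ℝ 1 ψ) (hφ : ContDiff ℝ 1 φ)
    (hs : tsupport φ ⊆ U) (hw : ContDiffOn ℝ 1 w U) :
    Continuous fun q : ℝ × ℝ × ℝ => φ q.2 * ψ (q.1 - w q.2) := by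
  rw [continuous_iff_continuousAt]
  rintro ⟨k, p⟩
  by_cases hp : p ∈ tsupport φ
  · have c1 : ContinuousAt (fun q : ℝ × ℝ × ℝ => w q.2) (k, p) :=
      ContinuousAt.comp (g := w) (hw.contDiffAt (hU.mem_nhds (hs hp))).continuousAt continuousAt_snd
    exact (hφ.continuous.comp continuous_snd).continuousAt.mul
      (ContinuousAt.comp (g := ψ) hψ.continuous.continuousAt (continuousAt_fst.sub c1))
  · refine (continuousAt_const (y := (0 : ℝ))).congr ?_
    have h3 : ∀ᶠ q : ℝ × ℝ × ℝ in 𝓝 (k, p), φ q.2 = 0 :=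
      (continuous_snd.tendsto ((k, p) : ℝ × ℝ × ℝ)).eventually
        (notMem_tsupport_iff_eventuallyEq.1 hp)
    filter_upwards [h3] with q hq
    simp [hq]

end TestFunctions

theorem exists_time_bounds {φ : ℝ × ℝ → ℝ} (hc : HasCompactSupport φ)
    (hs : tsupport φ ⊆ Ioi 0 ×ˢ univ) :
    ∃ a b : ℝ, 0 < a ∧ tsupport φ ⊆ Icc a b ×ˢ univ := by
  rcases (tsupport φ).eq_empty_or_nonempty with h | h
  · exact ⟨1, 1, one_pos, by simp [h]⟩
  · obtain ⟨p, hp, hmin⟩ := hc.exists_isMinOn h (continuous_fst (X := ℝ) (Y := ℝ)).continuousOn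
    obtain ⟨q, hq, hmax⟩ := hc.exists_isMaxOn h (continuous_fst (X := ℝ) (Y := ℝ)).continuousOn
    exact ⟨p.1, q.1, (hs hp).1, fun z hz => ⟨⟨hmin hz, hmax hz⟩, trivial⟩⟩

namespace IsWeakEntropySolution

variable {ubar : ℝ → ℝ} {u : ℝ → ℝ → ℝ}

theorem aestronglyMeasurable (hu : IsWeakEntropySolution ubar u) :
    AEStronglyMeasurable (fun p : ℝ × ℝ => u p.1 p.2) (volume.restrict (Ioi 0 ×ˢ univ)) :=
  hu.locallyIntegrable.aestronglyMeasurable.mono_set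
    (prod_mono Ioi_subset_Ici_self subset_rfl)

theorem aestronglyMeasurable_bpSource (hu : IsWeakEntropySolution ubar u) :
    AEStronglyMeasurable (fun p : ℝ × ℝ => bpSource (u p.1) p.2)
      (volume.restrict (Ioi 0 ×ˢ univ)) :=
  (hu.continuousOn_bpSource.mono (prod_mono Ioi_subset_Ici_self subset_rfl)).aestronglyMeasurable
    (measurableSet_Ioi.prod MeasurableSet.univ)

theorem ae_bound_of_compact (hu : IsWeakEntropySolution ubar u) {φ : ℝ × ℝ → ℝ}
    (hc : HasCompactSupport φ) (hs : tsupport φ ⊆ Ioi 0 ×ˢ univ) :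
    ∃ C, ∀ᵐ p : ℝ × ℝ ∂(volume.restrict (Ioi 0 ×ˢ univ)), p ∈ tsupport φ → |u p.1 p.2| ≤ C := by
  obtain ⟨a, b, ha, hab⟩ := exists_time_bounds hc hs
  obtain ⟨C, hC⟩ := hu.locallyBounded a b ha
  rw [ae_restrict_iff' (measurableSet_Icc.prod MeasurableSet.univ)] at hC
  refine ⟨C, ae_restrict_of_ae ?_⟩
  filter_upwards [hC] with p hp hps using hp (hab hps)

/-- Kruzkov's inequality with the constant replaced by a `C¹` function. -/
theorem entropy_of_contDiffOn (hu : IsWeakEntropySolution ubar u) {U : Set (ℝ × ℝ)}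
    (hU : IsOpen U) (hU0 : U ⊆ Ioi 0 ×ˢ univ)
    {w : ℝ × ℝ → ℝ} (hw : ContDiffOn ℝ 1 w U) {φ : ℝ × ℝ → ℝ}
    (hφ : ContDiff ℝ 1 φ) (hc : HasCompactSupport φ) (hs : tsupport φ ⊆ U) (h0 : ∀ p, 0 ≤ φ p) :
    0 ≤ ∫ p : ℝ × ℝ in Ioi 0 ×ˢ univ,
      (|u p.1 p.2 - w p| * fderiv ℝ φ p (1, 0)
        + Real.sign (u p.1 p.2 - w p) * (u p.1 p.2 ^ 2 / 2 - w p ^ 2 / 2) * fderiv ℝ φ p (0, 1)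
        + Real.sign (u p.1 p.2 - w p) * (bpSource (u p.1) p.2
          - (fderiv ℝ w p (1, 0) + w p * fderiv ℝ w p (0, 1))) * φ p) := by
  set μ : Measure (ℝ × ℝ) := volume.restrict (Ioi 0 ×ˢ univ) with hμ
  have hvm := hu.aestronglyMeasurable
  have hSm := hu.aestronglyMeasurable_bpSource
  obtain ⟨Cv, hCv⟩ := hu.ae_bound_of_compact hc (hs.trans hU0)
  obtain ⟨CS, hCS⟩ := hc.exists_bound_of_continuousOn (hu.continuousOn_bpSource.mono
    ((hs.trans hU0).trans (prod_mono Ioi_subset_Ici_self subset_rfl)))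
  obtain ⟨Cw, hCw⟩ := hc.exists_bound_of_continuousOn (hw.continuousOn.mono hs)
  have hfc : ∀ e : ℝ × ℝ, ContinuousOn (fun p => fderiv ℝ w p e) U := fun e =>
    (hw.continuousOn_fderiv_of_isOpen hU le_rfl).clm_apply continuousOn_const
  have hφc : ∀ e : ℝ × ℝ, Continuous (fun p => fderiv ℝ φ p e) := fun e =>
    (hφ.continuous_fderiv one_ne_zero).clm_apply continuous_const
  obtain ⟨C1, hC1⟩ := hc.exists_bound_of_continuousOn ((hfc (1, 0)).mono hs)
  obtain ⟨C2, hC2⟩ := hc.exists_bound_of_continuousOn ((hfc (0, 1)).mono hs)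
  obtain ⟨C3, hC3⟩ := hc.exists_bound_of_continuousOn (hφc (1, 0)).continuousOn
  obtain ⟨C4, hC4⟩ := hc.exists_bound_of_continuousOn (hφc (0, 1)).continuousOn
  obtain ⟨C5, hC5⟩ := hc.exists_bound_of_continuousOn hφ.continuous.continuousOn
  obtain ⟨Q, hQ0, hQv, hQS, hQw, hQ1, hQ2, hQ3, hQ4, hQ5⟩ : ∃ Q : ℝ, 0 ≤ Q ∧ Cv ≤ Q ∧ CS ≤ Q ∧
      Cw ≤ Q ∧ C1 ≤ Q ∧ C2 ≤ Q ∧ C3 ≤ Q ∧ C4 ≤ Q ∧ C5 ≤ Q := by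
    refine ⟨|Cv| + |CS| + |Cw| + |C1| + |C2| + |C3| + |C4| + |C5|, by positivity, ?_⟩
    have := abs_nonneg Cv; have := abs_nonneg CS; have := abs_nonneg Cw; have := abs_nonneg C1
    have := abs_nonneg C2; have := abs_nonneg C3; have := abs_nonneg C4; have := abs_nonneg C5
    have := le_abs_self Cv; have := le_abs_self CS; have := le_abs_self Cw
    have := le_abs_self C1; have := le_abs_self C2; have := le_abs_self C3
    have := le_abs_self C4; have := le_abs_self C5
    refine ⟨?_, ?_, ?_, ?_, ?_, ?_, ?_, ?_⟩ <;> linarith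
  have hφz : ∀ p ∉ tsupport φ, φ p = 0 := fun p hp => image_eq_zero_of_notMem_tsupport hp
  have hdφz : ∀ p ∉ tsupport φ, fderiv ℝ φ p = 0 := fun p hp => by
    rw [(notMem_tsupport_iff_eventuallyEq.1 hp).fderiv_eq]; simp
  -- `R n` is what remains of the entropy integrand for the level `k` and the test function `φ(p)
  -- ρₙ(k - w(p))` after integration over all `k`. As `n → ∞` the mollifier concentrates at `k =
  -- w(p)`, and the derivatives falling on it produce the term `w_t + w w_x`.
  set R : ℕ → ℝ × ℝ → ℝ := fun n p =>
    fderiv ℝ φ p (1, 0) * mollAbs n (u p.1 p.2 - w p)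
      + fderiv ℝ φ p (0, 1) * ((u p.1 p.2 + w p) / 2 * mollAbs n (u p.1 p.2 - w p)
        + mollMoment n (u p.1 p.2 - w p) / 2)
      + (bpSource (u p.1) p.2 - fderiv ℝ w p (1, 0)) * φ p * mollSign n (u p.1 p.2 - w p)
      - φ p * fderiv ℝ w p (0, 1) * (u p.1 p.2 * mollSign n (u p.1 p.2 - w p)
        - mollAbs n (u p.1 p.2 - w p)) with hR
  have key : ∀ n, AEStronglyMeasurable (R n) μ ∧ 0 ≤ ∫ p, R n p ∂μ := by
    intro n
    set ψ := mollifier n with hψ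
    have hψ1 : ContDiff ℝ 1 ψ := contDiff_mollifier n
    set G : ℝ × ℝ → ℝ × ℝ × ℝ → ℝ := fun e q => fderiv ℝ φ q.2 e * ψ (q.1 - w q.2)
      - φ q.2 * (deriv ψ (q.1 - w q.2) * fderiv ℝ w q.2 e) with hG
    set H : ℝ × ℝ × ℝ → ℝ := fun q => φ q.2 * ψ (q.1 - w q.2) with hH
    -- The mollifier confines `k` to distance at most `1` from `w(p)`, which is bounded on the
    -- support of `φ`; so all factors have compact support in `(k, p)` and Fubini applies.
    have hkb : ∀ q : ℝ × ℝ × ℝ, q.2 ∈ tsupport φ →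
        (ψ (q.1 - w q.2) ≠ 0 ∨ deriv ψ (q.1 - w q.2) ≠ 0) → q.1 ∈ Icc (-(Q + 1)) (Q + 1) := by
      intro q hq hor
      have h1 : |q.1 - w q.2| ≤ 1 := hor.elim
        (fun h => (abs_lt_one_of_mollifier_ne_zero h).le) abs_le_one_of_deriv_mollifier_ne_zero
      have h2 := abs_le.1 h1
      have h3 := abs_le.1 ((hCw q.2 hq).trans hQw)
      exact ⟨by linarith [h2.1, h3.1], by linarith [h2.2, h3.2]⟩
    have hGz : ∀ e, ∀ q ∉ Icc (-(Q + 1)) (Q + 1) ×ˢ tsupport φ, G e q = 0 := by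
      intro e q hq
      by_cases hq2 : q.2 ∈ tsupport φ
      · have hq1 : q.1 ∉ Icc (-(Q + 1)) (Q + 1) := fun h => hq ⟨h, hq2⟩
        have h := mt (hkb q hq2) hq1
        push Not at h
        simp [hG, h.1, h.2]
      · simp [hG, hφz _ hq2, hdφz _ hq2]
    have hHz : ∀ q ∉ Icc (-(Q + 1)) (Q + 1) ×ˢ tsupport φ, H q = 0 := by
      intro q hq
      by_cases hq2 : q.2 ∈ tsupport φ
      · have hq1 : q.1 ∉ Icc (-(Q + 1)) (Q + 1) := fun h => hq ⟨h, hq2⟩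
        have h := mt (hkb q hq2) hq1
        push Not at h
        simp [hH, h.1]
      · simp [hH, hφz _ hq2]
    have hKc : IsCompact (Icc (-(Q + 1)) (Q + 1) ×ˢ tsupport φ) := isCompact_Icc.prod hc
    have hGi : ∀ e, Integrable (G e) (volume.prod μ) := fun e =>
      (continuous_fderiv_mul_comp_sub hU hψ1 hφ hs hw e).integrable_of_hasCompactSupport
        (HasCompactSupport.intro hKc (hGz e))
    have hHi : Integrable H (volume.prod μ) :=
      (continuous_mul_comp_sub hU hψ1 hφ hs hw).integrable_of_hasCompactSupport
        (HasCompactSupport.intro hKc hHz)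
    have hae : ∀ᵐ q : ℝ × ℝ × ℝ ∂(volume.prod μ), q.2 ∈ tsupport φ → |u q.2.1 q.2.2| ≤ Q :=
      (Measure.quasiMeasurePreserving_snd (μ := (volume : Measure ℝ)) (ν := μ)).ae
        (hCv.mono fun p hp hps => (hp hps).trans hQv)
    have hmul : ∀ (b g : ℝ × ℝ × ℝ → ℝ) (C : ℝ), AEStronglyMeasurable b (volume.prod μ) →
        Integrable g (volume.prod μ) →
        (∀ q ∉ Icc (-(Q + 1)) (Q + 1) ×ˢ tsupport φ, g q = 0) →
        (∀ q ∈ Icc (-(Q + 1)) (Q + 1) ×ˢ tsupport φ, |u q.2.1 q.2.2| ≤ Q → |b q| ≤ C) →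
        Integrable (fun q => b q * g q) (volume.prod μ) := by
      intro b g C hb hg hgz hbC
      refine (hg.norm.const_mul C).mono' (hb.mul hg.aestronglyMeasurable) ?_
      filter_upwards [hae] with q hq
      by_cases hqK : q ∈ Icc (-(Q + 1)) (Q + 1) ×ˢ tsupport φ
      · rw [norm_mul]
        exact mul_le_mul_of_nonneg_right (hbC q hqK (hq hqK.2)) (norm_nonneg _)
      · simp [hgz q hqK]
    have hvm2 : AEStronglyMeasurable (fun q : ℝ × ℝ × ℝ => u q.2.1 q.2.2) (volume.prod μ) :=
      hvm.comp_snd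
    have hkm2 : AEStronglyMeasurable (fun q : ℝ × ℝ × ℝ => q.1) (volume.prod μ) :=
      continuous_fst.aestronglyMeasurable
    have hsm2 : AEStronglyMeasurable (fun q : ℝ × ℝ × ℝ => Real.sign (u q.2.1 q.2.2 - q.1))
        (volume.prod μ) :=
      (measurable_realSign.comp_aemeasurable (hvm2.sub hkm2).aemeasurable).aestronglyMeasurable
    have i1 := hmul (fun q => |u q.2.1 q.2.2 - q.1|) (G (1, 0)) (Q + (Q + 1))
      (hvm2.sub hkm2).norm (hGi _) (hGz _) (fun q hq hv => by
        have := abs_le.2 hq.1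
        simp only [abs_abs]
        linarith [abs_sub (u q.2.1 q.2.2) q.1])
    have i2 := hmul (fun q => Real.sign (u q.2.1 q.2.2 - q.1)
        * (u q.2.1 q.2.2 ^ 2 / 2 - q.1 ^ 2 / 2)) (G (0, 1)) (1 * (Q ^ 2 / 2 + (Q + 1) ^ 2 / 2))
      (hsm2.mul (((hvm2.pow 2).mul_const (1 / 2)).sub ((hkm2.pow 2).mul_const (1 / 2)) |>.congr
        (Eventually.of_forall fun q => by simp; ring))) (hGi _) (hGz _) (fun q hq hv => by
        have h1 := abs_le.2 hq.1
        rw [abs_mul]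
        have h2 := abs_realSign_le (u q.2.1 q.2.2 - q.1)
        have h3 := abs_sub (u q.2.1 q.2.2 ^ 2 / 2) (q.1 ^ 2 / 2)
        have h4 : |u q.2.1 q.2.2 ^ 2 / 2| ≤ Q ^ 2 / 2 := by
          rw [abs_div, abs_two, abs_pow]; gcongr
        have h5 : |q.1 ^ 2 / 2| ≤ (Q + 1) ^ 2 / 2 := by
          rw [abs_div, abs_two, abs_pow]; gcongr
        gcongr
        linarith)
    have i3 := hmul (fun q => Real.sign (u q.2.1 q.2.2 - q.1) * bpSource (u q.2.1) q.2.2) H (1 * Q)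
      (hsm2.mul hSm.comp_snd) hHi hHz (fun q hq hv => by
        rw [abs_mul]
        gcongr
        · exact abs_realSign_le _
        · exact (hCS q.2 hq.2).trans hQS)
    set g : ℝ → ℝ × ℝ → ℝ := fun k p => |u p.1 p.2 - k| * G (1, 0) (k, p)
      + Real.sign (u p.1 p.2 - k) * (u p.1 p.2 ^ 2 / 2 - k ^ 2 / 2) * G (0, 1) (k, p)
      + Real.sign (u p.1 p.2 - k) * bpSource (u p.1) p.2 * H (k, p) with hg
    have hgi : Integrable (Function.uncurry g) (volume.prod μ) := (i1.add i2).add i3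
    have hinner : ∀ p, ∫ k, g k p = R n p := fun p =>
      integral_mollified_entropy n (u p.1 p.2) (w p) (fderiv ℝ φ p (1, 0)) (fderiv ℝ φ p (0, 1))
        (bpSource (u p.1) p.2) (φ p) (fderiv ℝ w p (1, 0)) (fderiv ℝ w p (0, 1))
    have hpos : ∀ k, 0 ≤ ∫ p, g k p ∂μ := by
      intro k
      have h1 := hu.entropy k (fun p => φ p * ψ (k - w p))
        (contDiff_mul_comp_sub hU hψ1 hφ hs hw k) hc.mul_right
        ((tsupport_mul_subset_left).trans (hs.trans hU0))
        (fun p => mul_nonneg (h0 p) (mollifier_nonneg n _))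
      simpa only [fderiv_mul_comp_sub hU hψ1 hφ hs hw] using h1
    refine ⟨hgi.integral_prod_right.aestronglyMeasurable.congr
      (Eventually.of_forall fun p => hinner p), ?_⟩
    -- For each `k` the inner integral is nonnegative by the entropy inequality; exchanging the
    -- integrals transfers this to `R n`.
    have h2 : ∫ k, (∫ p, g k p ∂μ) = ∫ p, (∫ k, g k p) ∂μ := integral_integral_swap hgi
    simp only [hinner] at h2
    rw [← h2]
    exact integral_nonneg hpos
  have hlim : Tendsto (fun n => ∫ p, R n p ∂μ) atTop (𝓝 (∫ p,
      (|u p.1 p.2 - w p| * fderiv ℝ φ p (1, 0)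
        + Real.sign (u p.1 p.2 - w p) * (u p.1 p.2 ^ 2 / 2 - w p ^ 2 / 2) * fderiv ℝ φ p (0, 1)
        + Real.sign (u p.1 p.2 - w p) * (bpSource (u p.1) p.2
          - (fderiv ℝ w p (1, 0) + w p * fderiv ℝ w p (0, 1))) * φ p) ∂μ)) := by
    -- A dominating constant, read off term by term from `R n` with every ingredient bounded by `Q`
    -- and the mollified quantities by `2 * Q + 1` or `1`.
    set D : ℝ := Q * (2 * Q + 1) + Q * (Q * (2 * Q + 1) + (2 * Q + 1) / 2) + (Q + Q) * Q * 1
      + Q * Q * (Q * 1 + (2 * Q + 1)) with hD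
    refine tendsto_integral_of_dominated_convergence (indicator (tsupport φ) fun _ => D)
      (fun n => (key n).1) ?_ (fun n => ?_) (Eventually.of_forall fun p => ?_)
    · rw [integrable_indicator_iff (isClosed_tsupport φ).measurableSet]
      exact integrableOn_const hc.measure_lt_top.ne (by simp)
    · filter_upwards [hCv] with p hp
      by_cases hps : p ∈ tsupport φ
      · rw [indicator_of_mem hps]
        have a0 := (hp hps).trans hQv
        have aw := (hCw p hps).trans hQw
        have aS := (hCS p hps).trans hQS
        have a1 := (hC1 p hps).trans hQ1
        have a2 := (hC2 p hps).trans hQ2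
        have a3 := (hC3 p hps).trans hQ3
        have a4 := (hC4 p hps).trans hQ4
        have a5 := (hC5 p hps).trans hQ5
        simp only [Real.norm_eq_abs] at aw aS a1 a2 a3 a4 a5 ⊢
        have ac : |u p.1 p.2 - w p| ≤ 2 * Q := by linarith [abs_sub (u p.1 p.2) (w p)]
        have am := abs_mollAbs_le n (u p.1 p.2 - w p)
        have aq := abs_mollMoment_le n (u p.1 p.2 - w p)
        have asg := abs_mollSign_le n (u p.1 p.2 - w p)
        have am' : |mollAbs n (u p.1 p.2 - w p)| ≤ 2 * Q + 1 := by linarith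
        have aq' : |mollMoment n (u p.1 p.2 - w p)| ≤ 2 * Q + 1 := by linarith
        have ah : |(u p.1 p.2 + w p) / 2| ≤ Q := by
          rw [abs_div, abs_two]
          linarith [abs_add_le (u p.1 p.2) (w p)]
        simp only [hR, hD]
        refine (abs_sub _ _).trans (add_le_add ((abs_add_le _ _).trans (add_le_add
          ((abs_add_le _ _).trans (add_le_add ?_ ?_)) ?_)) ?_)
        · rw [abs_mul]; gcongr
        · rw [abs_mul]; gcongr
          refine (abs_add_le _ _).trans (add_le_add ?_ ?_)
          · rw [abs_mul]; gcongr
          · rw [abs_div, abs_two]; gcongr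
        · rw [abs_mul, abs_mul]; gcongr
          exact (abs_sub _ _).trans (add_le_add aS a1)
        · rw [abs_mul, abs_mul]; gcongr
          refine (abs_sub _ _).trans (add_le_add ?_ am')
          rw [abs_mul]; gcongr
      · rw [indicator_of_notMem hps]
        simp [hR, hφz p hps, hdφz p hps]
    · have t1 := tendsto_mollAbs (u p.1 p.2 - w p)
      have t2 := tendsto_mollMoment (u p.1 p.2 - w p)
      have t3 := tendsto_mollSign (u p.1 p.2 - w p)
      have t4 := (((t1.const_mul (fderiv ℝ φ p (1, 0))).add
        (((t1.const_mul ((u p.1 p.2 + w p) / 2)).add (t2.div_const 2)).const_mul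
          (fderiv ℝ φ p (0, 1)))).add
        (t3.const_mul ((bpSource (u p.1) p.2 - fderiv ℝ w p (1, 0)) * φ p))).sub
        (((t3.const_mul (u p.1 p.2)).sub t1).const_mul (φ p * fderiv ℝ w p (0, 1)))
      convert t4 using 2
      rw [realSign_mul_sq_sub_sq, ← realSign_mul_self]
      ring
  exact ge_of_tendsto' hlim fun n => (key n).2

end IsWeakEntropySolution


/-! ### Distributional inequalities in time and shrinking cones -/

/-- The primitive of the `n`-th mollifier. -/
noncomputable def mollStep (n : ℕ) (s : ℝ) : ℝ := ∫ z in (-1 : ℝ)..s, mollifier n z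

theorem hasDerivAt_mollStep (n : ℕ) (s : ℝ) : HasDerivAt (mollStep n) (mollifier n s) s :=
  ((contDiff_mollifier n).continuous).integral_hasStrictDerivAt (-1) s |>.hasDerivAt

theorem monotone_mollStep (n : ℕ) : Monotone (mollStep n) :=
  monotone_of_deriv_nonneg (fun s => (hasDerivAt_mollStep n s).differentiableAt)
    fun s => by rw [(hasDerivAt_mollStep n s).deriv]; exact mollifier_nonneg n s

theorem mollifier_eq_zero {n : ℕ} {z : ℝ} (h : 1 / ((n : ℝ) + 1) ≤ |z|) : mollifier n z = 0 := by
  by_contra hne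
  have h1 : z ∈ Function.support (mollifier n) := hne
  rw [mollifier, ContDiffBump.support_normed_eq, mem_ball_zero_iff] at h1
  exact absurd h1 (not_lt.2 h)

theorem mollStep_eq_zero {n : ℕ} {s : ℝ} (h : s ≤ -(1 / ((n : ℝ) + 1))) : mollStep n s = 0 := by
  have hr : 1 / ((n : ℝ) + 1) ≤ 1 := shrinkingBump_rOut_le_one n
  rw [mollStep, intervalIntegral.integral_congr (g := fun _ => 0)]
  · simp
  · intro z hz
    have hz2 : z ≤ -(1 / ((n : ℝ) + 1)) := hz.2.trans (max_le (by linarith) h)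
    have h0 : 0 < 1 / ((n : ℝ) + 1) := by positivity
    exact mollifier_eq_zero (by rw [abs_of_neg (by linarith)]; linarith)

theorem mollStep_eq {n : ℕ} {s s' : ℝ} (h : 1 / ((n : ℝ) + 1) ≤ s) (h' : 1 / ((n : ℝ) + 1) ≤ s') :
    mollStep n s = mollStep n s' := by
  have hc := (contDiff_mollifier n).continuous
  have h1 := intervalIntegral.integral_interval_sub_left (μ := volume)
    (hc.intervalIntegrable (-1) s) (hc.intervalIntegrable (-1) s')
  have h2 : ∫ z in s'..s, mollifier n z = 0 := by
    rw [intervalIntegral.integral_congr (g := fun _ => 0)]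
    · simp
    · intro z hz
      have hz1 : 1 / ((n : ℝ) + 1) ≤ z := (le_min h' h).trans hz.1
      exact mollifier_eq_zero (hz1.trans (le_abs_self z))
  rw [h2] at h1
  exact sub_eq_zero.1 h1

/-- Testing with smooth approximations of the indicator of `[a, b]`, whose derivatives are
mollifiers at `a` minus mollifiers at `b`. -/
theorem le_add_integral_of_distributional_of_continuous {h G : ℝ → ℝ} (hh : Continuous h)
    (hG : Continuous G) {a₀ b₀ a b : ℝ} (ha : a₀ < a) (hab : a ≤ b) (hb : b < b₀)
    (H : ∀ θ : ℝ → ℝ, ContDiff ℝ 1 θ → (∀ t, 0 ≤ θ t) → HasCompactSupport θ →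
      tsupport θ ⊆ Ioo a₀ b₀ → 0 ≤ ∫ t, (deriv θ t * h t + θ t * G t)) :
    h b ≤ h a + ∫ t in a..b, G t := by
  set P : ℝ → ℝ := fun t => ∫ s in a..t, G s with hP
  have hPd : ∀ t, HasDerivAt P (G t) t := fun t => (hG.integral_hasStrictDerivAt a t).hasDerivAt
  have hPc : Continuous P := continuous_iff_continuousAt.2 fun t => (hPd t).continuousAt
  -- Subtracting a primitive of `G` reduces the claim to `k b ≤ k a`.
  set k : ℝ → ℝ := fun t => h t - P t with hk
  have hkc : Continuous k := hh.sub hPc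
  have lim : ∀ c, Tendsto (fun n => ∫ t, mollifier n (t - c) * k t) atTop (𝓝 (k c)) := fun c => by
    have h1 := tendsto_integral_mul_mollifier (g := fun z => k (z + c))
      (hkc.comp (continuous_add_const c)).measurable
      (hkc.comp (continuous_add_const c)).continuousAt
    simp only [zero_add] at h1
    refine h1.congr fun n => ?_
    rw [← integral_sub_right_eq_self (fun z => k (z + c) * mollifier n z) c]
    simp only [sub_add_cancel, mul_comm]
  have hev : ∀ᶠ n : ℕ in atTop, 0 ≤ (∫ t, mollifier n (t - a) * k t)
      - ∫ t, mollifier n (t - b) * k t := by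
    have hmin : 0 < min (a - a₀) (b₀ - b) := lt_min (by linarith) (by linarith)
    filter_upwards [(tendsto_one_div_add_atTop_nhds_zero_nat (𝕜 := ℝ)).eventually_lt_const hmin]
      with n hn
    set r := 1 / ((n : ℝ) + 1) with hr
    have hr0 : 0 < r := by positivity
    have hra : r < a - a₀ := hn.trans_le (min_le_left _ _)
    have hrb : r < b₀ - b := hn.trans_le (min_le_right _ _)
    set θ : ℝ → ℝ := fun t => mollStep n (t - a) - mollStep n (t - b) with hθ
    have hθd : ∀ t, HasDerivAt θ (mollifier n (t - a) - mollifier n (t - b)) t := fun t =>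
      ((hasDerivAt_mollStep n (t - a)).comp_sub_const t a).sub
        ((hasDerivAt_mollStep n (t - b)).comp_sub_const t b)
    have hmc := (contDiff_mollifier n).continuous
    have hθ1 : ContDiff ℝ 1 θ := by
      rw [contDiff_one_iff_deriv]
      refine ⟨fun t => (hθd t).differentiableAt, ?_⟩
      rw [show deriv θ = _ from funext fun t => (hθd t).deriv]
      fun_prop
    have hz : ∀ t ∉ Icc (a - r) (b + r), θ t = 0 := fun t ht => by
      rw [mem_Icc, not_and_or, not_le, not_le] at ht
      rcases ht with ht | ht
      · simp only [hθ]
        rw [mollStep_eq_zero (by linarith), mollStep_eq_zero (by linarith), sub_zero]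
      · simp only [hθ]
        rw [mollStep_eq (s := t - a) (s' := t - b) (by linarith) (by linarith), sub_self]
    have hts : tsupport θ ⊆ Icc (a - r) (b + r) :=
      closure_minimal (fun t ht => by by_contra h; exact ht (hz t h)) isClosed_Icc
    have hcs : HasCompactSupport θ := HasCompactSupport.intro isCompact_Icc hz
    have h1 := H θ hθ1 (fun t => sub_nonneg.2 (monotone_mollStep n (by linarith))) hcs
      (hts.trans (Icc_subset_Ioo (by linarith) (by linarith)))
    have hcsd : HasCompactSupport (deriv θ) := hcs.deriv
    have hdc : Continuous (deriv θ) := hθ1.continuous_deriv le_rfl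
    have i1 : Integrable fun t => deriv θ t * k t :=
      (hdc.mul hkc).integrable_of_hasCompactSupport hcsd.mul_right
    have i2 : Integrable fun t => deriv θ t * P t + θ t * G t :=
      ((hdc.mul hPc).integrable_of_hasCompactSupport hcsd.mul_right).add
        ((hθ1.continuous.mul hG).integrable_of_hasCompactSupport hcs.mul_right)
    have i3 : Integrable fun t => θ t * P t :=
      (hθ1.continuous.mul hPc).integrable_of_hasCompactSupport hcs.mul_right
    have h2 : ∫ t, (deriv θ t * P t + θ t * G t) = 0 :=
      integral_eq_zero_of_hasDerivAt_of_integrable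
        (fun t => (hθ1.differentiable one_ne_zero t).hasDerivAt.mul (hPd t)) i2 i3
    have h3 : ∫ t, (deriv θ t * h t + θ t * G t) = ∫ t, deriv θ t * k t := by
      rw [← add_zero (∫ t, deriv θ t * k t), ← h2, ← integral_add i1 i2]
      refine integral_congr_ae (Eventually.of_forall fun t => ?_)
      simp only [hk]; ring
    have i4 : ∀ c, Integrable fun t => mollifier n (t - c) * k t := fun c => by
      refine Continuous.integrable_of_hasCompactSupport (by fun_prop) ?_
      exact ((hasCompactSupport_mollifier n).comp_homeomorph (Homeomorph.subRight c)).mul_right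
    rw [h3] at h1
    rw [← integral_sub (i4 a) (i4 b)]
    refine h1.trans_eq (integral_congr_ae (Eventually.of_forall fun t => ?_))
    simp only [(hθd t).deriv]; ring
  have h4 := ge_of_tendsto ((lim a).sub (lim b)) hev
  have h5 : P a = 0 := by simp [hP]
  simp only [hk, h5] at h4
  change h b ≤ h a + P b
  linarith

/-- Clamping time to a compact interval slightly larger than `[a, b]` makes `h` and `G` globally
continuous without changing them on the relevant supports. -/
theorem le_add_integral_of_distributional {h G : ℝ → ℝ} {a₀ b₀ a b : ℝ}
    (hh : ContinuousOn h (Ioo a₀ b₀)) (hG : ContinuousOn G (Ioo a₀ b₀)) (ha : a₀ < a) (hab : a ≤ b)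
    (hb : b < b₀) (H : ∀ θ : ℝ → ℝ, ContDiff ℝ 1 θ → (∀ t, 0 ≤ θ t) → HasCompactSupport θ →
      tsupport θ ⊆ Ioo a₀ b₀ → 0 ≤ ∫ t, (deriv θ t * h t + θ t * G t)) :
    h b ≤ h a + ∫ t in a..b, G t := by
  set a' := (a₀ + a) / 2 with ha'
  set b' := (b + b₀) / 2 with hb'
  have h1 : a' ≤ b' := by linarith
  have hsub : Icc a' b' ⊆ Ioo a₀ b₀ := Icc_subset_Ioo (by linarith) (by linarith)
  have hcl : Continuous fun t : ℝ => (projIcc a' b' h1 t : ℝ) :=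
    continuous_subtype_val.comp continuous_projIcc
  have hclm : ∀ t : ℝ, (projIcc a' b' h1 t : ℝ) ∈ Ioo a₀ b₀ := fun t =>
    hsub (projIcc a' b' h1 t).2
  have hcle : ∀ t ∈ Icc a' b', (projIcc a' b' h1 t : ℝ) = t := fun t ht => by
    rw [projIcc_of_mem h1 ht]
  have key := le_add_integral_of_distributional_of_continuous (a₀ := a') (b₀ := b') (a := a) (b := b)
    (hh.comp_continuous hcl hclm) (hG.comp_continuous hcl hclm) (by linarith) hab (by linarith)
    fun θ hθ h0 hc hs => by
      refine (H θ hθ h0 hc (hs.trans (Ioo_subset_Icc_self.trans hsub))).trans_eq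
        (integral_congr_ae (Eventually.of_forall fun t => ?_))
      by_cases ht : t ∈ tsupport θ
      · simp only [Function.comp_apply, hcle t (Ioo_subset_Icc_self (hs ht))]
      · have e1 : θ t = 0 := image_eq_zero_of_notMem_tsupport ht
        have e2 : deriv θ t = 0 :=
          image_eq_zero_of_notMem_tsupport fun hmem => ht (closure_mono support_deriv_subset
            hmem |> fun h => by simpa [tsupport] using h)
        simp [e1, e2]
  simp only [Function.comp_apply] at key
  rw [hcle a ⟨by linarith, by linarith⟩, hcle b ⟨by linarith, by linarith⟩] at key
  refine key.trans_eq (congrArg _ (intervalIntegral.integral_congr fun t ht => ?_))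
  rw [uIcc_of_le hab] at ht
  simp only [hcle t ⟨by linarith [ht.1], by linarith [ht.2]⟩]

/-- A cutoff supported in a cone shrinking with speed `L`. -/
noncomputable def coneCutoff (L R : ℝ) (p : ℝ × ℝ) : ℝ :=
  Real.smoothTransition (1 + R - (√(1 + p.2 ^ 2) + L * p.1))

section Cutoff

variable {L R : ℝ}

theorem coneCutoff_nonneg (p : ℝ × ℝ) : 0 ≤ coneCutoff L R p := Real.smoothTransition.nonneg _

theorem coneCutoff_le_one (p : ℝ × ℝ) : coneCutoff L R p ≤ 1 := Real.smoothTransition.le_one _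

theorem coneCutoff_eq_one {p : ℝ × ℝ} (h : √(1 + p.2 ^ 2) + L * p.1 ≤ R) : coneCutoff L R p = 1 :=
  Real.smoothTransition.one_of_one_le (by linarith)

theorem coneCutoff_eq_zero (hL : 0 ≤ L) {p : ℝ × ℝ} (ht : 0 ≤ p.1) (h : 1 + R ≤ |p.2|) :
    coneCutoff L R p = 0 := by
  refine Real.smoothTransition.zero_of_nonpos ?_
  have h1 : |p.2| ≤ √(1 + p.2 ^ 2) := Real.abs_le_sqrt (by linarith)
  have h2 := mul_nonneg hL ht
  linarith

theorem contDiff_coneCutoff : ContDiff ℝ 1 (coneCutoff L R) := by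
  have h1 : ContDiff ℝ 1 fun p : ℝ × ℝ => √(1 + p.2 ^ 2) :=
    ContDiff.sqrt (by fun_prop) fun p => by positivity
  exact (Real.smoothTransition.contDiff (n := 1)).comp
    (contDiff_const.sub (h1.add (contDiff_const.mul contDiff_fst)))

/-- `√(1 + x²)` is a smooth substitute for `|x|` with slope at most `1`. The space derivative of the
cutoff is therefore at most `1 / L` of its time decay when `L > 0`, which is exactly what absorbs a
flux bounded by `L H`. -/
theorem fderiv_coneCutoff (p : ℝ × ℝ) : ∃ d, 0 ≤ d ∧ fderiv ℝ (coneCutoff L R) p (1, 0) = -(L * d) ∧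
    ∃ c, |c| ≤ 1 ∧ fderiv ℝ (coneCutoff L R) p (0, 1) = -(c * d) := by
  set y := 1 + R - (√(1 + p.2 ^ 2) + L * p.1) with hy
  have hS : HasDerivAt Real.smoothTransition (deriv Real.smoothTransition y) y :=
    ((Real.smoothTransition.contDiff (n := 1)).differentiable one_ne_zero y).hasDerivAt
  have hpos : 0 < 1 + p.2 ^ 2 := by positivity
  have hfd : DifferentiableAt ℝ (coneCutoff L R) p := contDiff_coneCutoff.differentiable one_ne_zero p
  refine ⟨deriv Real.smoothTransition y, Real.smoothTransition.monotone.deriv_nonneg, ?_,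
    p.2 / √(1 + p.2 ^ 2), ?_, ?_⟩
  · have h1 : HasDerivAt (fun s : ℝ => (p.1 + s, p.2)) ((1 : ℝ), (0 : ℝ)) 0 :=
      ((hasDerivAt_id (0 : ℝ)).const_add p.1).prodMk (hasDerivAt_const _ _)
    have h2 := HasFDerivAt.comp_hasDerivAt (f := fun s : ℝ => (p.1 + s, p.2)) (0 : ℝ)
      (by simpa using hfd.hasFDerivAt) h1
    have h3 : HasDerivAt (fun s : ℝ => 1 + R - (√(1 + p.2 ^ 2) + L * (p.1 + s))) (-L) 0 := by
      have := ((((hasDerivAt_id (0 : ℝ)).const_add p.1).const_mul L).const_add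
        (√(1 + p.2 ^ 2))).const_sub (1 + R)
      simpa using this
    have h4 := HasDerivAt.comp (h := fun s : ℝ => 1 + R - (√(1 + p.2 ^ 2) + L * (p.1 + s)))
      (h₂ := Real.smoothTransition) (0 : ℝ) (h₂' := deriv Real.smoothTransition y)
      (by rw [add_zero]; exact hS) h3
    have h5 := h2.unique h4
    rw [h5]; ring
  · rw [abs_div, abs_of_pos (Real.sqrt_pos.2 hpos), div_le_one (Real.sqrt_pos.2 hpos)]
    exact Real.abs_le_sqrt (by linarith)
  · have h1 : HasDerivAt (fun s : ℝ => (p.1, p.2 + s)) ((0 : ℝ), (1 : ℝ)) 0 :=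
      (hasDerivAt_const _ _).prodMk ((hasDerivAt_id (0 : ℝ)).const_add p.2)
    have h2 := HasFDerivAt.comp_hasDerivAt (f := fun s : ℝ => (p.1, p.2 + s)) (0 : ℝ)
      (by simpa using hfd.hasFDerivAt) h1
    have h3 : HasDerivAt (fun s : ℝ => 1 + R - (√(1 + (p.2 + s) ^ 2) + L * p.1))
        (-(p.2 / √(1 + p.2 ^ 2))) 0 := by
      have e1 : HasDerivAt (fun s : ℝ => 1 + (p.2 + s) ^ 2) (2 * p.2) 0 := by
        have := ((((hasDerivAt_id (0 : ℝ)).const_add p.2).pow 2)).const_add 1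
        simpa using this
      have e2 := ((e1.sqrt (by simpa using hpos.ne')).add_const (L * p.1)).const_sub (1 + R)
      refine e2.congr_deriv ?_
      simp only [add_zero]
      rw [mul_div_mul_left _ _ two_ne_zero]
    have h4 := HasDerivAt.comp (h := fun s : ℝ => 1 + R - (√(1 + (p.2 + s) ^ 2) + L * p.1))
      (h₂ := Real.smoothTransition) (0 : ℝ) (h₂' := deriv Real.smoothTransition y)
      (by rw [add_zero]; exact hS) h3
    have h5 := h2.unique h4
    rw [h5]; ring

end Cutoff


theorem volume_restrict_prod_univ (s : Set ℝ) :
    (volume : Measure (ℝ × ℝ)).restrict (s ×ˢ univ) = (volume.restrict s).prod volume := by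
  rw [Measure.volume_eq_prod, ← Measure.prod_restrict, Measure.restrict_univ]

theorem fderiv_mul_coneCutoff {θ : ℝ → ℝ} (hθ : ContDiff ℝ 1 θ) {L R : ℝ} (p v : ℝ × ℝ) :
    fderiv ℝ (fun p : ℝ × ℝ => θ p.1 * coneCutoff L R p) p v
      = θ p.1 * fderiv ℝ (coneCutoff L R) p v + v.1 * deriv θ p.1 * coneCutoff L R p := by
  have h1 : HasFDerivAt (fun p : ℝ × ℝ => θ p.1)
      (deriv θ p.1 • ContinuousLinearMap.fst ℝ ℝ ℝ) p :=
    (hθ.differentiable one_ne_zero p.1).hasDerivAt.comp_hasFDerivAt p hasFDerivAt_fst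
  have h2 := (contDiff_coneCutoff (L := L) (R := R)).differentiable one_ne_zero p |>.hasFDerivAt
  have h3 : HasFDerivAt (fun p : ℝ × ℝ => θ p.1 * coneCutoff L R p) _ p := h1.mul h2
  rw [h3.fderiv]
  simp
  ring

/-- Finite speed of propagation: a balance inequality with flux `|F| ≤ L H`, integrated over the
slices of a cone that shrinks with speed `L`. -/
theorem integral_cone_le {H F Q g : ℝ × ℝ → ℝ} {G : ℝ → ℝ} {a₀ b₀ a b L C R : ℝ} (h0 : 0 ≤ a₀)
    (hL : 0 ≤ L)
    (mH : AEStronglyMeasurable H (volume.restrict (Ioo a₀ b₀ ×ˢ univ)))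
    (mF : AEStronglyMeasurable F (volume.restrict (Ioo a₀ b₀ ×ˢ univ)))
    (mQ : AEStronglyMeasurable Q (volume.restrict (Ioo a₀ b₀ ×ˢ univ)))
    (mg : AEStronglyMeasurable g (volume.restrict (Ioo a₀ b₀ ×ˢ univ)))
    (bd : ∀ᵐ p ∂(volume.restrict (Ioo a₀ b₀ ×ˢ univ)),
      0 ≤ H p ∧ H p ≤ C ∧ |F p| ≤ L * H p ∧ |Q p| ≤ C ∧ Q p ≤ g p ∧ |g p| ≤ C)
    (ineq : ∀ φ : ℝ × ℝ → ℝ, ContDiff ℝ 1 φ → HasCompactSupport φ →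
      tsupport φ ⊆ Ioo a₀ b₀ ×ˢ univ → (∀ p, 0 ≤ φ p) →
      0 ≤ ∫ p in Ioo a₀ b₀ ×ˢ univ,
        (H p * fderiv ℝ φ p (1, 0) + F p * fderiv ℝ φ p (0, 1) + Q p * φ p))
    (hh : ContinuousOn (fun t => ∫ x, H (t, x) * coneCutoff L R (t, x)) (Ioo a₀ b₀))
    (hG : ContinuousOn G (Ioo a₀ b₀))
    (hgG : ∀ t ∈ Ioo a₀ b₀, ∫ x, g (t, x) * coneCutoff L R (t, x) ≤ G t)
    (ha : a₀ < a) (hab : a ≤ b) (hb : b < b₀) :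
    ∫ x, H (b, x) * coneCutoff L R (b, x)
      ≤ (∫ x, H (a, x) * coneCutoff L R (a, x)) + ∫ t in a..b, G t := by
  refine le_add_integral_of_distributional (a₀ := a₀) (b₀ := b₀)
    (h := fun t => ∫ x, H (t, x) * coneCutoff L R (t, x)) hh hG ha hab hb fun θ hθ hθ0 hθc hθs => ?_
  set μ := (volume : Measure (ℝ × ℝ)).restrict (Ioo a₀ b₀ ×ˢ univ) with hμ
  have hμp : μ = (volume.restrict (Ioo a₀ b₀)).prod volume := volume_restrict_prod_univ _
  have hms : MeasurableSet (Ioo a₀ b₀ ×ˢ (univ : Set ℝ)) := measurableSet_Ioo.prod MeasurableSet.univ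
  have hχ : ContDiff ℝ 1 (coneCutoff L R) := contDiff_coneCutoff
  have hdθ : Continuous (deriv θ) := hθ.continuous_deriv le_rfl
  have hdz : ∀ t ∉ tsupport θ, deriv θ t = 0 := fun t ht =>
    image_eq_zero_of_notMem_tsupport fun hm => ht (tsupport_deriv_subset hm)
  have cs : ∀ f : ℝ → ℝ, (∀ t ∉ tsupport θ, f t = 0) →
      HasCompactSupport fun p : ℝ × ℝ => f p.1 * coneCutoff L R p := by
    intro f hf
    refine HasCompactSupport.intro (hθc.isCompact.prod (isCompact_Icc (a := -(1 + R)) (b := 1 + R)))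
      fun p hp => ?_
    by_cases h1 : p.1 ∈ tsupport θ
    · rw [coneCutoff_eq_zero hL (h0.trans (hθs h1).1.le), mul_zero]
      by_contra! h2
      exact hp ⟨h1, abs_le.1 h2.le⟩
    · rw [hf _ h1, zero_mul]
  set φ : ℝ × ℝ → ℝ := fun p => θ p.1 * coneCutoff L R p with hφ
  have hφ1 : ContDiff ℝ 1 φ := (hθ.comp contDiff_fst).mul hχ
  have hφc : HasCompactSupport φ := cs θ fun t ht => image_eq_zero_of_notMem_tsupport ht
  have hφs : tsupport φ ⊆ Ioo a₀ b₀ ×ˢ univ := by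
    refine (closure_minimal (t := tsupport θ ×ˢ (univ : Set ℝ)) (fun p hp => ⟨?_, mem_univ _⟩)
      ((isClosed_tsupport θ).prod isClosed_univ)).trans (prod_mono hθs subset_rfl)
    by_contra h
    exact hp (by simp [hφ, image_eq_zero_of_notMem_tsupport h])
  have h1 := ineq φ hφ1 hφc hφs fun p => mul_nonneg (hθ0 _) (coneCutoff_nonneg p)
  have cd : ∀ v, Continuous fun p => fderiv ℝ φ p v := fun v =>
    (hφ1.continuous_fderiv one_ne_zero).clm_apply continuous_const
  have cds : ∀ v, HasCompactSupport fun p => fderiv ℝ φ p v := fun v =>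
    (hφc.fderiv (𝕜 := ℝ)).comp_left (g := fun f : ℝ × ℝ →L[ℝ] ℝ => f v) (by simp)
  have dom : ∀ {f k : ℝ × ℝ → ℝ} {c : ℝ}, AEStronglyMeasurable f μ → (∀ᵐ p ∂μ, |f p| ≤ c) →
      Continuous k → HasCompactSupport k → Integrable (fun p => f p * k p) μ := by
    intro f k c hf hb hk hkc
    exact ((hk.integrable_of_hasCompactSupport hkc).restrict).bdd_mul hf hb
  have bH : ∀ᵐ p ∂μ, |H p| ≤ C := bd.mono fun p hp => by rw [abs_of_nonneg hp.1]; exact hp.2.1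
  have bF : ∀ᵐ p ∂μ, |F p| ≤ L * C := bd.mono fun p hp =>
    hp.2.2.1.trans (mul_le_mul_of_nonneg_left hp.2.1 hL)
  have k1 : Continuous fun p : ℝ × ℝ => deriv θ p.1 * coneCutoff L R p :=
    (hdθ.comp continuous_fst).mul hχ.continuous
  have i1 : Integrable (fun p => H p * fderiv ℝ φ p (1, 0) + F p * fderiv ℝ φ p (0, 1) + Q p * φ p)
      μ := ((dom mH bH (cd _) (cds _)).add (dom mF bF (cd _) (cds _))).add
      (dom mQ (bd.mono fun p hp => hp.2.2.2.1) hφ1.continuous hφc)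
  have j1 := dom mH bH k1 (cs _ hdz)
  have j2 := dom mg (bd.mono fun p hp => hp.2.2.2.2.2) hφ1.continuous hφc
  -- The derivatives of the cutoff contribute `-θ d (L H + c F) ≤ 0` and may be dropped; only the
  -- time derivative of `θ` and the source remain.
  have h2 : 0 ≤ ∫ p, (H p * (deriv θ p.1 * coneCutoff L R p) + g p * φ p) ∂μ := by
    refine h1.trans (integral_mono_ae i1 (j1.add j2) (bd.mono fun p hp => ?_))
    obtain ⟨h3, -, h4, -, h5, -⟩ := hp
    obtain ⟨d, hd, e1, c, hc, e2⟩ := fderiv_coneCutoff (L := L) (R := R) p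
    simp only [hφ, fderiv_mul_coneCutoff hθ, e1, e2]
    have h6 : -(c * F p) ≤ L * H p :=
      (neg_le_abs _).trans ((abs_mul _ _).trans_le
        ((mul_le_of_le_one_left (abs_nonneg _) hc).trans h4))
    have h7 := mul_le_mul_of_nonneg_left h6 (mul_nonneg (hθ0 p.1) hd)
    have h8 := mul_le_mul_of_nonneg_right h5 (mul_nonneg (hθ0 p.1) (coneCutoff_nonneg (L := L) (R := R) p))
    linarith
  rw [integral_add j1 j2, hμp, integral_prod _ (hμp ▸ j1), integral_prod _ (hμp ▸ j2)] at h2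
  have e1 : ∀ t, ∫ x, H (t, x) * (deriv θ t * coneCutoff L R (t, x))
      = deriv θ t * ∫ x, H (t, x) * coneCutoff L R (t, x) := fun t => by
    rw [← integral_const_mul]; congr 1; ext x; ring
  have e2 : ∀ t, ∫ x, g (t, x) * φ (t, x) = θ t * ∫ x, g (t, x) * coneCutoff L R (t, x) := fun t => by
    rw [← integral_const_mul]; congr 1; ext x; simp only [hφ]; ring
  have l1 := (hμp ▸ j1).integral_prod_left
  have l2 := (hμp ▸ j2).integral_prod_left
  simp only [e1, e2] at h2 l1 l2
  have l3 : Integrable (fun t => θ t * G t) (volume.restrict (Ioo a₀ b₀)) := by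
    have : IntegrableOn (fun t => θ t * G t) (tsupport θ) :=
      (hθ.continuous.continuousOn.mul (hG.mono hθs)).integrableOn_compact hθc.isCompact
    exact ((integrableOn_iff_integrable_of_support_subset
      ((Function.support_mul_subset_left _ _).trans subset_closure)).1 this).restrict
  have h3 : ∫ t in Ioo a₀ b₀, θ t * ∫ x, g (t, x) * coneCutoff L R (t, x)
      ≤ ∫ t in Ioo a₀ b₀, θ t * G t :=
    setIntegral_mono_on l2 l3 measurableSet_Ioo fun t ht =>
      mul_le_mul_of_nonneg_left (hgG t ht) (hθ0 t)
  have h4 := h2.trans (add_le_add_right h3 _)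
  rw [← integral_add l1 l3] at h4
  refine h4.trans_eq (setIntegral_eq_integral_of_forall_compl_eq_zero fun t ht => ?_)
  rw [hdz t fun h => ht (hθs h), image_eq_zero_of_notMem_tsupport fun h => ht (hθs h)]
  ring

theorem integrable_mul_coneCutoff {f : ℝ → ℝ} (hf : Integrable f) (L R t : ℝ) :
    Integrable fun x => f x * coneCutoff L R (t, x) :=
  hf.mul_bdd (c := 1) (contDiff_coneCutoff.continuous.comp (by fun_prop)).aestronglyMeasurable
    (Eventually.of_forall fun x => by
      rw [Real.norm_eq_abs, abs_of_nonneg (coneCutoff_nonneg _)]; exact coneCutoff_le_one _)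

theorem hasCompactSupport_coneCutoff_slice {L R t : ℝ} (hL : 0 ≤ L) (ht : 0 ≤ t) :
    HasCompactSupport fun x => coneCutoff L R (t, x) :=
  HasCompactSupport.intro (isCompact_Icc (a := -(1 + R)) (b := 1 + R)) fun x hx =>
    coneCutoff_eq_zero hL ht (by by_contra! h; exact hx (abs_le.1 h.le))

theorem integrable_abs_sub_mul_coneCutoff {v w : ℝ → ℝ} (hv : Integrable v) (hw : Continuous w)
    {L R t : ℝ} (hL : 0 ≤ L) (ht : 0 ≤ t) :
    Integrable fun x => |v x - w x| * coneCutoff L R (t, x) := by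
  have hχ : Continuous fun x => coneCutoff L R (t, x) :=
    contDiff_coneCutoff.continuous.comp (by fun_prop)
  have h1 : Integrable fun x => v x * coneCutoff L R (t, x) - w x * coneCutoff L R (t, x) :=
    (integrable_mul_coneCutoff hv L R t).sub ((hw.mul hχ).integrable_of_hasCompactSupport
      (hasCompactSupport_coneCutoff_slice hL ht).mul_left)
  refine h1.abs.congr (Eventually.of_forall fun x => ?_)
  simp only [← sub_mul, abs_mul, abs_of_nonneg (coneCutoff_nonneg _)]

/-- The change of `u` is controlled in `L¹`, with the cutoff at most `1`; after freezing `u` at time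
`s`, the change of `w` and of the cutoff is handled by dominated convergence. -/
theorem continuousOn_integral_abs_sub_mul_coneCutoff {u w : ℝ → ℝ → ℝ} {T B L R : ℝ} (hL : 0 ≤ L)
    (hi : ∀ t ∈ Ico 0 T, Integrable (u t))
    (hc : ∀ s ∈ Ico 0 T, Tendsto (fun t => ∫ x, |u t x - u s x|) (𝓝[Ico 0 T] s) (𝓝 0))
    (hw : ContinuousOn (fun p : ℝ × ℝ => w p.1 p.2) (Ico 0 T ×ˢ univ))
    (hB : ∀ t ∈ Ico 0 T, ∀ x, |w t x| ≤ B) :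
    ContinuousOn (fun t => ∫ x, |u t x - w t x| * coneCutoff L R (t, x)) (Ico 0 T) := by
  intro s hs
  have hwc : ∀ t ∈ Ico 0 T, Continuous (w t) := fun t ht => by
    rw [← continuousOn_univ]
    exact hw.comp (f := fun x => (t, x)) (by fun_prop) fun x _ => ⟨ht, mem_univ _⟩
  have hχ : Continuous (coneCutoff L R) := contDiff_coneCutoff.continuous
  have lim : Tendsto (fun t => ∫ x, |u s x - w t x| * coneCutoff L R (t, x)) (𝓝[Ico 0 T] s)
      (𝓝 (∫ x, |u s x - w s x| * coneCutoff L R (s, x))) := by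
    refine tendsto_integral_filter_of_dominated_convergence
      (fun x => |u s x| + (Icc (-(1 + R)) (1 + R)).indicator (fun _ => B) x) ?_ ?_ ?_ ?_
    · filter_upwards [self_mem_nhdsWithin] with t ht
      exact (integrable_abs_sub_mul_coneCutoff (hi s hs) (hwc t ht) hL ht.1).aestronglyMeasurable
    · filter_upwards [self_mem_nhdsWithin] with t ht
      refine Eventually.of_forall fun x => ?_
      rw [Real.norm_eq_abs, abs_mul, abs_abs, abs_of_nonneg (coneCutoff_nonneg _)]
      by_cases hx : x ∈ Icc (-(1 + R)) (1 + R)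
      · rw [indicator_of_mem hx]
        refine (mul_le_of_le_one_right (abs_nonneg _) (coneCutoff_le_one _)).trans
          ((abs_sub _ _).trans (add_le_add_right (hB t ht x) _))
      · rw [indicator_of_notMem hx, coneCutoff_eq_zero hL ht.1, mul_zero, add_zero]
        · exact abs_nonneg _
        · by_contra! h; exact hx (abs_le.1 h.le)
    · exact (hi s hs).abs.add ((integrable_indicator_iff measurableSet_Icc).2 (by simp))
    · refine Eventually.of_forall fun x => ?_
      have h1 : Tendsto (fun t => w t x) (𝓝[Ico 0 T] s) (𝓝 (w s x)) :=
        (hw.comp (f := fun t : ℝ => (t, x)) (by fun_prop) (fun t ht => ⟨ht, mem_univ _⟩)) s hs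
      have h2 : Tendsto (fun t => coneCutoff L R (t, x)) (𝓝[Ico 0 T] s) (𝓝 (coneCutoff L R (s, x))) :=
        ((hχ.comp (by fun_prop : Continuous fun t : ℝ => (t, x))).tendsto s).mono_left inf_le_left
      exact (tendsto_const_nhds.sub h1).abs.mul h2
  have hd : Tendsto (fun t => (∫ x, |u t x - w t x| * coneCutoff L R (t, x))
      - ∫ x, |u s x - w t x| * coneCutoff L R (t, x)) (𝓝[Ico 0 T] s) (𝓝 0) := by
    refine squeeze_zero_norm' ?_ (hc s hs)
    filter_upwards [self_mem_nhdsWithin] with t ht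
    rw [← integral_sub (integrable_abs_sub_mul_coneCutoff (hi t ht) (hwc t ht) hL ht.1)
      (integrable_abs_sub_mul_coneCutoff (hi s hs) (hwc t ht) hL ht.1)]
    refine norm_integral_le_of_norm_le ((hi t ht).sub (hi s hs)).abs (Eventually.of_forall fun x => ?_)
    rw [← sub_mul, Real.norm_eq_abs, abs_mul, abs_of_nonneg (coneCutoff_nonneg _)]
    refine (mul_le_of_le_one_right (abs_nonneg _) (coneCutoff_le_one _)).trans
      ((abs_abs_sub_abs_le _ _).trans_eq ?_)
    rw [sub_sub_sub_cancel_right]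
  have := hd.add lim
  simpa [ContinuousWithinAt] using this

theorem tendsto_integral_mul_coneCutoff {f : ℝ → ℝ} (hf : Integrable f) (L t : ℝ) :
    Tendsto (fun R => ∫ x, f x * coneCutoff L R (t, x)) atTop (𝓝 (∫ x, f x)) := by
  refine tendsto_integral_filter_of_dominated_convergence (fun x => |f x|)
    (Eventually.of_forall fun R => (integrable_mul_coneCutoff hf L R t).aestronglyMeasurable)
    (Eventually.of_forall fun R => Eventually.of_forall fun x => ?_) hf.abs
    (Eventually.of_forall fun x => ?_)
  · rw [Real.norm_eq_abs, abs_mul, abs_of_nonneg (coneCutoff_nonneg _)]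
    exact mul_le_of_le_one_right (abs_nonneg _) (coneCutoff_le_one _)
  · refine tendsto_const_nhds.congr' ?_
    filter_upwards [eventually_ge_atTop (√(1 + x ^ 2) + L * t)] with R hR
    rw [coneCutoff_eq_one hR, mul_one]


/-! ### Comparison with classical functions and growth of the `L¹` norm -/

theorem integrable_mul_test {H F Q φ : ℝ × ℝ → ℝ} {C : ℝ} {S : Set (ℝ × ℝ)}
    (mH : AEStronglyMeasurable H (volume.restrict S))
    (mF : AEStronglyMeasurable F (volume.restrict S))
    (mQ : AEStronglyMeasurable Q (volume.restrict S))
    (hφ : ContDiff ℝ 1 φ) (hc : HasCompactSupport φ)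
    (bd : ∀ᵐ p ∂(volume.restrict S), |H p| ≤ C ∧ |F p| ≤ C ∧ |Q p| ≤ C) :
    Integrable (fun p => H p * fderiv ℝ φ p (1, 0) + F p * fderiv ℝ φ p (0, 1) + Q p * φ p)
      (volume.restrict S) := by
  have cd : ∀ v, Continuous fun p => fderiv ℝ φ p v := fun v =>
    (hφ.continuous_fderiv one_ne_zero).clm_apply continuous_const
  have cds : ∀ v, HasCompactSupport fun p => fderiv ℝ φ p v := fun v =>
    (hc.fderiv (𝕜 := ℝ)).comp_left (g := fun f : ℝ × ℝ →L[ℝ] ℝ => f v) (by simp)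
  exact ((((cd _).integrable_of_hasCompactSupport (cds _)).restrict.bdd_mul mH
    (bd.mono fun p hp => hp.1)).add (((cd _).integrable_of_hasCompactSupport
    (cds _)).restrict.bdd_mul mF (bd.mono fun p hp => hp.2.1))).add
    ((hφ.continuous.integrable_of_hasCompactSupport hc).restrict.bdd_mul mQ
    (bd.mono fun p hp => hp.2.2))

theorem setIntegral_strip {f φ : ℝ × ℝ → ℝ} {a₀ T : ℝ} (h0 : 0 ≤ a₀)
    (hs : tsupport φ ⊆ Ioo a₀ T ×ˢ univ) (hf : ∀ p ∉ tsupport φ, f p = 0) :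
    ∫ p in Ioi 0 ×ˢ univ, f p = ∫ p in Ioo a₀ T ×ˢ univ, f p :=
  setIntegral_eq_of_subset_of_forall_sdiff_eq_zero (measurableSet_Ioi.prod MeasurableSet.univ)
    (prod_mono (fun _ h => h0.trans_lt h.1) subset_rfl) fun p hp => hf p fun h => hp.2 (hs h)

theorem abs_realSign_mul_sq_sub_le {v k C B : ℝ} (hv : |v| ≤ C) (hk : |k| ≤ B) :
    |Real.sign (v - k) * (v ^ 2 / 2 - k ^ 2 / 2)| ≤ (C + B) / 2 * |v - k| := by
  have h1 : |v + k| ≤ C + B := (abs_add_le _ _).trans (add_le_add hv hk)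
  rw [abs_mul, show v ^ 2 / 2 - k ^ 2 / 2 = (v + k) / 2 * (v - k) by ring, abs_mul, abs_div,
    abs_two]
  exact (mul_le_of_le_one_left (by positivity) (abs_realSign_le _)).trans (by gcongr)

theorem fderiv_eq_zero_of_notMem_tsupport {φ : ℝ × ℝ → ℝ} {p : ℝ × ℝ} (h : p ∉ tsupport φ) :
    fderiv ℝ φ p = 0 :=
  image_eq_zero_of_notMem_tsupport fun hm => h (tsupport_fderiv_subset ℝ hm)

namespace IsWeakEntropySolution

variable {ubar : ℝ → ℝ} {u : ℝ → ℝ → ℝ}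

theorem continuous_L1_Ico (hu : IsWeakEntropySolution ubar u) {s : ℝ} (hs : 0 ≤ s) (T : ℝ) :
    Tendsto (fun t => ∫ x, |u t x - u s x|) (𝓝[Ico 0 T] s) (𝓝 0) :=
  (hu.continuous_L1 s hs).mono_left (nhdsWithin_mono _ fun _ h => h.1)

/-- Weak-strong stability. Kruzkov's inequality against `w` is a balance law for `|u - w|` whose
flux is at most `(C + B) / 2` times `|u - w|`, so a cone shrinking at that speed receives nothing
from outside and only the source mismatch contributes. -/
theorem integral_abs_sub_le (hu : IsWeakEntropySolution ubar u) {w r : ℝ → ℝ → ℝ}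
    {a₀ T C B D R a b : ℝ} {G : ℝ → ℝ} (h0 : 0 ≤ a₀) (hCB : 0 ≤ C + B)
    (hC : ∀ᵐ p : ℝ × ℝ ∂(volume.restrict (Ioo a₀ T ×ˢ univ)), |u p.1 p.2| ≤ C)
    (hw : ContDiffOn ℝ 1 (fun p : ℝ × ℝ => w p.1 p.2) (Ioo 0 T ×ˢ univ))
    (hwc : ContinuousOn (fun p : ℝ × ℝ => w p.1 p.2) (Ico 0 T ×ˢ univ))
    (hB : ∀ t ∈ Ico 0 T, ∀ x, |w t x| ≤ B)
    (pde : ∀ t ∈ Ioo 0 T, ∀ x, fderiv ℝ (fun p : ℝ × ℝ => w p.1 p.2) (t, x) (1, 0)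
      + w t x * fderiv ℝ (fun p : ℝ × ℝ => w p.1 p.2) (t, x) (0, 1) = r t x)
    (hr : ContinuousOn (fun p : ℝ × ℝ => r p.1 p.2) (Ioo 0 T ×ˢ univ))
    (hD : ∀ t ∈ Ioo 0 T, ∀ x, |bpSource (u t) x - r t x| ≤ D)
    (hG : ContinuousOn G (Ioo 0 T))
    (hgG : ∀ t ∈ Ioo 0 T,
      ∫ x, |bpSource (u t) x - r t x| * coneCutoff ((C + B) / 2) R (t, x) ≤ G t)
    (ha : a₀ < a) (hab : a ≤ b) (hb : b < T) :
    ∫ x, |u b x - w b x| * coneCutoff ((C + B) / 2) R (b, x)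
      ≤ (∫ x, |u a x - w a x| * coneCutoff ((C + B) / 2) R (a, x)) + ∫ t in a..b, G t := by
  have hsub : Ioo a₀ T ⊆ Ioo 0 T := Ioo_subset_Ioo_left h0
  have hsub2 : (Ioo a₀ T ×ˢ univ : Set (ℝ × ℝ)) ⊆ Ioo 0 T ×ˢ univ := prod_mono hsub subset_rfl
  have hms : MeasurableSet (Ioo a₀ T ×ˢ (univ : Set ℝ)) := measurableSet_Ioo.prod MeasurableSet.univ
  have hsub3 : (Ioo a₀ T ×ˢ univ : Set (ℝ × ℝ)) ⊆ Ioi 0 ×ˢ univ :=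
    hsub2.trans (prod_mono (fun _ h => h.1) subset_rfl)
  have D0 : 0 ≤ D := (abs_nonneg _).trans (hD a ⟨by linarith, by linarith⟩ 0)
  have mu := hu.aestronglyMeasurable.mono_measure (Measure.restrict_mono hsub3 le_rfl)
  have ms := hu.aestronglyMeasurable_bpSource.mono_measure (Measure.restrict_mono hsub3 le_rfl)
  have mw : AEStronglyMeasurable (fun p : ℝ × ℝ => w p.1 p.2)
    (volume.restrict (Ioo a₀ T ×ˢ univ)) := (hw.continuousOn.mono hsub2).aestronglyMeasurable hms
  have mr : AEStronglyMeasurable (fun p : ℝ × ℝ => r p.1 p.2)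
    (volume.restrict (Ioo a₀ T ×ˢ univ)) := (hr.mono hsub2).aestronglyMeasurable hms
  have msg : AEStronglyMeasurable (fun p : ℝ × ℝ => Real.sign (u p.1 p.2 - w p.1 p.2))
      (volume.restrict (Ioo a₀ T ×ˢ univ)) :=
    (measurable_realSign.comp_aemeasurable (mu.sub mw).aemeasurable).aestronglyMeasurable
  refine integral_cone_le (a₀ := a₀) (b₀ := T) (C := C + B + (C + B) / 2 * (C + B) + D)
    (H := fun p => |u p.1 p.2 - w p.1 p.2|)
    (F := fun p => Real.sign (u p.1 p.2 - w p.1 p.2) * (u p.1 p.2 ^ 2 / 2 - w p.1 p.2 ^ 2 / 2))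
    (Q := fun p => Real.sign (u p.1 p.2 - w p.1 p.2) * (bpSource (u p.1) p.2 - r p.1 p.2))
    (g := fun p => |bpSource (u p.1) p.2 - r p.1 p.2|) h0 (by positivity)
    (mu.sub mw).norm (msg.mul (((mu.aemeasurable.pow_const 2).div_const 2).sub
      ((mw.aemeasurable.pow_const 2).div_const 2)).aestronglyMeasurable)
    (msg.mul (ms.sub mr)) (ms.sub mr).norm ?_ ?_ ?_ (hG.mono hsub) (fun t ht => hgG t (hsub ht))
    ha hab hb
  · filter_upwards [hC, ae_restrict_mem hms] with p hp hpm
    have h1 := hD p.1 (hsub hpm.1) p.2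
    have h2 := hB p.1 ⟨(hsub hpm.1).1.le, hpm.1.2⟩ p.2
    have h3 : |Real.sign (u p.1 p.2 - w p.1 p.2) * (bpSource (u p.1) p.2 - r p.1 p.2)|
        ≤ |bpSource (u p.1) p.2 - r p.1 p.2| := by
      rw [abs_mul]; exact mul_le_of_le_one_left (abs_nonneg _) (abs_realSign_le _)
    have h4 : 0 ≤ (C + B) / 2 * (C + B) := by positivity
    have h5 : |u p.1 p.2 - w p.1 p.2| ≤ C + B := (abs_sub _ _).trans (add_le_add hp h2)
    refine ⟨abs_nonneg _, by linarith, abs_realSign_mul_sq_sub_le hp h2, by linarith,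
      (le_abs_self _).trans h3, by rw [abs_abs]; linarith⟩
  · intro φ hφ hc hs hφ0
    have h1 := hu.entropy_of_contDiffOn (isOpen_Ioo.prod isOpen_univ) hsub3 (hw.mono hsub2)
      hφ hc hs hφ0
    rw [setIntegral_strip h0 hs fun p hp => by
      simp [fderiv_eq_zero_of_notMem_tsupport hp, image_eq_zero_of_notMem_tsupport hp]] at h1
    refine h1.trans_eq (setIntegral_congr_fun hms fun p hp => ?_)
    have := pde p.1 (hsub hp.1) p.2
    simp only [← this]
  · exact (continuousOn_integral_abs_sub_mul_coneCutoff (by positivity)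
      (fun t ht => hu.integrable t ht.1) (fun s hs => hu.continuous_L1_Ico hs.1 T) hwc hB).mono
      fun t ht => ⟨(hsub ht).1.le, ht.2⟩

theorem abs_integral_abs_sub_le (hu : IsWeakEntropySolution ubar u) {s t : ℝ} (hs : 0 ≤ s)
    (ht : 0 ≤ t) : |(∫ x, |u t x|) - (∫ x, |u s x|)| ≤ ∫ x, |u t x - u s x| := by
  rw [← integral_sub (hu.integrable t ht).abs (hu.integrable s hs).abs]
  exact norm_integral_le_of_norm_le (f := fun x => |u t x| - |u s x|)
    ((hu.integrable t ht).sub (hu.integrable s hs)).abs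
    (Eventually.of_forall fun x => abs_abs_sub_abs_le (u t x) (u s x))

theorem continuousOn_integral_abs (hu : IsWeakEntropySolution ubar u) :
    ContinuousOn (fun t => ∫ x, |u t x|) (Ici 0) := by
  intro s hs
  have h := squeeze_zero_norm' (f := fun t => (∫ x, |u t x|) - ∫ x, |u s x|) (by
    filter_upwards [self_mem_nhdsWithin] with t ht
    exact hu.abs_integral_abs_sub_le hs ht) (hu.continuous_L1 s hs)
  have := h.add_const (∫ x, |u s x|)
  simpa [ContinuousWithinAt] using this

/-- Comparison with the solution `w = 0` of the equation with zero source; the mismatch is then the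
source itself, with `L¹` norm at most that of `u`. The cone radius is sent to infinity. -/
theorem integral_abs_le_add (hu : IsWeakEntropySolution ubar u) {a b : ℝ} (ha : 0 < a)
    (hab : a ≤ b) : ∫ x, |u b x| ≤ (∫ x, |u a x|) + ∫ t in a..b, ∫ x, |u t x| := by
  obtain ⟨C, hC⟩ := hu.locallyBounded (a / 2) (b + 1) (by linarith)
  have hN := hu.continuousOn_integral_abs
  obtain ⟨D, hD⟩ := (isCompact_Icc (a := 0) (b := b + 1)).bddAbove_image
    (hN.mono fun t ht => ht.1 : ContinuousOn _ (Icc 0 (b + 1)))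
  have hC' : ∀ᵐ p : ℝ × ℝ ∂(volume.restrict (Ioo (a / 2) (b + 1) ×ˢ univ)),
      |u p.1 p.2| ≤ max C 0 :=
    (hC.filter_mono (ae_mono (Measure.restrict_mono
      (prod_mono Ioo_subset_Icc_self subset_rfl) le_rfl))).mono fun p hp => hp.trans (le_max_left _ _)
  have key : ∀ R, ∫ x, |u b x| * coneCutoff ((max C 0 + 0) / 2) R (b, x)
      ≤ (∫ x, |u a x|) + ∫ t in a..b, ∫ x, |u t x| := fun R => by
    have h1 := hu.integral_abs_sub_le (w := fun _ _ => 0) (r := fun _ _ => 0) (a₀ := a / 2)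
      (T := b + 1) (C := max C 0) (B := 0) (D := D) (R := R) (a := a) (b := b)
      (G := fun t => ∫ x, |u t x|) (by linarith) (by simp) hC' contDiffOn_const
      continuousOn_const (by simp) (by simp) continuousOn_const (fun t ht x => by
        have h2 := hD ⟨t, Ioo_subset_Icc_self ht, rfl⟩
        have h3 := abs_bpSource_le (hu.integrable t ht.1.le) x
        have h4 : 0 ≤ ∫ x, |u t x| := integral_nonneg fun x => abs_nonneg _
        rw [sub_zero]
        simp only at h2
        linarith) (hN.mono fun t ht => ht.1.le) (fun t ht => by
        have hi := (integrable_bpSource (hu.integrable t ht.1.le)).abs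
        refine le_trans (integral_mono (g := fun x => |bpSource (u t) x|) ?_ hi fun x => ?_)
          (integral_abs_bpSource_le (hu.integrable t ht.1.le))
        · simpa only [sub_zero] using integrable_mul_coneCutoff hi _ _ _
        · simp only [sub_zero]
          exact mul_le_of_le_one_right (abs_nonneg _) (coneCutoff_le_one _)) (by linarith) hab
      (by linarith)
    simp only [sub_zero] at h1
    refine h1.trans (add_le_add_left (integral_mono (integrable_mul_coneCutoff
      (hu.integrable a ha.le).abs _ _ _) (hu.integrable a ha.le).abs fun x => ?_) _)
    exact mul_le_of_le_one_right (abs_nonneg _) (coneCutoff_le_one _)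
  exact le_of_tendsto (tendsto_integral_mul_coneCutoff (hu.integrable b (by linarith)).abs _ _)
    (Eventually.of_forall key)

/-- Gronwall in integrated form: with `I` the integral of the norm from `0`, the function `e^(-t) (N
0 + I t)` is nonincreasing. -/
theorem integral_abs_le_exp (hu : IsWeakEntropySolution ubar u) {t : ℝ} (ht : 0 ≤ t) :
    ∫ x, |u t x| ≤ (∫ x, |ubar x|) * Real.exp t := by
  set N : ℝ → ℝ := fun t => ∫ x, |u (max t 0) x| with hN
  have hNt : ∀ t, 0 ≤ t → N t = ∫ x, |u t x| := fun t ht => by simp [hN, max_eq_left ht]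
  have hNc : Continuous N := hu.continuousOn_integral_abs.comp_continuous
    (f := fun t : ℝ => max t 0) (by fun_prop) fun t => mem_Ici.2 (le_max_right _ _)
  have hN0 : N 0 = ∫ x, |ubar x| := by
    rw [hNt 0 le_rfl]
    exact integral_congr_ae (hu.initial.mono fun x hx => by simp only [hx])
  set I : ℝ → ℝ := fun t => ∫ s in (0 : ℝ)..t, N s with hI
  have hId : ∀ t, HasDerivAt I (N t) t := fun t =>
    intervalIntegral.integral_hasDerivAt_right (hNc.intervalIntegrable _ _)
      hNc.aestronglyMeasurable.stronglyMeasurableAtFilter hNc.continuousAt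
  have h1 : ∀ a, 0 < a → ∀ b, a ≤ b → N b ≤ N a + (I b - I a) := fun a ha b hab => by
    have h2 := hu.integral_abs_le_add ha hab
    rw [intervalIntegral.integral_interval_sub_left (hNc.intervalIntegrable _ _)
      (hNc.intervalIntegrable _ _), hNt a ha.le, hNt b (ha.le.trans hab)]
    refine h2.trans_eq (congrArg _ (intervalIntegral.integral_congr fun s hs => ?_))
    rw [uIcc_of_le hab] at hs
    exact (hNt s (ha.le.trans hs.1)).symm
  have hIc : Continuous I := continuous_iff_continuousAt.2 fun t => (hId t).continuousAt
  -- The entropy inequality sees only positive times; `L¹` continuity at `0` permits `a → 0`.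
  have h3 : ∀ b, 0 < b → N b ≤ N 0 + I b := fun b hb => by
    have l : Tendsto (fun a => N a + (I b - I a)) (𝓝[>] 0) (𝓝 (N 0 + (I b - I 0))) :=
      ((hNc.tendsto 0).add (tendsto_const_nhds.sub (hIc.tendsto 0))).mono_left inf_le_left
    have := ge_of_tendsto l (by
      filter_upwards [Ioo_mem_nhdsGT hb] with a ha
      exact h1 a ha.1 b ha.2.le)
    simpa [hI] using this
  have hJd : ∀ t, HasDerivAt (fun t => Real.exp (-t) * (N 0 + I t))
      (Real.exp (-t) * -1 * (N 0 + I t) + Real.exp (-t) * N t) t := fun t =>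
    ((hasDerivAt_id t).neg.exp).mul ((hId t).const_add (N 0))
  have hJ : AntitoneOn (fun t => Real.exp (-t) * (N 0 + I t)) (Ici 0) := by
    refine antitoneOn_of_deriv_nonpos (convex_Ici 0) (by fun_prop) (fun t _ => ?_) fun t ht => ?_
    · exact (hJd t).differentiableAt.differentiableWithinAt
    · rw [interior_Ici] at ht
      rw [(hJd t).deriv]
      have := mul_le_mul_of_nonneg_left (h3 t ht) (Real.exp_pos (-t)).le
      linarith
  have h4 := hJ (mem_Ici.2 le_rfl) (mem_Ici.2 ht) ht
  have h5 : N t ≤ N 0 + I t := by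
    rcases ht.eq_or_lt with rfl | ht
    · simp [hI]
    · exact h3 t ht
  simp only [neg_zero, Real.exp_zero, one_mul] at h4
  rw [← hNt t ht, ← hN0]
  have h6 : I 0 = 0 := by simp [hI]
  rw [h6, add_zero] at h4
  have h7 := mul_le_mul_of_nonneg_right h4 (Real.exp_pos t).le
  rw [mul_right_comm, ← Real.exp_add, neg_add_cancel, Real.exp_zero, one_mul] at h7
  exact h5.trans h7

end IsWeakEntropySolution


/-! ### The maximum principle for the sup norm -/

/-- Adding the Kruzkov entropies at levels `k` and `-k` and subtracting `2 k` gives twice the excess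
of `|v|` over `k`. Its flux vanishes where `|v| ≤ k`, and its source is nonpositive if `k` grows at
a rate `k'` that dominates the source `s`. -/
theorem abs_sub_add_abs_add_sub_bounds {v k s k' C B : ℝ} (hk : 0 ≤ k) (hs : |s| ≤ k')
    (hv : |v| ≤ C) (hB : k ≤ B) :
    |v - k| + |v + k| - 2 * k = 2 * max (|v| - k) 0 ∧
    |Real.sign (v - k) * (v ^ 2 / 2 - k ^ 2 / 2) + Real.sign (v + k) * (v ^ 2 / 2 - k ^ 2 / 2)|
      ≤ (C + B) / 2 * (|v - k| + |v + k| - 2 * k) ∧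
    Real.sign (v - k) * (s - k') + Real.sign (v + k) * (s + k') - 2 * k' ≤ 0 := by
  have hs' := abs_le.1 hs
  have hv' := abs_le.1 hv
  rcases lt_or_ge v (-k) with h | h
  · have h1 : v - k < 0 := by linarith
    have h2 : v + k < 0 := by linarith
    rw [Real.sign_of_neg h1, Real.sign_of_neg h2, abs_of_neg h1, abs_of_neg h2,
      abs_of_neg (a := v) (by linarith), max_eq_left (by linarith)]
    refine ⟨by ring, ?_, by linarith⟩
    rw [show -1 * (v ^ 2 / 2 - k ^ 2 / 2) + -1 * (v ^ 2 / 2 - k ^ 2 / 2) = -((v - k) * (v + k)) by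
      ring, abs_neg, abs_mul, abs_of_neg h1, abs_of_neg h2]
    have := mul_nonneg (by linarith : 0 ≤ C + B - (k - v)) (neg_nonneg.2 h2.le)
    nlinarith
  rcases lt_or_ge k v with h' | h'
  · have h1 : 0 < v - k := by linarith
    have h2 : 0 < v + k := by linarith
    rw [Real.sign_of_pos h1, Real.sign_of_pos h2, abs_of_pos h1, abs_of_pos h2,
      abs_of_pos (a := v) (by linarith), max_eq_left (by linarith)]
    refine ⟨by ring, ?_, by linarith⟩
    rw [show 1 * (v ^ 2 / 2 - k ^ 2 / 2) + 1 * (v ^ 2 / 2 - k ^ 2 / 2) = (v - k) * (v + k) by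
      ring, abs_mul, abs_of_pos h1, abs_of_pos h2]
    have := mul_nonneg (by linarith : 0 ≤ C + B - (v + k)) h1.le
    nlinarith
  have hH : |v - k| + |v + k| - 2 * k = 0 := by
    rw [abs_of_nonpos (by linarith), abs_of_nonneg (by linarith)]; ring
  rw [hH, max_eq_right (sub_nonpos.2 (abs_le.2 ⟨h, h'⟩)), mul_zero, mul_zero]
  rcases h.eq_or_lt with h1 | h1
  · rw [← h1]
    refine ⟨rfl, by simp, ?_⟩
    rw [neg_add_cancel, Real.sign_zero]
    have h2 := abs_le.1 (abs_realSign_le (-k - k))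
    nlinarith [mul_nonneg (by linarith : 0 ≤ 1 + Real.sign (-k - k)) (by linarith : 0 ≤ k' - s)]
  rw [Real.sign_of_pos (by linarith : 0 < v + k)]
  rcases h'.eq_or_lt with h2 | h2
  · rw [h2]
    refine ⟨rfl, by simp, ?_⟩
    rw [sub_self, Real.sign_zero]
    linarith
  · rw [Real.sign_of_neg (by linarith : v - k < 0)]
    exact ⟨rfl, by ring_nf; simp, by linarith⟩

theorem integral_mul_fderiv_fst {k : ℝ → ℝ} (hk : ContDiff ℝ 1 k) {φ : ℝ × ℝ → ℝ}
    (hφ : ContDiff ℝ 1 φ) (hc : HasCompactSupport φ) :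
    ∫ p : ℝ × ℝ, (k p.1 * fderiv ℝ φ p (1, 0) + deriv k p.1 * φ p) = 0 := by
  have hd : ∀ p : ℝ × ℝ, HasFDerivAt (fun p : ℝ × ℝ => k p.1)
      (deriv k p.1 • ContinuousLinearMap.fst ℝ ℝ ℝ) p := fun p =>
    (hk.differentiable one_ne_zero p.1).hasDerivAt.comp_hasFDerivAt p hasFDerivAt_fst
  have hkc : Continuous fun p : ℝ × ℝ => k p.1 := hk.continuous.comp continuous_fst
  have hdc : Continuous fun p : ℝ × ℝ => deriv k p.1 :=
    (hk.continuous_deriv le_rfl).comp continuous_fst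
  have cd : Continuous fun p => fderiv ℝ φ p (1, 0) :=
    (hφ.continuous_fderiv one_ne_zero).clm_apply continuous_const
  have cds : HasCompactSupport fun p => fderiv ℝ φ p (1, 0) :=
    (hc.fderiv (𝕜 := ℝ)).comp_left (g := fun f : ℝ × ℝ →L[ℝ] ℝ => f (1, 0)) (by simp)
  have i1 : Integrable fun p : ℝ × ℝ => k p.1 * fderiv ℝ φ p (1, 0) :=
    (hkc.mul cd).integrable_of_hasCompactSupport cds.mul_left
  have i2 : Integrable fun p : ℝ × ℝ => deriv k p.1 * φ p :=
    (hdc.mul hφ.continuous).integrable_of_hasCompactSupport hc.mul_left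
  have e : ∀ p : ℝ × ℝ, fderiv ℝ (fun p : ℝ × ℝ => k p.1) p (1, 0) = deriv k p.1 := fun p => by
    rw [(hd p).fderiv]; simp
  have := integral_mul_fderiv_eq_neg_fderiv_mul_of_integrable (μ := (volume : Measure (ℝ × ℝ)))
    (f := fun p : ℝ × ℝ => k p.1) (g := φ) (v := ((1 : ℝ), (0 : ℝ))) (by simpa only [e] using i2) i1
    ((hkc.mul hφ.continuous).integrable_of_hasCompactSupport hc.mul_left)
    (fun p _ => (hd p).differentiableAt) (fun p _ => hφ.differentiable one_ne_zero p)
  rw [integral_add i1 i2, this]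
  simp only [e]
  ring

namespace IsWeakEntropySolution

variable {ubar : ℝ → ℝ} {u : ℝ → ℝ → ℝ}

/-- The mass of the excess `(|u| - k)₊` cannot increase, by the cone estimate with zero source, and
it is zero initially. -/
theorem abs_le_of_forall_abs_bpSource_le (hu : IsWeakEntropySolution ubar u) {k : ℝ → ℝ}
    (hk : ContDiff ℝ 1 k) (hk0 : 0 ≤ k 0) (hkm : Monotone k)
    (hs : ∀ t, 0 ≤ t → ∀ x, |bpSource (u t) x| ≤ deriv k t) (h0 : ∀ x, |ubar x| ≤ k 0) {b : ℝ}
    (hb : 0 ≤ b) : ∀ᵐ x, |u b x| ≤ k b := by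
  have hu0 : ∀ᵐ x, |u 0 x| ≤ k 0 := hu.initial.mono fun x hx => hx ▸ h0 x
  rcases hb.eq_or_lt with rfl | hb
  · exact hu0
  set T := b + 1 with hT
  have hkn : ∀ t, 0 ≤ t → 0 ≤ k t := fun t ht => hk0.trans (hkm ht)
  have iH : ∀ t, 0 ≤ t → Integrable fun x => max (|u t x| - k t) 0 := fun t ht =>
    (hu.integrable t ht).abs.mono' (((hu.integrable t ht).abs.aestronglyMeasurable.sub
      aestronglyMeasurable_const).sup aestronglyMeasurable_const) (Eventually.of_forall fun x => by
        rw [Real.norm_eq_abs, abs_of_nonneg (le_max_right _ _)]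
        exact max_le (by linarith [hkn t ht]) (abs_nonneg _))
  have key : ∀ a ∈ Ioc 0 b, ∫ x, max (|u b x| - k b) 0 ≤ ∫ x, |u a x - u 0 x| := by
    intro a ha
    obtain ⟨C', hC'⟩ := hu.locallyBounded (a / 2) T (by linarith [ha.1])
    set C := max C' 0 with hCdef
    set B := k T with hB
    have hB0 : 0 ≤ B := hkn T (by linarith)
    have hC0 : 0 ≤ C := le_max_right _ _
    set S : Set (ℝ × ℝ) := Ioo (a / 2) T ×ˢ univ with hS
    have hms : MeasurableSet S := measurableSet_Ioo.prod MeasurableSet.univ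
    have hsub : S ⊆ Ioi 0 ×ˢ univ := prod_mono (fun t ht => by
      have := ht.1; have := ha.1; rw [mem_Ioi]; linarith) subset_rfl
    have hC : ∀ᵐ p : ℝ × ℝ ∂(volume.restrict S), |u p.1 p.2| ≤ C :=
      (hC'.filter_mono (ae_mono (Measure.restrict_mono
        (prod_mono Ioo_subset_Icc_self subset_rfl) le_rfl))).mono
        fun p hp => hp.trans (le_max_left _ _)
    obtain ⟨D, hD⟩ := (isCompact_Icc (a := 0) (b := T)).bddAbove_image
      (hk.continuous_deriv le_rfl).continuousOn
    have hkc := hk.continuous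
    have hdc := hk.continuous_deriv le_rfl
    have mu := (hu.aestronglyMeasurable.mono_measure (Measure.restrict_mono hsub le_rfl)).aemeasurable
    have ms := (hu.aestronglyMeasurable_bpSource.mono_measure
      (Measure.restrict_mono hsub le_rfl)).aemeasurable
    have mk : AEMeasurable (fun p : ℝ × ℝ => k p.1) (volume.restrict S) :=
      (hkc.comp continuous_fst).measurable.aemeasurable
    have mk' : AEMeasurable (fun p : ℝ × ℝ => deriv k p.1) (volume.restrict S) :=
      (hdc.comp continuous_fst).measurable.aemeasurable
    have sg1 := measurable_realSign.comp_aemeasurable (mu.sub mk)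
    have sg2 := measurable_realSign.comp_aemeasurable (mu.add mk)
    have mq := ((mu.pow_const 2).div_const 2).sub ((mk.pow_const 2).div_const 2)
    set H : ℝ × ℝ → ℝ := fun p => |u p.1 p.2 - k p.1| + |u p.1 p.2 + k p.1| - 2 * k p.1 with hH
    have hHmax : ∀ t, 0 ≤ t → ∀ x, H (t, x) = 2 * max (|u t x| - k t) 0 := fun t ht x =>
      (abs_sub_add_abs_add_sub_bounds (s := 0) (k' := 0) (hkn t ht) (by simp) le_rfl le_rfl).1
    have hL : 0 ≤ (C + B) / 2 := by positivity
    have hHcont : ∀ R, ContinuousOn (fun t => ∫ x, H (t, x) * coneCutoff ((C + B) / 2) R (t, x))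
        (Ioo (a / 2) T) := fun R => by
      have hkB : ∀ t ∈ Ico 0 T, k t ≤ B := fun t ht => hkm ht.2.le
      have c1 := continuousOn_integral_abs_sub_mul_coneCutoff (u := u) (w := fun t _ => k t) (T := T)
        (R := R) (B := B) hL (fun t ht => hu.integrable t ht.1)
        (fun s hs => hu.continuous_L1_Ico hs.1 T) (by fun_prop)
        (fun t ht _ => (abs_of_nonneg (hkn t ht.1)).trans_le (hkB t ht))
      have c2 := continuousOn_integral_abs_sub_mul_coneCutoff (u := u) (w := fun t _ => -k t) (T := T)
        (R := R) (B := B) hL (fun t ht => hu.integrable t ht.1)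
        (fun s hs => hu.continuous_L1_Ico hs.1 T) (by fun_prop)
        (fun t ht _ => (abs_neg _).trans_le ((abs_of_nonneg (hkn t ht.1)).trans_le (hkB t ht)))
      -- The term `2 k` is written as `|0 - 2 k|`, so that the same continuity statement covers it.
      have c3 := continuousOn_integral_abs_sub_mul_coneCutoff (u := fun _ _ => 0)
        (w := fun t _ => 2 * k t) (T := T) (R := R) (B := 2 * B) hL (fun _ _ => integrable_zero _ _ _)
        (fun s _ => by simpa using tendsto_const_nhds) (by fun_prop) (fun t ht _ => by
          rw [abs_of_nonneg (by linarith [hkn t ht.1])]; linarith [hkB t ht])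
      refine (((c1.add c2).sub c3).mono fun t ht => ⟨by linarith [ht.1, ha.1], ht.2⟩).congr
        fun t ht => ?_
      have ht0 : 0 ≤ t := by linarith [ht.1, ha.1]
      have i1 := integrable_abs_sub_mul_coneCutoff (hu.integrable t ht0)
        (continuous_const (y := k t)) (R := R) hL ht0
      have i2 := integrable_abs_sub_mul_coneCutoff (hu.integrable t ht0)
        (continuous_const (y := -k t)) (R := R) hL ht0
      have i3 := integrable_abs_sub_mul_coneCutoff (v := fun _ => 0) (integrable_zero _ _ _)
        (continuous_const (y := 2 * k t)) (R := R) hL ht0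
      simp only [Pi.add_apply, Pi.sub_apply]
      have i12 : Integrable fun x => |u t x - k t| * coneCutoff ((C + B) / 2) R (t, x)
          + |u t x - -k t| * coneCutoff ((C + B) / 2) R (t, x) := i1.add i2
      rw [← integral_add i1 i2, ← integral_sub i12 i3]
      refine integral_congr_ae (Eventually.of_forall fun x => ?_)
      simp only [hH, sub_neg_eq_add, zero_sub, abs_neg,
        abs_of_nonneg (by linarith [hkn t ht0] : 0 ≤ 2 * k t)]
      ring
    have bds : ∀ᵐ p : ℝ × ℝ ∂(volume.restrict S), |u p.1 p.2| ≤ C ∧ k p.1 ≤ B ∧ 0 ≤ k p.1 ∧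
        |bpSource (u p.1) p.2| ≤ deriv k p.1 ∧ deriv k p.1 ≤ D := by
      filter_upwards [hC, ae_restrict_mem hms] with p hp hpm
      have h1 : 0 ≤ p.1 := by linarith [hpm.1.1, ha.1]
      exact ⟨hp, hkm hpm.1.2.le, hkn _ h1, hs _ h1 _, hD ⟨p.1, ⟨h1, hpm.1.2.le⟩, rfl⟩⟩
    have D0 : 0 ≤ D := (abs_nonneg _).trans ((hs b hb.le 0).trans (hD ⟨b, ⟨hb.le, by linarith⟩, rfl⟩))
    have sgm : ∀ x y K : ℝ, |y| ≤ K → |Real.sign x * y| ≤ K := fun x y K hy => by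
      rw [abs_mul]; exact (mul_le_of_le_one_left (abs_nonneg _) (abs_realSign_le _)).trans hy
    set E := (C + B) / 2 * (C + B) + (C + B) + 2 * D with hE
    have hLCB : 0 ≤ (C + B) / 2 * (C + B) := by positivity
    have comp : ∀ R, ∫ x, H (b, x) * coneCutoff ((C + B) / 2) R (b, x)
        ≤ (∫ x, H (a, x) * coneCutoff ((C + B) / 2) R (a, x)) + ∫ _ in a..b, (0 : ℝ) := fun R => by
      refine integral_cone_le (a₀ := a / 2) (b₀ := T) (C := 3 * E) (H := H) (g := fun _ => 0)
        (F := fun p => Real.sign (u p.1 p.2 - k p.1) * (u p.1 p.2 ^ 2 / 2 - k p.1 ^ 2 / 2)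
          + Real.sign (u p.1 p.2 + k p.1) * (u p.1 p.2 ^ 2 / 2 - k p.1 ^ 2 / 2))
        (Q := fun p => Real.sign (u p.1 p.2 - k p.1) * (bpSource (u p.1) p.2 - deriv k p.1)
          + Real.sign (u p.1 p.2 + k p.1) * (bpSource (u p.1) p.2 + deriv k p.1)
          - 2 * deriv k p.1) (by linarith [ha.1]) hL
        (((mu.sub mk).norm.add (mu.add mk).norm).sub (mk.const_mul 2)).aestronglyMeasurable
        ((sg1.mul mq).add (sg2.mul mq)).aestronglyMeasurable
        (((sg1.mul (ms.sub mk')).add (sg2.mul (ms.add mk'))).sub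
          (mk'.const_mul 2)).aestronglyMeasurable aestronglyMeasurable_const ?_ ?_ (hHcont R)
        continuousOn_const (by simp) (by linarith [ha.1]) ha.2 (by linarith)
      · filter_upwards [bds] with p ⟨h1, h2, h3, h4, h5⟩
        obtain ⟨e1, e2, e3⟩ := abs_sub_add_abs_add_sub_bounds h3 h4 h1 h2
        have h6 : max (|u p.1 p.2| - k p.1) 0 ≤ C := max_le (by linarith) hC0
        have h7 := abs_le.1 h4
        refine ⟨by simp only [hH]; rw [e1]; positivity, by simp only [hH]; rw [e1]; linarith,
          e2, ?_, e3, by rw [abs_zero]; positivity⟩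
        have g1 := sgm (u p.1 p.2 - k p.1) (bpSource (u p.1) p.2 - deriv k p.1) (2 * D)
          (abs_le.2 ⟨by linarith, by linarith⟩)
        have g2 := sgm (u p.1 p.2 + k p.1) (bpSource (u p.1) p.2 + deriv k p.1) (2 * D)
          (abs_le.2 ⟨by linarith, by linarith⟩)
        refine (abs_sub _ _).trans ?_
        rw [abs_of_nonneg (a := 2 * deriv k p.1) (by linarith)]
        linarith [abs_add_le (Real.sign (u p.1 p.2 - k p.1) * (bpSource (u p.1) p.2 - deriv k p.1))
          (Real.sign (u p.1 p.2 + k p.1) * (bpSource (u p.1) p.2 + deriv k p.1))]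
      · intro φ hφ hc hsup hφ0
        -- The levels `k(t)` and `-k(t)` are the cases `σ = 1` and `σ = -1`; they depend on time, so
        -- the inequality for `C¹` comparison functions is needed.
        have ent : ∀ {σ : ℝ}, 0 ≤ ∫ p in S, (|u p.1 p.2 - σ * k p.1| * fderiv ℝ φ p (1, 0)
            + Real.sign (u p.1 p.2 - σ * k p.1) * (u p.1 p.2 ^ 2 / 2 - (σ * k p.1) ^ 2 / 2)
              * fderiv ℝ φ p (0, 1)
            + Real.sign (u p.1 p.2 - σ * k p.1) * (bpSource (u p.1) p.2 - σ * deriv k p.1) * φ p) :=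
          fun {σ} => by
          have hd : ∀ p : ℝ × ℝ, HasFDerivAt (fun p : ℝ × ℝ => σ * k p.1)
              (σ • deriv k p.1 • ContinuousLinearMap.fst ℝ ℝ ℝ) p := fun p =>
            ((hk.differentiable one_ne_zero p.1).hasDerivAt.comp_hasFDerivAt p
              hasFDerivAt_fst).const_mul σ
          have h1 := hu.entropy_of_contDiffOn (w := fun p => σ * k p.1)
            (isOpen_Ioo.prod isOpen_univ : IsOpen S) hsub
            (contDiff_const.mul (hk.comp contDiff_fst)).contDiffOn hφ hc hsup hφ0
          rw [setIntegral_strip (by linarith [ha.1]) hsup fun p hp => by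
            simp [fderiv_eq_zero_of_notMem_tsupport hp, image_eq_zero_of_notMem_tsupport hp]] at h1
          refine h1.trans_eq (setIntegral_congr_fun hms fun p hp => ?_)
          simp only [(hd p).fderiv]
          simp
        have e1 := ent (σ := 1)
        have e2 := ent (σ := -1)
        simp only [one_mul, neg_mul, sub_neg_eq_add, neg_sq] at e1 e2
        have i1 := integrable_mul_test (C := E) (S := S) (mu.sub mk).norm.aestronglyMeasurable
          (sg1.mul mq).aestronglyMeasurable (sg1.mul (ms.sub mk')).aestronglyMeasurable hφ hc (by
            filter_upwards [bds] with p ⟨h1, h2, h3, h4, h5⟩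
            have hk1 : |k p.1| ≤ B := by rwa [abs_of_nonneg h3]
            have h6 : |u p.1 p.2 - k p.1| ≤ C + B := (abs_sub _ _).trans (add_le_add h1 hk1)
            have h7 := abs_le.1 h4
            refine ⟨by simp only [Real.norm_eq_abs, Pi.sub_apply, abs_abs]; linarith,
              (abs_realSign_mul_sq_sub_le h1 hk1).trans ?_, (sgm _ _ (2 * D)
              (abs_le.2 ⟨by simp; linarith, by simp; linarith⟩)).trans (by linarith)⟩
            have := mul_le_mul_of_nonneg_left h6 hL
            linarith)
        have i2 := integrable_mul_test (C := E) (S := S) (mu.add mk).norm.aestronglyMeasurable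
          (sg2.mul mq).aestronglyMeasurable (sg2.mul (ms.add mk')).aestronglyMeasurable hφ hc (by
            filter_upwards [bds] with p ⟨h1, h2, h3, h4, h5⟩
            have hk1 : |-k p.1| ≤ B := by rwa [abs_neg, abs_of_nonneg h3]
            have h6 : |u p.1 p.2 - -k p.1| ≤ C + B := (abs_sub _ _).trans (add_le_add h1 hk1)
            have h8 := abs_realSign_mul_sq_sub_le h1 hk1
            rw [sub_neg_eq_add] at h6 h8
            rw [neg_sq] at h8
            have h7 := abs_le.1 h4
            refine ⟨by simp only [Real.norm_eq_abs, Pi.add_apply, abs_abs]; linarith,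
              h8.trans ?_, (sgm _ _ (2 * D)
              (abs_le.2 ⟨by simp; linarith, by simp; linarith⟩)).trans (by linarith)⟩
            have := mul_le_mul_of_nonneg_left h6 hL
            linarith)
        -- Subtracting twice this vanishing integral supplies the parts `-2 k` of `H` and `-2 k'` of
        -- `Q`.
        have z := integral_mul_fderiv_fst hk hφ hc
        rw [← setIntegral_eq_integral_of_forall_compl_eq_zero (s := S) fun p hp => by
          have hp' : p ∉ tsupport φ := fun h => hp (hsup h)
          simp [fderiv_eq_zero_of_notMem_tsupport hp', image_eq_zero_of_notMem_tsupport hp']] at z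
        have i3 : Integrable (fun p : ℝ × ℝ => k p.1 * fderiv ℝ φ p (1, 0) + deriv k p.1 * φ p)
            (volume.restrict S) := by
          have := integrable_mul_test (C := B + D) (S := S) (H := fun p => k p.1) (F := fun _ => 0)
            (Q := fun p => deriv k p.1) mk.aestronglyMeasurable aestronglyMeasurable_const
            mk'.aestronglyMeasurable hφ hc (by
              filter_upwards [bds] with p ⟨h1, h2, h3, h4, h5⟩
              have := (abs_nonneg _).trans h4
              exact ⟨by rw [abs_of_nonneg h3]; linarith, by rw [abs_zero]; positivity,
                by rw [abs_of_nonneg this]; linarith⟩)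
          simpa only [zero_mul, add_zero] using this
        have h9 := (add_nonneg e1 e2).trans_eq (integral_add i1 i2).symm
        have h10 : ∫ p in S, 2 * (k p.1 * fderiv ℝ φ p (1, 0) + deriv k p.1 * φ p) = 0 := by
          rw [integral_const_mul, z, mul_zero]
        have h12 := integral_sub (i1.add i2) (i3.const_mul 2)
        rw [h10, sub_zero] at h12
        refine (h9.trans_eq h12.symm).trans_eq (integral_congr_ae (Eventually.of_forall fun p => ?_))
        simp only [hH, Pi.add_apply, Pi.sub_apply, Pi.mul_apply, Function.comp_apply, Real.norm_eq_abs]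
        ring
    -- Since `|u 0| ≤ k 0 ≤ k a`, the excess at time `a` is at most `|u a - u 0|`, which tends to
    -- zero in `L¹` as `a → 0`.
    have hHa : ∀ R, ∫ x, H (a, x) * coneCutoff ((C + B) / 2) R (a, x)
        ≤ 2 * ∫ x, |u a x - u 0 x| := fun R => by
      rw [← integral_const_mul]
      refine integral_mono_ae ?_ (((hu.integrable a ha.1.le).sub
        (hu.integrable 0 le_rfl)).abs.const_mul 2) ?_
      · simp only [hHmax a ha.1.le]
        exact integrable_mul_coneCutoff ((iH a ha.1.le).const_mul 2) _ _ _
      · filter_upwards [hu0] with x hx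
        rw [hHmax a ha.1.le]
        refine (mul_le_of_le_one_right (by positivity) (coneCutoff_le_one _)).trans
          (mul_le_mul_of_nonneg_left (max_le ?_ (abs_nonneg _)) zero_le_two)
        have h1 := hkm ha.1.le
        have h2 := abs_sub_abs_le_abs_sub (u a x) (u 0 x)
        linarith
    have lim := tendsto_integral_mul_coneCutoff ((iH b hb.le).const_mul 2) ((C + B) / 2) b
    have h11 := le_of_tendsto lim (Eventually.of_forall fun R => by
      have := comp R
      simp only [hHmax b hb.le, intervalIntegral.integral_zero, add_zero] at this
      exact this.trans (hHa R))
    rw [integral_const_mul] at h11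
    linarith
  have h1 : ∫ x, max (|u b x| - k b) 0 ≤ 0 := by
    refine ge_of_tendsto ((hu.continuous_L1 0 le_rfl).mono_left
      (nhdsWithin_mono _ Ioi_subset_Ici_self)) ?_
    filter_upwards [Ioc_mem_nhdsGT hb] with a ha using key a ha
  have h2 := (integral_eq_zero_iff_of_nonneg (fun x => le_max_right _ _) (iH b hb.le)).1
    (h1.antisymm (integral_nonneg fun x => le_max_right _ _))
  filter_upwards [h2] with x hx
  have := (le_max_left _ _).trans_eq hx
  simpa using this

end IsWeakEntropySolution


/-! ### Stability from the initial time -/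

/-- Clamping of a time to `[0,T]`. -/
noncomputable def clampTime (T t : ℝ) : ℝ := max 0 (min t T)

theorem clampTime_mem {T : ℝ} (hT : 0 ≤ T) (t : ℝ) : clampTime T t ∈ Icc 0 T :=
  ⟨le_max_left _ _, max_le hT (min_le_right _ _)⟩

theorem clampTime_of_mem {T t : ℝ} (ht : t ∈ Icc 0 T) : clampTime T t = t := by
  rw [clampTime, min_eq_left ht.2, max_eq_right ht.1]

theorem continuous_clampTime (T : ℝ) : Continuous (clampTime T) := by
  unfold clampTime; fun_prop

theorem integral_abs_mul_coneCutoff_le {f : ℝ → ℝ} (hf : Continuous f) {ε : ℝ}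
    (hε : ∀ x, |f x| ≤ ε) {L R t : ℝ} (hL : 0 ≤ L) (hR : 0 ≤ R) (ht : 0 ≤ t) :
    ∫ x, |f x| * coneCutoff L R (t, x) ≤ ε * (2 * (1 + R)) := by
  have h0 : ∀ x ∉ Icc (-(1 + R)) (1 + R), |f x| * coneCutoff L R (t, x) = 0 := fun x hx => by
    rw [coneCutoff_eq_zero hL ht, mul_zero]
    by_contra! h; exact hx (abs_le.1 h.le)
  rw [← setIntegral_eq_integral_of_forall_compl_eq_zero h0]
  have hc : Continuous fun x => |f x| * coneCutoff L R (t, x) :=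
    hf.abs.mul (contDiff_coneCutoff.continuous.comp (by fun_prop))
  refine (setIntegral_mono_on (g := fun _ => ε) hc.integrableOn_Icc (by simp) measurableSet_Icc
    fun x _ => (mul_le_of_le_one_right (abs_nonneg _) (coneCutoff_le_one _)).trans (hε x)).trans_eq ?_
  rw [setIntegral_const, smul_eq_mul, Real.volume_real_Icc_of_le (by linarith)]
  ring

namespace IsClassicalSolution

variable {r : ℝ → ℝ → ℝ} {f : ℝ → ℝ} {T : ℝ} {w : ℝ → ℝ → ℝ}

theorem continuousOn (h : IsClassicalSolution r f T w) :
    ContinuousOn (fun p : ℝ × ℝ => w p.1 p.2) (Icc 0 T ×ˢ univ) := h.contDiffOn.continuousOn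

theorem contDiffOn_slice (h : IsClassicalSolution r f T w) {t : ℝ} (ht : t ∈ Icc 0 T) :
    ContDiff ℝ 1 (w t) := by
  rw [← contDiffOn_univ]
  exact h.contDiffOn.comp (f := fun x : ℝ => (t, x)) (by fun_prop) fun x _ => ⟨ht, mem_univ _⟩

end IsClassicalSolution

namespace IsWeakEntropySolution

variable {ubar : ℝ → ℝ} {u : ℝ → ℝ → ℝ}

theorem ae_abs_le_of_forall_ae (hu : IsWeakEntropySolution ubar u) {T C : ℝ}
    (hC : ∀ t ∈ Ioo 0 T, ∀ᵐ x, |u t x| ≤ C) :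
    ∀ᵐ p : ℝ × ℝ ∂(volume.restrict (Ioo 0 T ×ˢ univ)), |u p.1 p.2| ≤ C := by
  have hm := hu.aestronglyMeasurable.mono_measure
    (Measure.restrict_mono (prod_mono (fun t (ht : t ∈ Ioo 0 T) => ht.1) subset_rfl) le_rfl)
  rw [volume_restrict_prod_univ] at hm ⊢
  -- Passing from almost every slice to almost every point requires a measurable set, hence the
  -- measurable modification of `u`.
  have h1 : ∀ᵐ t ∂(volume.restrict (Ioo 0 T)), ∀ᵐ x, |hm.mk _ (t, x)| ≤ C := by
    filter_upwards [Measure.ae_ae_of_ae_prod hm.ae_eq_mk, ae_restrict_mem measurableSet_Ioo]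
      with t ht ht'
    filter_upwards [ht, hC t ht'] with x hx hx'
    rwa [← hx]
  have h2 := (Measure.ae_prod_iff_ae_ae (μ := volume.restrict (Ioo 0 T)) (ν := volume)
    (p := fun p => |hm.mk _ p| ≤ C)
    (measurableSet_le hm.stronglyMeasurable_mk.measurable.abs measurable_const)).2 h1
  filter_upwards [h2, hm.ae_eq_mk] with p hp hp'
  rw [hp']; exact hp

/-- Both functions start from `ubar`, and the sources differ by at most `ε` on slices of width at
most `2 (1 + R)`. The estimate holds from every time `a > 0`; continuity of the cone integral allows
`a → 0`. -/
theorem integral_abs_sub_classical_le (hu : IsWeakEntropySolution ubar u) {w r : ℝ → ℝ → ℝ}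
    {T C B ε R b : ℝ} (hC : ∀ t ∈ Ioo 0 T, ∀ᵐ x, |u t x| ≤ C) (hCB : 0 ≤ C + B)
    (hw : IsClassicalSolution r ubar T w) (hr : Continuous fun p : ℝ × ℝ => r p.1 p.2)
    (hB : ∀ t ∈ Icc 0 T, ∀ x, |w t x| ≤ B)
    (hε : ∀ t ∈ Ioo 0 T, ∀ x, |bpSource (u t) x - r t x| ≤ ε) (hR : 0 ≤ R) (hb : b ∈ Ico 0 T) :
    ∫ x, |u b x - w b x| * coneCutoff ((C + B) / 2) R (b, x) ≤ ε * (2 * (1 + R)) * b := by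
  have hL : 0 ≤ (C + B) / 2 := by positivity
  have hsub : (Ico 0 T ×ˢ univ : Set (ℝ × ℝ)) ⊆ Icc 0 T ×ˢ univ :=
    prod_mono Ico_subset_Icc_self subset_rfl
  have hwc := hw.continuousOn.mono hsub
  have hcont := continuousOn_integral_abs_sub_mul_coneCutoff (R := R) hL
    (fun t ht => hu.integrable t ht.1) (fun s hs => hu.continuous_L1_Ico hs.1 T) hwc
    (fun t ht => hB t (Ico_subset_Icc_self ht))
  set h : ℝ → ℝ := fun t => ∫ x, |u t x - w t x| * coneCutoff ((C + B) / 2) R (t, x) with hh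
  have h0 : h 0 = 0 := by
    simp only [hh]
    refine integral_eq_zero_of_ae (hu.initial.mono fun x hx => ?_)
    simp only [hx, hw.initial, sub_self, abs_zero, zero_mul, Pi.zero_apply]
  rcases hb.1.eq_or_lt with hb0 | hb0
  · rw [← hb0]; simpa using h0.le
  have key : ∀ a ∈ Ioc 0 b, h b ≤ h a + ε * (2 * (1 + R)) * (b - a) := fun a ha => by
    have := hu.integral_abs_sub_le (w := w) (r := r) (a₀ := 0) (D := ε) (R := R)
      (G := fun _ => ε * (2 * (1 + R))) le_rfl hCB (hu.ae_abs_le_of_forall_ae hC)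
      (hw.contDiffOn.mono (prod_mono Ioo_subset_Icc_self subset_rfl)) hwc
      (fun t ht => hB t (Ico_subset_Icc_self ht)) hw.pde hr.continuousOn hε continuousOn_const
      (fun t ht => integral_abs_mul_coneCutoff_le ((continuous_bpSource
        (hu.integrable t ht.1.le)).sub (hr.comp (f := fun x => (t, x)) (by fun_prop)))
        (hε t ht) hL hR ht.1.le) ha.1 ha.2 hb.2
    rw [intervalIntegral.integral_const, smul_eq_mul, mul_comm (b - a)] at this
    exact this
  have hT : 0 < T := hb0.trans hb.2
  have lim : Tendsto (fun a => h a + ε * (2 * (1 + R)) * (b - a)) (𝓝[Ioc 0 b] 0)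
      (𝓝 (h 0 + ε * (2 * (1 + R)) * (b - 0))) := by
    refine Tendsto.add ((hcont 0 ⟨le_rfl, hT⟩).mono_left (nhdsWithin_mono _ fun a ha =>
      ⟨ha.1.le, ha.2.trans_lt hb.2⟩)) (Continuous.tendsto' (by fun_prop) _ _ rfl |>.mono_left
      inf_le_left)
  have : (𝓝[Ioc 0 b] (0 : ℝ)).NeBot := left_nhdsWithin_Ioc_neBot hb0
  have := ge_of_tendsto lim (by filter_upwards [self_mem_nhdsWithin] with a ha using key a ha)
  simpa [h0] using this

theorem setIntegral_abs_sub_classical_le (hu : IsWeakEntropySolution ubar u) {w r : ℝ → ℝ → ℝ}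
    {T C B ε ρ b : ℝ} (hC : ∀ t ∈ Ioo 0 T, ∀ᵐ x, |u t x| ≤ C) (hCB : 0 ≤ C + B)
    (hw : IsClassicalSolution r ubar T w) (hr : Continuous fun p : ℝ × ℝ => r p.1 p.2)
    (hB : ∀ t ∈ Icc 0 T, ∀ x, |w t x| ≤ B)
    (hε : ∀ t ∈ Ioo 0 T, ∀ x, |bpSource (u t) x - r t x| ≤ ε) (hb : b ∈ Ico 0 T) :
    ∫ x in Icc (-ρ) ρ, |u b x - w b x|
      ≤ ε * (2 * (1 + (√(1 + ρ ^ 2) + (C + B) / 2 * T))) * T := by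
  have hT : 0 < T := hb.1.trans_lt hb.2
  have hL : 0 ≤ (C + B) / 2 := by positivity
  have hε0 : 0 ≤ ε := (abs_nonneg _).trans (hε (T / 2) ⟨by linarith, by linarith⟩ 0)
  -- With this radius the cutoff equals `1` on `[-ρ, ρ]` at all times up to `T`.
  have hR : 0 ≤ √(1 + ρ ^ 2) + (C + B) / 2 * T := by positivity
  have h1 := hu.integral_abs_sub_classical_le hC hCB hw hr hB hε hR hb
  have hwc := (hw.contDiffOn_slice (Ico_subset_Icc_self hb)).continuous
  have hi := integrable_abs_sub_mul_coneCutoff (R := √(1 + ρ ^ 2) + (C + B) / 2 * T)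
    (hu.integrable b hb.1) hwc hL hb.1
  have h2 : ∫ x in Icc (-ρ) ρ, |u b x - w b x|
      = ∫ x in Icc (-ρ) ρ, |u b x - w b x| *
        coneCutoff ((C + B) / 2) (√(1 + ρ ^ 2) + (C + B) / 2 * T) (b, x) := by
    refine setIntegral_congr_fun measurableSet_Icc fun x hx => ?_
    rw [coneCutoff_eq_one, mul_one]
    have h3 : x ^ 2 ≤ ρ ^ 2 := sq_le_sq' hx.1 hx.2
    have h4 : √(1 + x ^ 2) ≤ √(1 + ρ ^ 2) := Real.sqrt_le_sqrt (by linarith)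
    have h5 := mul_le_mul_of_nonneg_left hb.2.le hL
    linarith
  rw [h2]
  refine (setIntegral_le_integral hi (Eventually.of_forall fun x =>
    mul_nonneg (abs_nonneg _) (coneCutoff_nonneg _))).trans (h1.trans ?_)
  exact mul_le_mul_of_nonneg_left hb.2.le (by positivity)

end IsWeakEntropySolution


/-! ### Averaged sources and a continuous version of the solution -/

/-- The average of `g` over `[x, x + δ]`. -/
noncomputable def forwardAverage (δ : ℝ) (g : ℝ → ℝ) (x : ℝ) : ℝ :=
  δ⁻¹ * ∫ y in (0 : ℝ)..δ, g (x + y)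

section ForwardAverage

variable {δ : ℝ} {g : ℝ → ℝ}

theorem hasDerivAt_forwardAverage (hg : Continuous g) (x : ℝ) :
    HasDerivAt (forwardAverage δ g) (δ⁻¹ * (g (x + δ) - g x)) x := by
  have e : forwardAverage δ g
      = fun x => δ⁻¹ * ((∫ y in (0 : ℝ)..(x + δ), g y) - ∫ y in (0 : ℝ)..x, g y) := by
    ext x
    rw [forwardAverage, intervalIntegral.integral_comp_add_left (fun y => g y), add_zero,
      intervalIntegral.integral_interval_sub_left (hg.intervalIntegrable _ _)
        (hg.intervalIntegrable _ _)]
  rw [e]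
  have h : ∀ x, HasDerivAt (fun x => ∫ y in (0 : ℝ)..x, g y) (g x) x := fun x =>
    intervalIntegral.integral_hasDerivAt_right (hg.intervalIntegrable _ _)
      hg.aestronglyMeasurable.stronglyMeasurableAtFilter hg.continuousAt
  exact (((h (x + δ)).comp_add_const x δ).sub (h x)).const_mul _

theorem continuous_forwardAverage {r : ℝ → ℝ → ℝ} (hr : Continuous fun p : ℝ × ℝ => r p.1 p.2) :
    Continuous fun p : ℝ × ℝ => forwardAverage δ (r p.1) p.2 := by
  refine continuous_const.mul ?_
  exact intervalIntegral.continuous_parametric_intervalIntegral_of_continuous'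
    (f := fun (p : ℝ × ℝ) y => r p.1 (p.2 + y))
    (hr.comp (f := fun q : (ℝ × ℝ) × ℝ => (q.1.1, q.1.2 + q.2)) (by fun_prop)) 0 δ

theorem abs_forwardAverage_sub_le (hδ : 0 < δ) (hg : Continuous g) {x c K : ℝ}
    (h : ∀ y ∈ Icc 0 δ, |g (x + y) - c| ≤ K) : |forwardAverage δ g x - c| ≤ K := by
  have e : forwardAverage δ g x - c = δ⁻¹ * ∫ y in (0 : ℝ)..δ, (g (x + y) - c) := by
    rw [intervalIntegral.integral_sub (Continuous.intervalIntegrable (by fun_prop) _ _) (by simp),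
      intervalIntegral.integral_const, smul_eq_mul, forwardAverage, mul_sub]
    field_simp
    ring
  rw [e, abs_mul, abs_of_pos (inv_pos.2 hδ), inv_mul_le_iff₀ hδ]
  have := intervalIntegral.norm_integral_le_of_norm_le_const (a := 0) (b := δ) (C := K)
    (f := fun y => g (x + y) - c) fun y hy => by
      rw [uIoc_of_le hδ.le] at hy
      exact h y ⟨hy.1.le, hy.2⟩
  rw [sub_zero, abs_of_pos hδ, mul_comm] at this
  exact this

end ForwardAverage

/-- `F` bounds `‖u(t)‖_∞ + ‖u(t)‖₁ / 2`, hence also the slope of the source term. -/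
def SourceSlopeBound (u : ℝ → ℝ → ℝ) (F : ℝ → ℝ) : Prop :=
  ∀ t, 0 ≤ t → ∃ C, (∀ᵐ x, |u t x| ≤ C) ∧ C + (∫ x, |u t x|) / 2 ≤ F t

theorem continuous_abs_le_of_ae {f : ℝ → ℝ} (hf : Continuous f) {C : ℝ} (h : ∀ᵐ x, |f x| ≤ C)
    (x : ℝ) : |f x| ≤ C := by
  have h1 : (fun x => max (|f x| - C) 0) =ᵐ[volume] fun _ => 0 := h.mono fun x hx => by
    simp only; rw [max_eq_right]; linarith
  have h2 := congrFun (Continuous.ae_eq_iff_eq volume (by fun_prop) continuous_const |>.1 h1) x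
  have := (le_max_left (|f x| - C) 0).trans_eq h2
  linarith

namespace SourceSlopeBound

variable {u : ℝ → ℝ → ℝ} {F : ℝ → ℝ} {t : ℝ}

theorem ae_abs_le (h : SourceSlopeBound u F) (ht : 0 ≤ t) : ∀ᵐ x, |u t x| ≤ F t := by
  obtain ⟨C, h1, h2⟩ := h t ht
  have : 0 ≤ ∫ x, |u t x| := integral_nonneg fun x => abs_nonneg _
  exact h1.mono fun x hx => by linarith

theorem integral_le (h : SourceSlopeBound u F) (ht : 0 ≤ t) : (∫ x, |u t x|) / 2 ≤ F t := by
  obtain ⟨C, h1, h2⟩ := h t ht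
  obtain ⟨x, hx⟩ := h1.exists
  have := (abs_nonneg _).trans hx
  linarith

theorem nonneg (h : SourceSlopeBound u F) (ht : 0 ≤ t) : 0 ≤ F t :=
  le_trans (div_nonneg (integral_nonneg fun _ => abs_nonneg _) zero_le_two) (h.integral_le ht)

theorem abs_bpSource_le (h : SourceSlopeBound u F) (ht : 0 ≤ t) (hi : Integrable (u t)) (x : ℝ) :
    |bpSource (u t) x| ≤ F t := (_root_.abs_bpSource_le hi x).trans (h.integral_le ht)

theorem abs_bpSource_sub_le (h : SourceSlopeBound u F) (ht : 0 ≤ t) (hi : Integrable (u t))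
    (x x' : ℝ) : |bpSource (u t) x' - bpSource (u t) x| ≤ F t * |x' - x| := by
  obtain ⟨C, h1, h2⟩ := h t ht
  rcases le_total x x' with hx | hx
  · rw [abs_of_nonneg (sub_nonneg.2 hx)]
    exact (abs_bpSource_sub_le_mul hi h1 hx).trans
      (mul_le_mul_of_nonneg_right h2 (sub_nonneg.2 hx))
  · rw [abs_sub_comm, abs_sub_comm x', abs_of_nonneg (sub_nonneg.2 hx)]
    exact (abs_bpSource_sub_le_mul hi h1 hx).trans
      (mul_le_mul_of_nonneg_right h2 (sub_nonneg.2 hx))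

end SourceSlopeBound

namespace IsWeakEntropySolution

variable {ubar : ℝ → ℝ} {u : ℝ → ℝ → ℝ}

theorem continuous_bpSource_clampTime (hu : IsWeakEntropySolution ubar u) {T : ℝ} (hT : 0 ≤ T) :
    Continuous fun p : ℝ × ℝ => bpSource (u (clampTime T p.1)) p.2 :=
  hu.continuousOn_bpSource.comp_continuous
    (f := fun p : ℝ × ℝ => (clampTime T p.1, p.2))
    (((continuous_clampTime T).comp continuous_fst).prodMk continuous_snd)
    fun p => ⟨(clampTime_mem hT p.1).1, mem_univ _⟩

/-- The source of a merely bounded solution is Lipschitz in `x`; its forward average over length `δ`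
is `C¹` with the same bound `F` on the slope and lies within `D δ` of it. The classical solutions
for the averaged sources therefore share the barrier `Y`, and all constants collected in `A` are
independent of `δ`. -/
theorem exists_approximation (hu : IsWeakEntropySolution ubar u) (hC1 : ContDiff ℝ 1 ubar)
    {F Y Y' : ℝ → ℝ} {T : ℝ} (hT : 0 < T) (hF : SourceSlopeBound u F) (hFc : Continuous F)
    (hY : ∀ t ∈ Icc 0 T, HasDerivAt Y (Y' t) t ∧ Y t ^ 2 + F t ≤ Y' t)
    (hY0 : ∀ x, -Y 0 ≤ deriv ubar x) :
    ∃ A, 0 ≤ A ∧ ∀ δ, 0 < δ → ∃ w : ℝ → ℝ → ℝ,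
      ContinuousOn (fun p : ℝ × ℝ => w p.1 p.2) (Icc 0 T ×ˢ univ) ∧
      (∀ t ∈ Icc 0 T, Differentiable ℝ (w t)) ∧
      (∀ t ∈ Icc 0 T, ∀ x, ∃ α, |x - α| ≤ A * t ∧ |w t x - ubar α| ≤ A * t) ∧
      (∀ t ∈ Icc 0 T, ∀ x, -A ≤ deriv (w t) x) ∧
      (∀ t ∈ Ioc 0 T, ∀ x, deriv (w t) x ≤ 1 / t + A) ∧
      ∀ t ∈ Ico 0 T, ∀ ρ, ∫ x in Icc (-ρ) ρ, |u t x - w t x|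
        ≤ δ * (A * (2 * (1 + (√(1 + ρ ^ 2) + A * T))) * T) := by
  obtain ⟨t₀, -, hmax⟩ := isCompact_Icc.exists_isMaxOn (nonempty_Icc.2 hT.le) hFc.continuousOn
  set D := F t₀ with hD
  have hFD : ∀ t ∈ Icc 0 T, F t ≤ D := fun t ht => hmax ht
  have hD0 : 0 ≤ D := (hF.nonneg le_rfl).trans (hFD 0 ⟨le_rfl, hT.le⟩)
  have hYc : ContinuousOn Y (Icc 0 T) := fun t ht => (hY t ht).1.continuousAt.continuousWithinAt
  obtain ⟨D', hD'⟩ := isCompact_Icc.exists_bound_of_continuousOn hYc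
  have hub : ∀ x, |ubar x| ≤ D := continuous_abs_le_of_ae hC1.continuous (by
    filter_upwards [hu.initial, hF.ae_abs_le le_rfl] with x hx hx'
    rw [← hx]; exact hx'.trans (hFD 0 ⟨le_rfl, hT.le⟩))
  -- Freezing time outside `[0, T]` gives a source on all of `ℝ × ℝ`, as the global flow requires.
  set r : ℝ → ℝ → ℝ := fun t x => bpSource (u (clampTime T t)) x with hr
  have hcm := clampTime_mem hT.le
  have hint : ∀ t, Integrable (u (clampTime T t)) := fun t => hu.integrable _ (hcm t).1
  have hrc : Continuous fun p : ℝ × ℝ => r p.1 p.2 := hu.continuous_bpSource_clampTime hT.le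
  have hrs : ∀ t, Continuous (r t) := fun t => continuous_bpSource (hint t)
  have hrl : ∀ t x x', |r t x' - r t x| ≤ F (clampTime T t) * |x' - x| := fun t =>
    hF.abs_bpSource_sub_le (hcm t).1 (hint t)
  have hrb : ∀ t x, |r t x| ≤ D := fun t x =>
    (hF.abs_bpSource_le (hcm t).1 (hint t) x).trans (hFD _ (hcm t))
  set A := D + D * T + (D + 1) + |D'| with hA
  have hDT : 0 ≤ D * T := by positivity
  have hD'0 := abs_nonneg D'
  refine ⟨A, by positivity, fun δ hδ => ?_⟩
  set rδ : ℝ → ℝ → ℝ := fun t => forwardAverage δ (r t) with hrδ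
  have hd : ∀ t x, HasDerivAt (rδ t) (δ⁻¹ * (r t (x + δ) - r t x)) x := fun t =>
    hasDerivAt_forwardAverage (hrs t)
  have hdF : ∀ t x, |δ⁻¹ * (r t (x + δ) - r t x)| ≤ F (clampTime T t) := fun t x => by
    have := hrl t x (x + δ)
    rw [add_sub_cancel_left, abs_of_pos hδ, mul_comm] at this
    rwa [abs_mul, abs_of_pos (inv_pos.2 hδ), inv_mul_le_iff₀ hδ]
  have hbd : ∀ t x, |rδ t x| ≤ D := fun t x => by
    have := abs_forwardAverage_sub_le (c := 0) (x := x) (K := D) hδ (hrs t)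
      fun y _ => by rw [sub_zero]; exact hrb _ _
    rwa [sub_zero] at this
  have happ : ∀ t x, |r t x - rδ t x| ≤ D * δ := fun t x => by
    rw [abs_sub_comm]
    refine abs_forwardAverage_sub_le hδ (hrs t) fun y hy => (hrl t x (x + y)).trans ?_
    rw [add_sub_cancel_left, abs_of_nonneg hy.1]
    exact mul_le_mul (hFD _ (hcm t)) hy.2 hy.1 hD0
  obtain ⟨w, hw, hfoot, hlow, hup, -⟩ := exists_isClassicalSolution (T := T) (F := F) (Y := Y)
    (Y' := Y') (continuous_forwardAverage hrc) (by fun_prop) hd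
    (fun t x => (hdF t x).trans (hFD _ (hcm t))) hbd hC1 hub
    (fun t ht x => (hdF t x).trans_eq (by rw [clampTime_of_mem ht])) hY hY0
  have hwB : ∀ t ∈ Icc 0 T, ∀ x, |w t x| ≤ D + D * T := fun t ht x => by
    obtain ⟨α, -, h2⟩ := hfoot t ht x
    have h3 := abs_sub_abs_le_abs_sub (w t x) (ubar α)
    have h4 := mul_le_mul_of_nonneg_left ht.2 hD0
    linarith [hub α]
  refine ⟨w, hw.continuousOn, fun t ht => (hw.contDiffOn_slice ht).differentiable one_ne_zero,
    fun t ht x => ?_, fun t ht x => ?_, fun t ht x => ?_, fun t ht ρ => ?_⟩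
  · obtain ⟨α, h1, h2⟩ := hfoot t ht x
    have h4 := mul_le_mul_of_nonneg_left ht.2 hD0
    refine ⟨α, h1.trans (mul_le_mul_of_nonneg_right (by linarith) ht.1),
      h2.trans (mul_le_mul_of_nonneg_right (by linarith) ht.1)⟩
  · have h1 := hlow t ht x
    have h2 := (le_abs_self _).trans (hD' t ht)
    linarith [le_abs_self D']
  -- The choice `k = D + 1` works since `F ≤ D ≤ (D + 1)²`.
  · have h1 := (hup (D + 1) (by positivity) fun t ht => (hFD t ht).trans (by nlinarith)).1 t ht x
    linarith
  · have h1 := hu.setIntegral_abs_sub_classical_le (ρ := ρ) (ε := D * δ) (C := D) (B := D + D * T)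
      (fun t ht => (hF.ae_abs_le ht.1.le).mono fun x hx => hx.trans (hFD t (Ioo_subset_Icc_self ht)))
      (by positivity) hw (continuous_forwardAverage hrc) hwB (fun t ht x => by
        have := happ t x
        simp only [hr, clampTime_of_mem (Ioo_subset_Icc_self ht)] at this
        exact this) ht
    refine h1.trans ?_
    have e : δ * (A * (2 * (1 + (√(1 + ρ ^ 2) + A * T))) * T)
      = A * δ * (2 * (1 + (√(1 + ρ ^ 2) + A * T))) * T := by ring
    rw [e]
    have g1 : D ≤ A := by linarith
    have g2 : (D + (D + D * T)) / 2 ≤ A := by linarith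
    gcongr

end IsWeakEntropySolution


/-- A Lipschitz function is controlled by its mean absolute value over a short interval. -/
theorem abs_le_integral_add_of_lipschitz {g : ℝ → ℝ} (hg : Continuous g) {Λ r ρ x : ℝ}
    (hΛ : ∀ x y, |g x - g y| ≤ Λ * |x - y|) (hΛ0 : 0 ≤ Λ) (hr : 0 < r) (hx : |x| + r ≤ ρ) :
    |g x| ≤ (2 * r)⁻¹ * (∫ y in Icc (-ρ) ρ, |g y|) + Λ * r := by
  have hx' := abs_le.1 (le_refl |x|)
  have hsub : Icc (x - r) (x + r) ⊆ Icc (-ρ) ρ := Icc_subset_Icc (by linarith) (by linarith)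
  have h1 : ∫ y in Icc (x - r) (x + r), |g y| ≤ ∫ y in Icc (-ρ) ρ, |g y| :=
    setIntegral_mono_set hg.abs.integrableOn_Icc (Eventually.of_forall fun y => abs_nonneg _)
      hsub.eventuallyLE
  have h2 : ∫ _ in Icc (x - r) (x + r), (|g x| - Λ * r) ≤ ∫ y in Icc (x - r) (x + r), |g y| := by
    refine setIntegral_mono_on (by simp) hg.abs.integrableOn_Icc measurableSet_Icc fun y hy => ?_
    have h3 : |x - y| ≤ r := abs_le.2 ⟨by linarith [hy.2], by linarith [hy.1]⟩
    have h4 := (hΛ x y).trans (mul_le_mul_of_nonneg_left h3 hΛ0)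
    have h5 := abs_sub_abs_le_abs_sub (g x) (g y)
    linarith
  rw [setIntegral_const, smul_eq_mul, Real.volume_real_Icc_of_le (by linarith)] at h2
  have h6 : 2 * r * (|g x| - Λ * r) ≤ ∫ y in Icc (-ρ) ρ, |g y| := by
    refine le_trans (le_of_eq ?_) (h2.trans h1); ring
  have h7 := (le_inv_mul_iff₀ (by positivity : 0 < 2 * r)).2 h6
  linarith

theorem ae_eq_of_forall_setIntegral_abs_sub_eq_zero {v w : ℝ → ℝ} (hv : Integrable v)
    (hw : Continuous w) (h : ∀ N : ℕ, ∫ x in Icc (-(N : ℝ)) N, |v x - w x| = 0) :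
    v =ᵐ[volume] w := by
  have h1 : ∀ N : ℕ, ∀ᵐ x, x ∈ Icc (-(N : ℝ)) N → v x = w x := fun N => by
    have h2 := (setIntegral_eq_zero_iff_of_nonneg_ae (Eventually.of_forall fun x => abs_nonneg _)
      ((hv.integrableOn.sub hw.integrableOn_Icc).abs)).1 (h N)
    rw [EventuallyEq, ae_restrict_iff' measurableSet_Icc] at h2
    filter_upwards [h2] with x hx hx'
    exact sub_eq_zero.1 (abs_eq_zero.1 (hx hx'))
  filter_upwards [ae_all_iff.2 h1] with x hx
  obtain ⟨N, hN⟩ := exists_nat_ge |x|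
  exact hx N (abs_le.1 hN)

namespace IsWeakEntropySolution

variable {ubar : ℝ → ℝ} {u : ℝ → ℝ → ℝ}

/-- Away from `t = 0` the approximations are uniformly Lipschitz in `x`, so their `L¹_loc`
convergence to `u` upgrades to locally uniform convergence. -/
theorem exists_continuous_version (hu : IsWeakEntropySolution ubar u) (hC1 : ContDiff ℝ 1 ubar)
    {F Y Y' : ℝ → ℝ} {T : ℝ} (hT : 0 < T) (hF : SourceSlopeBound u F) (hFc : Continuous F)
    (hY : ∀ t ∈ Icc 0 T, HasDerivAt Y (Y' t) t ∧ Y t ^ 2 + F t ≤ Y' t)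
    (hY0 : ∀ x, -Y 0 ≤ deriv ubar x) :
    ∃ w : ℝ → ℝ → ℝ, ContinuousOn (fun p : ℝ × ℝ => w p.1 p.2) (Ico 0 T ×ˢ univ) ∧
      ∀ t ∈ Ico 0 T, u t =ᵐ[volume] w t := by
  obtain ⟨A, hA, hex⟩ := hu.exists_approximation hC1 hT hF hFc hY hY0
  set δ : ℕ → ℝ := fun n => 1 / ((n : ℝ) + 1) with hδ
  have hδ0 : ∀ n, 0 < δ n := fun n => by positivity
  have hδl : Tendsto δ atTop (𝓝 0) := tendsto_one_div_add_atTop_nhds_zero_nat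
  choose w hwc hwd hfoot hlow hup hL1 using fun n => hex (δ n) (hδ0 n)
  set K : ℝ → ℝ := fun ρ => A * (2 * (1 + (√(1 + ρ ^ 2) + A * T))) * T with hK
  have hK0 : ∀ ρ, 0 ≤ K ρ := fun ρ => by positivity
  have hws : ∀ n, ∀ t ∈ Icc 0 T, Continuous (w n t) := fun n t ht => (hwd n t ht).continuous
  -- uniform Cauchy estimate away from the initial time
  have hcau : ∀ τ ρ, 0 < τ → UniformCauchySeqOn (fun n (p : ℝ × ℝ) => w n p.1 p.2) atTop
      (Ico τ T ×ˢ Icc (-ρ) ρ) := by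
    intro τ ρ hτ
    rw [Metric.uniformCauchySeqOn_iff]
    intro ε hε
    set Λ := 2 * (1 / τ + A) with hΛ
    have hΛ0 : 0 < Λ := by positivity
    -- Averaging over radius `r` costs `Λ r = ε / 2`; the `L¹` part takes the other half for large
    -- indices.
    set r := ε / (2 * Λ) with hr
    have hr0 : 0 < r := by positivity
    have hlim : Tendsto (fun n => (2 * r)⁻¹ * (2 * (δ n * K (|ρ| + r)))) atTop (𝓝 0) := by
      have := ((hδl.mul_const (K (|ρ| + r))).const_mul 2).const_mul (2 * r)⁻¹
      simpa using this
    obtain ⟨N, hN⟩ := eventually_atTop.1 (hlim.eventually_lt_const (half_pos hε))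
    refine ⟨N, fun m hm n hn p hp => ?_⟩
    obtain ⟨⟨ht1, ht2⟩, hx⟩ := hp
    have ht : p.1 ∈ Icc 0 T := ⟨hτ.le.trans ht1, ht2.le⟩
    have ht' : p.1 ∈ Ioc 0 T := ⟨hτ.trans_le ht1, ht2.le⟩
    have hdb : ∀ k x, |deriv (w k p.1) x| ≤ 1 / τ + A := fun k x => by
      have h1 := hlow k _ ht x
      have h2 := hup k _ ht' x
      have h3 : 1 / p.1 ≤ 1 / τ := one_div_le_one_div_of_le hτ ht1
      have h4 : 0 < 1 / τ := by positivity
      exact abs_le.2 ⟨by linarith, by linarith⟩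
    have hlip : ∀ k x y, |w k p.1 x - w k p.1 y| ≤ (1 / τ + A) * |x - y| := fun k x y =>
      (convex_univ.norm_image_sub_le_of_norm_deriv_le (fun z _ => hwd k _ ht z)
        (fun z _ => hdb k z) (mem_univ y) (mem_univ x))
    have hI : ∀ k, ∫ y in Icc (-(|ρ| + r)) (|ρ| + r), |u p.1 y - w k p.1 y| ≤ δ k * K (|ρ| + r) :=
      fun k => hL1 k _ ⟨ht.1, ht2⟩ _
    have hint : ∀ k, IntegrableOn (fun y => |u p.1 y - w k p.1 y|)
        (Icc (-(|ρ| + r)) (|ρ| + r)) := fun k =>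
      ((hu.integrable _ ht.1).integrableOn.sub (hws k _ ht).integrableOn_Icc).abs
    have hδm : ∀ k, N ≤ k → δ k * K (|ρ| + r) ≤ δ N * K (|ρ| + r) := fun k hk =>
      mul_le_mul_of_nonneg_right (one_div_le_one_div_of_le (by positivity) (by gcongr)) (hK0 _)
    have h5 := abs_le_integral_add_of_lipschitz (g := fun x => w m p.1 x - w n p.1 x) (Λ := Λ)
      (r := r) (ρ := |ρ| + r) (x := p.2) ((hws m _ ht).sub (hws n _ ht)) (fun x y => by
        have e : w m p.1 x - w n p.1 x - (w m p.1 y - w n p.1 y)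
          = (w m p.1 x - w m p.1 y) - (w n p.1 x - w n p.1 y) := by ring
        rw [e]
        refine (abs_sub _ _).trans ((add_le_add (hlip m x y) (hlip n x y)).trans_eq ?_)
        ring) hΛ0.le hr0 (by
          have := (abs_le.2 hx).trans (le_abs_self ρ); linarith)
    have h6 : ∫ y in Icc (-(|ρ| + r)) (|ρ| + r), |w m p.1 y - w n p.1 y|
        ≤ 2 * (δ N * K (|ρ| + r)) := by
      have h7 : ∫ y in Icc (-(|ρ| + r)) (|ρ| + r), |w m p.1 y - w n p.1 y|
          ≤ ∫ y in Icc (-(|ρ| + r)) (|ρ| + r), (|u p.1 y - w m p.1 y| + |u p.1 y - w n p.1 y|) :=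
        setIntegral_mono_on ((hws m _ ht).sub (hws n _ ht)).abs.integrableOn_Icc
          ((hint m).add (hint n)) measurableSet_Icc fun y _ => by
          have e : w m p.1 y - w n p.1 y = (u p.1 y - w n p.1 y) - (u p.1 y - w m p.1 y) := by ring
          rw [e]
          exact (abs_sub _ _).trans_eq (add_comm _ _)
      rw [integral_add (hint m) (hint n)] at h7
      linarith [hI m, hI n, hδm m hm, hδm n hn]
    have h8 := hN N le_rfl
    have h9 := mul_le_mul_of_nonneg_left h6 (inv_pos.2 (by positivity : 0 < 2 * r)).le
    have h10 : Λ * r = ε / 2 := by rw [hr]; field_simp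
    rw [Real.dist_eq]
    linarith
  -- The foot estimate has error zero at time `0`, which forces the initial values to be exact.
  have hz : ∀ n x, w n 0 x = ubar x := fun n x => by
    obtain ⟨α, h1, h2⟩ := hfoot n 0 ⟨le_rfl, hT.le⟩ x
    rw [mul_zero] at h1 h2
    rw [sub_eq_zero.1 (abs_eq_zero.1 (h2.antisymm (abs_nonneg _))),
      ← sub_eq_zero.1 (abs_eq_zero.1 (h1.antisymm (abs_nonneg _)))]
  have hlim : ∀ t ∈ Ico 0 T, ∀ x, ∃ l, Tendsto (fun n => w n t x) atTop (𝓝 l) := by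
    intro t ht x
    rcases ht.1.eq_or_lt with rfl | ht0
    · exact ⟨ubar x, by simp only [hz]; exact tendsto_const_nhds⟩
    · exact cauchySeq_tendsto_of_complete ((hcau t |x| ht0).cauchySeq
        (x := (t, x)) ⟨⟨le_rfl, ht.2⟩, abs_le.1 le_rfl⟩)
  set v : ℝ → ℝ → ℝ := fun t x => limUnder atTop fun n => w n t x with hv
  have hvl : ∀ t ∈ Ico 0 T, ∀ x, Tendsto (fun n => w n t x) atTop (𝓝 (v t x)) := fun t ht x =>
    tendsto_nhds_limUnder (hlim t ht x)
  have hvu : ∀ τ ρ, 0 < τ → TendstoUniformlyOn (fun n (p : ℝ × ℝ) => w n p.1 p.2)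
      (fun p => v p.1 p.2) atTop (Ico τ T ×ˢ Icc (-ρ) ρ) := fun τ ρ hτ =>
    (hcau τ ρ hτ).tendstoUniformlyOn_of_tendsto fun p hp => hvl p.1 ⟨hτ.le.trans hp.1.1, hp.1.2⟩ p.2
  have hv0 : ∀ x, v 0 x = ubar x := fun x =>
    tendsto_nhds_unique (hvl 0 ⟨le_rfl, hT⟩ x) (by simp only [hz]; exact tendsto_const_nhds)
  have hvc : ContinuousOn (fun p : ℝ × ℝ => v p.1 p.2) (Ico 0 T ×ˢ univ) := by
    rintro ⟨t, x⟩ ⟨ht, -⟩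
    -- At the initial time the bound `1 / t + A` degenerates; there the uniform foot estimate,
    -- together with continuity of `ubar`, replaces uniform convergence.
    rcases ht.1.eq_or_lt with ht0 | ht0
    · simp only at ht0
      subst ht0
      rw [Metric.continuousWithinAt_iff]
      intro ε hε
      obtain ⟨η, hη, hηc⟩ := Metric.continuousAt_iff.1 (hC1.continuous.continuousAt (x := x)) (ε / 2)
        (half_pos hε)
      set κ := min η (ε / 2) / (2 * (A + 1)) with hκ
      have hm0 : 0 < min η (ε / 2) := lt_min hη (half_pos hε)
      have hκ0 : 0 < κ := by positivity
      refine ⟨min κ (η / 2), lt_min hκ0 (half_pos hη), fun {p} hp hd => ?_⟩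
      rw [Prod.dist_eq, max_lt_iff, Real.dist_eq, Real.dist_eq] at hd
      simp only [sub_zero] at hd
      have ht1 : A * p.1 ≤ min η (ε / 2) / 2 := by
        have h1 : p.1 ≤ κ := (le_abs_self _).trans (hd.1.le.trans (min_le_left _ _))
        calc A * p.1 ≤ (A + 1) * κ := mul_le_mul (by linarith) h1 hp.1.1 (by linarith)
          _ = min η (ε / 2) / 2 := by rw [hκ]; field_simp
      have hx1 : |p.2 - x| < η / 2 := hd.2.trans_le (min_le_right _ _)
      have hbound : ∀ n, |w n p.1 p.2 - ubar x| ≤ 3 * ε / 4 := fun n => by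
        obtain ⟨α, h1, h2⟩ := hfoot n p.1 ⟨hp.1.1, hp.1.2.le⟩ p.2
        have h3 : dist α x < η := by
          rw [Real.dist_eq]
          have h4 := abs_sub_le α p.2 x
          rw [abs_sub_comm α p.2] at h4
          linarith [min_le_left η (ε / 2)]
        have h5 := hηc h3
        rw [Real.dist_eq] at h5
        have h6 := abs_sub_le (w n p.1 p.2) (ubar α) (ubar x)
        linarith [min_le_right η (ε / 2)]
      have := le_of_tendsto ((hvl p.1 hp.1 p.2).sub_const (ubar x)).abs
        (Eventually.of_forall hbound)
      rw [Real.dist_eq]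
      simp only [hv0]
      linarith
    · have hc : ContinuousOn (fun p : ℝ × ℝ => v p.1 p.2)
          (Ico (t / 2) T ×ˢ Icc (-(|x| + 1)) (|x| + 1)) :=
        (hvu (t / 2) (|x| + 1) (half_pos ht0)).continuousOn (Frequently.of_forall fun n =>
          (hwc n).mono (prod_mono (fun s hs => ⟨by linarith [hs.1], hs.2.le⟩) (subset_univ _)))
      have hx := abs_lt.1 (lt_add_one |x|)
      refine (hc (t, x) ⟨⟨by simp only; linarith, ht.2⟩, hx.1.le, hx.2.le⟩).mono_of_mem_nhdsWithin
        (mem_nhdsWithin_of_mem_nhds ?_)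
      exact prod_mem_nhds (Ico_mem_nhds (by linarith) ht.2) (Icc_mem_nhds hx.1 hx.2)
  refine ⟨v, hvc, fun t ht => ?_⟩
  have hvs : Continuous (v t) := by
    rw [← continuousOn_univ]
    exact hvc.comp (f := fun x => (t, x)) (by fun_prop) fun x _ => ⟨ht, mem_univ _⟩
  rcases ht.1.eq_or_lt with rfl | ht0
  · filter_upwards [hu.initial] with x hx
    rw [hx, hv0]
  refine ae_eq_of_forall_setIntegral_abs_sub_eq_zero (hu.integrable t ht.1) hvs fun N => ?_
  have ht' := Ico_subset_Icc_self ht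
  have l1 : Tendsto (fun n => ∫ x in Icc (-(N : ℝ)) N, |u t x - w n t x|) atTop
      (𝓝 (∫ x in Icc (-(N : ℝ)) N, |u t x - v t x|)) := by
    refine tendsto_integral_filter_of_dominated_convergence (fun x => |u t x| + (|v t x| + 1))
      (Eventually.of_forall fun n => ((hu.integrable t ht.1).integrableOn.sub
        (hws n t ht').integrableOn_Icc).abs.aestronglyMeasurable) ?_
      ((hu.integrable t ht.1).abs.integrableOn.add (Continuous.integrableOn_Icc (by fun_prop)))
      (Eventually.of_forall fun x => (tendsto_const_nhds.sub (hvl t ht x)).abs)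
    filter_upwards [Metric.tendstoUniformlyOn_iff.1 (hvu t N ht0) 1 one_pos] with n hn
    filter_upwards [ae_restrict_mem measurableSet_Icc] with x hx
    have h1 := hn (t, x) ⟨⟨le_rfl, ht.2⟩, hx⟩
    rw [Real.dist_eq, abs_sub_comm] at h1
    have h2 := abs_sub_abs_le_abs_sub (w n t x) (v t x)
    rw [Real.norm_eq_abs, abs_abs]
    have h3 := abs_sub (u t x) (w n t x)
    simp only at h1
    linarith
  have l2 : Tendsto (fun n => ∫ x in Icc (-(N : ℝ)) N, |u t x - w n t x|) atTop (𝓝 0) :=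
    squeeze_zero (fun n => integral_nonneg fun x => abs_nonneg _) (fun n => hL1 n t ht N)
      (by simpa using hδl.mul_const (K N))
  exact tendsto_nhds_unique l1 l2

end IsWeakEntropySolution


/-! ### The entropy solution is classical -/

theorem bpPotential_congr_ae {v v' : ℝ → ℝ} (h : v =ᵐ[volume] v') (x : ℝ) :
    bpPotential v x = bpPotential v' x :=
  integral_congr_ae (h.mono fun y hy => by simp only [hy])

namespace IsWeakEntropySolution

variable {ubar : ℝ → ℝ} {u : ℝ → ℝ → ℝ}

/-- As long as the Riccati equation `Y' = Y² + F` has a supersolution that starts above `-ubar'`,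
the entropy solution is classical. -/
theorem exists_classical_version (hu : IsWeakEntropySolution ubar u) (hC1 : ContDiff ℝ 1 ubar)
    {F Y Y' : ℝ → ℝ} {T T₁ : ℝ} (hT₁ : 0 < T₁) (hT : T₁ < T) (hF : SourceSlopeBound u F)
    (hFc : Continuous F) (hY : ∀ t ∈ Icc 0 T, HasDerivAt Y (Y' t) t ∧ Y t ^ 2 + F t ≤ Y' t)
    (hY0 : ∀ x, -Y 0 ≤ deriv ubar x) :
    ∃ w : ℝ → ℝ → ℝ, ContDiffOn ℝ 1 (fun p : ℝ × ℝ => w p.1 p.2) (Icc 0 T₁ ×ˢ univ) ∧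
      (∀ t ∈ Ico 0 T₁, u t =ᵐ[volume] w t) ∧
      (∀ t ∈ Icc 0 T₁, ∀ x, -Y t ≤ deriv (w t) x) ∧
      (∀ k, 0 ≤ k → (∀ t ∈ Icc 0 T₁, F t ≤ k ^ 2) →
        (∀ t ∈ Ioc 0 T₁, ∀ x, deriv (w t) x ≤ 1 / t + k) ∧
        ((∀ x, deriv ubar x ≤ k) → ∀ t ∈ Icc 0 T₁, ∀ x, deriv (w t) x ≤ k)) ∧
      SlopePropagates F T₁ w := by
  obtain ⟨v, hvc, hve⟩ := hu.exists_continuous_version hC1 (hT₁.trans hT) hF hFc hY hY0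
  have hcm := clampTime_mem hT₁.le
  have hcm' : ∀ t, clampTime T₁ t ∈ Ico 0 T := fun t => ⟨(hcm t).1, (hcm t).2.trans_lt hT⟩
  have hvs : ∀ t ∈ Ico 0 T, Continuous (v t) := fun t ht => by
    rw [← continuousOn_univ]
    exact hvc.comp (f := fun x => (t, x)) (by fun_prop) fun x _ => ⟨ht, mem_univ _⟩
  obtain ⟨t₀, -, hmax⟩ := isCompact_Icc.exists_isMaxOn (nonempty_Icc.2 hT₁.le) hFc.continuousOn
  set D := F t₀ with hD
  have hFD : ∀ t ∈ Icc 0 T₁, F t ≤ D := fun t ht => hmax ht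
  have hD0 : 0 ≤ D := (hF.nonneg le_rfl).trans (hFD 0 ⟨le_rfl, hT₁.le⟩)
  have hub : ∀ x, |ubar x| ≤ D := continuous_abs_le_of_ae hC1.continuous (by
    filter_upwards [hu.initial, hF.ae_abs_le le_rfl] with x hx hx'
    rw [← hx]; exact hx'.trans (hFD 0 ⟨le_rfl, hT₁.le⟩))
  set r : ℝ → ℝ → ℝ := fun t x => bpSource (u (clampTime T₁ t)) x with hr
  set r' : ℝ → ℝ → ℝ := fun t x => v (clampTime T₁ t) x + bpPotential (u (clampTime T₁ t)) x with hr'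
  have hint : ∀ t, Integrable (u (clampTime T₁ t)) := fun t => hu.integrable _ (hcm t).1
  have hrc : Continuous fun p : ℝ × ℝ => r p.1 p.2 := hu.continuous_bpSource_clampTime hT₁.le
  have hcl : Continuous fun p : ℝ × ℝ => (clampTime T₁ p.1, p.2) :=
    ((continuous_clampTime T₁).comp continuous_fst).prodMk continuous_snd
  have hrc' : Continuous fun p : ℝ × ℝ => r' p.1 p.2 :=
    (hvc.comp_continuous hcl fun p => ⟨hcm' p.1, mem_univ _⟩).add
      (hu.continuousOn_bpPotential.comp_continuous hcl fun p => ⟨(hcm p.1).1, mem_univ _⟩)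
  -- The continuous version `v` is what makes the source `C¹` in `x`, so averaging is no longer
  -- necessary.
  have hd : ∀ t x, HasDerivAt (r t) (r' t x) x := fun t x => by
    have he := hve _ (hcm' t)
    have e1 : r t = bpSource (v (clampTime T₁ t)) := funext fun y => bpSource_congr_ae he y
    have e2 : r' t x = v (clampTime T₁ t) x + bpPotential (v (clampTime T₁ t)) x := by
      simp only [hr', bpPotential_congr_ae he x]
    rw [e1, e2]
    exact hasDerivAt_bpSource ((hint t).congr he) (hvs _ (hcm' t)) x
  -- A derivative is bounded by the Lipschitz constant, so `F` bounds `r'` at every point.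
  have hdF : ∀ t x, |r' t x| ≤ F (clampTime T₁ t) := fun t x =>
    (hd t x).le_of_lip' (hF.nonneg (hcm t).1) (Eventually.of_forall fun y =>
      hF.abs_bpSource_sub_le (hcm t).1 (hint t) x y)
  have hrb : ∀ t x, |r t x| ≤ D := fun t x =>
    (hF.abs_bpSource_le (hcm t).1 (hint t) x).trans (hFD _ (hcm t))
  obtain ⟨w, hw, hfoot, hlow, hup, hprop⟩ := exists_isClassicalSolution (T := T₁) (F := F) (Y := Y)
    (Y' := Y') hrc hrc' hd (fun t x => (hdF t x).trans (hFD _ (hcm t))) hrb hC1 hub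
    (fun t ht x => (hdF t x).trans_eq (by rw [clampTime_of_mem ht]))
    (fun t ht => hY t ⟨ht.1, ht.2.trans hT.le⟩) hY0
  refine ⟨w, hw.contDiffOn, fun t ht => ?_, hlow, hup, hprop⟩
  have hwB : ∀ t ∈ Icc 0 T₁, ∀ x, |w t x| ≤ D + D * T₁ := fun t ht x => by
    obtain ⟨α, -, h2⟩ := hfoot t ht x
    have h3 := abs_sub_abs_le_abs_sub (w t x) (ubar α)
    have h4 := mul_le_mul_of_nonneg_left ht.2 hD0
    linarith [hub α]
  have hws := (hw.contDiffOn_slice (Ico_subset_Icc_self ht)).continuous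
  refine ae_eq_of_forall_setIntegral_abs_sub_eq_zero (hu.integrable t ht.1) hws fun N => ?_
  -- Here `w` is driven by the source of `u` itself, so the stability estimate has error `ε = 0`.
  have h1 := hu.setIntegral_abs_sub_classical_le (ρ := N) (ε := 0) (C := D) (B := D + D * T₁)
    (fun t ht => (hF.ae_abs_le ht.1.le).mono fun x hx => hx.trans (hFD t (Ioo_subset_Icc_self ht)))
    (by positivity) hw hrc hwB (fun t ht x => by
      simp only [hr, clampTime_of_mem (Ioo_subset_Icc_self ht), sub_self, abs_zero, le_refl]) ht
  rw [zero_mul, zero_mul] at h1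
  exact h1.antisymm (integral_nonneg fun x => abs_nonneg _)

end IsWeakEntropySolution


/-! ### A priori bounds and time shift -/

/-- To the right of `x` the graph lies above a line of slope `-μ`; the triangle below that line has
height `f x`, base `f x / μ` and area `f x ^ 2 / (2 * μ)`. -/
theorem sq_le_of_neg_le_deriv {f : ℝ → ℝ} (hf : Differentiable ℝ f) (hi : Integrable f) {μ : ℝ}
    (hμ : 0 < μ) (hd : ∀ x, -μ ≤ deriv f x) {x : ℝ} (hx : 0 ≤ f x) :
    f x ^ 2 ≤ 2 * μ * ∫ y, |f y| := by
  set l := f x / μ with hl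
  have hl0 : 0 ≤ l := div_nonneg hx hμ.le
  have h1 : ∀ y, x ≤ y → f x - μ * (y - x) ≤ f y := fun y hy => by
    have := convex_univ.mul_sub_le_image_sub_of_le_deriv hf.continuous.continuousOn
      hf.differentiableOn (C := -μ) (fun z _ => hd z) x (mem_univ _) y (mem_univ _) hy
    linarith
  have h2 : ∫ y in x..(x + l), (f x - μ * (y - x)) ≤ ∫ y in x..(x + l), |f y| :=
    intervalIntegral.integral_mono_on (by linarith) (Continuous.intervalIntegrable (by fun_prop) _ _)
      (hf.continuous.abs.intervalIntegrable _ _) fun y hy => (h1 y hy.1).trans (le_abs_self _)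
  have h3 : ∫ y in x..(x + l), |f y| ≤ ∫ y, |f y| := by
    rw [intervalIntegral.integral_of_le (by linarith)]
    exact setIntegral_le_integral hi.abs (Eventually.of_forall fun y => abs_nonneg _)
  have h4 : ∫ y in x..(x + l), (f x - μ * (y - x)) = f x ^ 2 / (2 * μ) := by
    rw [intervalIntegral.integral_sub (by simp) (Continuous.intervalIntegrable (by fun_prop) _ _),
      intervalIntegral.integral_const, intervalIntegral.integral_const_mul,
      intervalIntegral.integral_comp_sub_right (fun y => y), integral_id, hl, smul_eq_mul]
    field_simp
    ring
  have h5 := (h4.symm.trans_le h2).trans h3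
  rwa [div_le_iff₀ (by positivity), mul_comm] at h5

theorem abs_le_sqrt_of_neg_le_deriv {f : ℝ → ℝ} (hf : Differentiable ℝ f) (hi : Integrable f)
    {μ : ℝ} (hμ : 0 < μ) (hd : ∀ x, -μ ≤ deriv f x) (x : ℝ) :
    |f x| ≤ √(2 * μ * ∫ y, |f y|) := by
  refine Real.le_sqrt_of_sq_le ?_
  rw [sq_abs]
  rcases le_total 0 (f x) with h | h
  · exact sq_le_of_neg_le_deriv hf hi hμ hd h
  -- Negative values reduce to positive ones by the point reflection `y ↦ -f (-y)`, which preserves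
  -- slopes.
  · have hg : ∀ y, HasDerivAt (fun y => -f (-y)) (deriv f (-y)) y := fun y => by
      exact ((hf (-y)).hasDerivAt.comp y (hasDerivAt_neg y)).neg.congr_deriv (by ring)
    have := sq_le_of_neg_le_deriv (f := fun y => -f (-y)) (x := -x)
      (fun y => (hg y).differentiableAt) hi.comp_neg.neg hμ
      (fun y => by rw [(hg y).deriv]; exact hd _) (by simpa using h)
    simp only [neg_neg, neg_sq, abs_neg] at this
    rwa [integral_neg_eq_self (fun y => |f y|)] at this

/-- The triangle bound holds for every `μ > 0`; let `μ → 0`. This is why a nonzero datum has `m <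
0`. -/
theorem eq_zero_of_forall_deriv_nonneg {f : ℝ → ℝ} (hf : Differentiable ℝ f) (hi : Integrable f)
    (hd : ∀ x, 0 ≤ deriv f x) : f = 0 := by
  ext x
  have h1 : Tendsto (fun μ : ℝ => √(2 * μ * ∫ y, |f y|)) (𝓝[>] 0) (𝓝 (√(2 * 0 * ∫ y, |f y|))) :=
    (Continuous.tendsto (by fun_prop) 0).mono_left inf_le_left
  have h2 := ge_of_tendsto h1 (by
    filter_upwards [self_mem_nhdsWithin] with μ hμ
    exact abs_le_sqrt_of_neg_le_deriv hf hi hμ (fun x => by linarith [hd x, mem_Ioi.1 hμ]) x)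
  simpa using h2

namespace IsWeakEntropySolution

variable {ubar : ℝ → ℝ} {u : ℝ → ℝ → ℝ}

/-- The sup norm is at most `√(2μM) + M (eᵗ - 1) / 2`, because the source is at most half of `‖u‖₁ ≤
M eᵗ`. With `√(2μM) ≤ μ + M / 2`, adding half the `L¹` norm gives exactly `μ + M eᵗ`. -/
theorem sourceSlopeBound (hu : IsWeakEntropySolution ubar u) (hC1 : ContDiff ℝ 1 ubar)
    (hL1 : Integrable ubar) {μ : ℝ} (hμ : 0 < μ) (hd : ∀ x, -μ ≤ deriv ubar x) :
    SourceSlopeBound u fun t => μ + (∫ x, |ubar x|) * Real.exp t := by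
  set M := ∫ x, |ubar x| with hM
  have hM0 : 0 ≤ M := integral_nonneg fun x => abs_nonneg _
  set k : ℝ → ℝ := fun t => √(2 * μ * M) + M / 2 * (Real.exp t - 1) with hk
  have hkd : ∀ t, HasDerivAt k (M / 2 * Real.exp t) t := fun t =>
    (((Real.hasDerivAt_exp t).sub_const 1).const_mul _).const_add _
  intro t ht
  refine ⟨k t, hu.abs_le_of_forall_abs_bpSource_le (by fun_prop) (by simp [hk]) ?_ ?_ ?_ ht, ?_⟩
  · intro s t hst
    simp only [hk]
    gcongr
  · intro s hs x
    rw [(hkd s).deriv]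
    have := hu.integral_abs_le_exp hs
    linarith [abs_bpSource_le (hu.integrable s hs) x]
  · intro x
    simpa [hk] using abs_le_sqrt_of_neg_le_deriv (hC1.differentiable one_ne_zero) hL1 hμ hd x
  · have h1 : √(2 * μ * M) ≤ μ + M / 2 :=
      Real.sqrt_le_iff.2 ⟨by positivity, by nlinarith [sq_nonneg (μ - M / 2)]⟩
    have h2 := hu.integral_abs_le_exp ht
    simp only [hk]
    linarith

/-- The time shift of an entropy solution. -/
theorem shift (hu : IsWeakEntropySolution ubar u) {t₀ : ℝ} (h₀ : 0 ≤ t₀) {v : ℝ → ℝ}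
    (hv : u t₀ =ᵐ[volume] v) : IsWeakEntropySolution v fun t => u (t₀ + t) := by
  set c : ℝ × ℝ := (t₀, 0) with hc
  have hmp : MeasurePreserving (fun p : ℝ × ℝ => c + p) volume volume :=
    measurePreserving_add_left volume c
  have hme : MeasurableEmbedding (fun p : ℝ × ℝ => c + p) := measurableEmbedding_addLeft c
  have hcomp : ∀ p : ℝ × ℝ, u (t₀ + p.1) p.2 = (fun q : ℝ × ℝ => u q.1 q.2) (c + p) := fun p => by
    simp [hc]
  refine ⟨?_, ?_, fun t ht => hu.integrable _ (by linarith), ?_, by simpa using hv, ?_⟩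
  · have hcl : IsLocallyClosed (Ici (0 : ℝ) ×ˢ (univ : Set ℝ)) :=
      (isClosed_Ici.prod isClosed_univ).isLocallyClosed
    rw [locallyIntegrableOn_iff hcl]
    intro K hK hKc
    have h1 := (locallyIntegrableOn_iff hcl).1 hu.locallyIntegrable ((fun p => c + p) '' K) (by
      rintro _ ⟨p, hp, rfl⟩
      have h2 := (hK hp).1
      refine ⟨?_, mem_univ _⟩
      simp only [mem_Ici, hc, Prod.fst_add] at h2 ⊢
      linarith) (hKc.image (by fun_prop))
    rw [hmp.integrableOn_image hme] at h1
    simpa only [Function.comp_def, ← hcomp] using h1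
  · intro a b ha
    obtain ⟨C, hC⟩ := hu.locallyBounded (t₀ + a) (t₀ + b) (by linarith)
    refine ⟨C, ?_⟩
    have hm : MeasurableSet (Icc (t₀ + a) (t₀ + b) ×ˢ (univ : Set ℝ)) :=
      measurableSet_Icc.prod MeasurableSet.univ
    have h1 := (hmp.restrict_preimage hm).quasiMeasurePreserving.ae hC
    have h2 : (fun p : ℝ × ℝ => c + p) ⁻¹' (Icc (t₀ + a) (t₀ + b) ×ˢ (univ : Set ℝ))
        = Icc a b ×ˢ univ := by
      ext p; simp [hc]
    rw [h2] at h1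
    simpa only [hcomp] using h1
  · intro s hs
    refine (hu.continuous_L1 (t₀ + s) (by linarith)).comp (tendsto_nhdsWithin_iff.2 ⟨?_, ?_⟩)
    · exact (Continuous.tendsto (by fun_prop) s).mono_left inf_le_left
    · filter_upwards [self_mem_nhdsWithin] with t ht
      rw [mem_Ici] at ht ⊢
      linarith
  · intro k φ hφ hφc hs h0
    -- The translated test function is supported in times later than `t₀`, hence admissible for `u`.
    set ψ : ℝ × ℝ → ℝ := fun p => φ (p - c) with hψ
    have hψs : tsupport ψ ⊆ Ioi t₀ ×ˢ univ := by
      have h1 : tsupport ψ ⊆ (fun p => p - c) ⁻¹' tsupport φ :=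
        closure_minimal (fun p hp => subset_closure hp)
          ((isClosed_tsupport φ).preimage (by fun_prop))
      intro p hp
      have h2 := (hs (h1 hp)).1
      refine ⟨?_, mem_univ _⟩
      simp only [mem_Ioi, hc, Prod.fst_sub] at h2 ⊢
      linarith
    have hsub : Ioi t₀ ×ˢ (univ : Set ℝ) ⊆ Ioi 0 ×ˢ univ :=
      prod_mono (Ioi_subset_Ioi h₀) subset_rfl
    have h1 := hu.entropy k ψ (hφ.comp (contDiff_id.sub contDiff_const))
      (hφc.comp_homeomorph (Homeomorph.subRight c)) (hψs.trans hsub) fun p => h0 _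
    have hfd : ∀ p, fderiv ℝ ψ p = fderiv ℝ φ (p - c) := fun p => fderiv_comp_sub c
    rw [setIntegral_eq_integral_of_forall_compl_eq_zero fun p hp => by
      have hp' : p ∉ tsupport ψ := fun h => hp (hsub (hψs h))
      simp [fderiv_eq_zero_of_notMem_tsupport hp', image_eq_zero_of_notMem_tsupport hp']] at h1
    rw [setIntegral_eq_integral_of_forall_compl_eq_zero fun p hp => by
      have hp' : p ∉ tsupport φ := fun h => hp (hs h)
      simp [fderiv_eq_zero_of_notMem_tsupport hp', image_eq_zero_of_notMem_tsupport hp']]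
    rw [← integral_add_left_eq_self _ c] at h1
    simp only [hfd] at h1
    simpa only [hψ, add_sub_cancel_left, hc, Prod.fst_add, Prod.snd_add, zero_add] using h1

end IsWeakEntropySolution


/-! ### Continuation of regular solutions and blow-up of the slope -/

open Classical in
/-- The continuous representative of `v`, if there is one. -/
noncomputable def continuousVersion (v : ℝ → ℝ) : ℝ → ℝ :=
  if h : ∃ w, Continuous w ∧ v =ᵐ[volume] w then h.choose else v

/-- Uniqueness of continuous representatives makes the choice canonical: versions obtained on
different time intervals are literally equal, so gluing requires no compatibility argument. -/
theorem continuousVersion_eq {v w : ℝ → ℝ} (hw : Continuous w) (h : v =ᵐ[volume] w) :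
    continuousVersion v = w := by
  have hex : ∃ w, Continuous w ∧ v =ᵐ[volume] w := ⟨w, hw, h⟩
  rw [continuousVersion, dif_pos hex]
  exact (Continuous.ae_eq_iff_eq volume hex.choose_spec.1 hw).1 (hex.choose_spec.2.symm.trans h)

/-- The continuous representatives of `u(t,·)` form a `C¹` function on `[0,T) × ℝ` whose slope is
bounded and obeys the Riccati comparison principle. -/
structure IsRegularOn (ubar : ℝ → ℝ) (u : ℝ → ℝ → ℝ) (F : ℝ → ℝ) (T : ℝ) : Prop where
  contDiffOn : ContDiffOn ℝ 1 (fun p : ℝ × ℝ => continuousVersion (u p.1) p.2) (Ico 0 T ×ˢ univ)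
  ae_eq : ∀ t ∈ Ico 0 T, u t =ᵐ[volume] continuousVersion (u t)
  slopeBoundedOn : SlopeBoundedOn ubar (fun t => continuousVersion (u t)) T
  propagates : SlopePropagates F T fun t => continuousVersion (u t)

theorem SlopeBoundedOn.mono {ubar : ℝ → ℝ} {w : ℝ → ℝ → ℝ} {S T : ℝ} (h : SlopeBoundedOn ubar w T)
    (hST : S ≤ T) : SlopeBoundedOn ubar w S := by
  have hs : ∀ a, Ico a S ⊆ Ico a T := fun a => Ico_subset_Ico_right hST
  refine ⟨?_, fun τ hτ => ?_, fun hb => ?_⟩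
  · obtain ⟨K, hK⟩ := h.1
    exact ⟨K, fun t ht => hK t (hs _ ht)⟩
  · obtain ⟨K, hK⟩ := h.2.1 τ hτ
    exact ⟨K, fun t ht => hK t (hs _ ht)⟩
  · obtain ⟨K, hK⟩ := h.2.2 hb
    exact ⟨K, fun t ht => hK t (hs _ ht)⟩

namespace IsWeakEntropySolution

variable {ubar : ℝ → ℝ} {u : ℝ → ℝ → ℝ}

theorem isRegularOn (hu : IsWeakEntropySolution ubar u) (hC1 : ContDiff ℝ 1 ubar)
    {F Y Y' : ℝ → ℝ} {T T₁ : ℝ} (hT₁ : 0 < T₁) (hT : T₁ < T) (hF : SourceSlopeBound u F)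
    (hFc : Continuous F) (hY : ∀ t ∈ Icc 0 T, HasDerivAt Y (Y' t) t ∧ Y t ^ 2 + F t ≤ Y' t)
    (hY0 : ∀ x, -Y 0 ≤ deriv ubar x) : IsRegularOn ubar u F T₁ := by
  obtain ⟨w, hw, hwe, hlow, hup, hprop⟩ :=
    hu.exists_classical_version hC1 hT₁ hT hF hFc hY hY0
  have hW : ∀ t ∈ Ico 0 T₁, continuousVersion (u t) = w t := fun t ht => by
    refine continuousVersion_eq ?_ (hwe t ht)
    rw [← continuousOn_univ]
    exact hw.continuousOn.comp (f := fun x => (t, x)) (by fun_prop)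
      fun x _ => ⟨Ico_subset_Icc_self ht, mem_univ _⟩
  have hYc : ContinuousOn Y (Icc 0 T₁) := fun t ht =>
    (hY t ⟨ht.1, ht.2.trans hT.le⟩).1.continuousAt.continuousWithinAt
  obtain ⟨C, hC⟩ := isCompact_Icc.exists_bound_of_continuousOn hYc
  obtain ⟨D, hD⟩ := (isCompact_Icc (a := 0) (b := T₁)).exists_bound_of_continuousOn
    hFc.continuousOn
  have hD0 : 0 ≤ D := (norm_nonneg _).trans (hD 0 ⟨le_rfl, hT₁.le⟩)
  have hlowC : ∀ t ∈ Ico 0 T₁, ∀ x, -C ≤ deriv (w t) x := fun t ht x => by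
    have h1 := hlow t (Ico_subset_Icc_self ht) x
    have h2 := (le_abs_self _).trans (hC t (Ico_subset_Icc_self ht))
    linarith
  have hC0 : 0 ≤ C := (norm_nonneg _).trans (hC 0 ⟨le_rfl, hT₁.le⟩)
  have hFk : ∀ k, D + 1 ≤ k → ∀ t ∈ Icc 0 T₁, F t ≤ k ^ 2 := fun k hk t ht => by
    have := (le_abs_self _).trans (hD t ht)
    nlinarith
  refine ⟨?_, fun t ht => (hW t ht).symm ▸ hwe t ht, ⟨⟨C, fun t ht x => ?_⟩, fun τ hτ => ?_,
    fun ⟨B, hB⟩ => ?_⟩, ?_⟩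
  · refine (hw.mono (prod_mono Ico_subset_Icc_self subset_rfl)).congr fun p hp => ?_
    rw [hW p.1 hp.1]
  · simp only [hW t ht]; exact hlowC t ht x
  · refine ⟨C + (1 / τ + (D + 1)), fun t ht x => ?_⟩
    have ht' : t ∈ Ico 0 T₁ := ⟨hτ.le.trans ht.1, ht.2⟩
    simp only [hW t ht']
    have h1 := hlowC t ht' x
    have h2 := (hup (D + 1) (by linarith) (hFk _ le_rfl)).1 t ⟨hτ.trans_le ht.1, ht.2.le⟩ x
    have h3 : 1 / t ≤ 1 / τ := one_div_le_one_div_of_le hτ ht.1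
    have h4 : 0 < 1 / τ := by positivity
    exact abs_le.2 ⟨by linarith, by linarith⟩
  · set k := max (D + 1) B with hk
    have hkD : D + 1 ≤ k := le_max_left _ _
    refine ⟨C + k, fun t ht x => ?_⟩
    simp only [hW t ht]
    have h1 := hlowC t ht x
    have h2 := (hup k (by linarith) (hFk _ hkD)).2
      (fun y => (hB (mem_range_self y)).trans (le_max_right _ _)) t (Ico_subset_Icc_self ht) x
    exact abs_le.2 ⟨by linarith, by linarith⟩
  · intro Z Z' t₁ t₂ h1 h12 h2 hZ hx
    beta_reduce at hx ⊢
    rw [hW t₁ ⟨h1, h12.trans_lt h2⟩] at hx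
    rw [hW t₂ ⟨h1.trans h12, h2⟩]
    exact hprop Z Z' t₁ t₂ h1 h12 h2 hZ hx

end IsWeakEntropySolution

namespace IsRegularOn

variable {ubar : ℝ → ℝ} {u : ℝ → ℝ → ℝ} {F : ℝ → ℝ}

theorem slice {T : ℝ} (h : IsRegularOn ubar u F T) {t : ℝ} (ht : t ∈ Ico 0 T) :
    ContDiff ℝ 1 (continuousVersion (u t)) := by
  rw [← contDiffOn_univ]
  exact h.contDiffOn.comp (f := fun x : ℝ => (t, x)) (by fun_prop) fun x _ => ⟨ht, mem_univ _⟩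

theorem mono {S T : ℝ} (h : IsRegularOn ubar u F T) (hST : S ≤ T) : IsRegularOn ubar u F S :=
  ⟨h.contDiffOn.mono (prod_mono (Ico_subset_Ico_right hST) subset_rfl),
    fun t ht => h.ae_eq t (Ico_subset_Ico_right hST ht), h.slopeBoundedOn.mono hST,
    fun Z Z' t₁ t₂ h1 h12 h2 => h.propagates Z Z' t₁ t₂ h1 h12 (h2.trans_le hST)⟩

/-- Restarting strictly before `S` makes the two intervals overlap, so `C¹` regularity is local on
either one, and a Riccati comparison that crosses `S` is chained through `t₀`. -/
theorem extend {S T t₀ : ℝ} (h : IsRegularOn ubar u F S) (h₀S : t₀ < S)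
    (h' : IsRegularOn (continuousVersion (u t₀)) (fun t => u (t₀ + t)) (fun t => F (t₀ + t)) T) :
    IsRegularOn ubar u F (t₀ + T) := by
  have hsh : ∀ {t}, S ≤ t → t < t₀ + T → t - t₀ ∈ Ico (S - t₀) T := fun h1 h2 =>
    ⟨by linarith, by linarith⟩
  have hsh0 : ∀ {t}, S ≤ t → t < t₀ + T → t - t₀ ∈ Ico 0 T := fun h1 h2 =>
    ⟨by linarith, by linarith⟩
  refine ⟨?_, fun t ht => ?_, ⟨?_, fun τ hτ => ?_, fun hb => ?_⟩, ?_⟩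
  · rintro ⟨t, x⟩ ⟨ht, -⟩
    rcases lt_or_ge t S with hS | hS
    · refine (h.contDiffOn (t, x) ⟨⟨ht.1, hS⟩, mem_univ _⟩).mono_of_mem_nhdsWithin ?_
      filter_upwards [self_mem_nhdsWithin, mem_nhdsWithin_of_mem_nhds
        (prod_mem_nhds (Iio_mem_nhds hS) univ_mem)] with p hp hp' using ⟨⟨hp.1.1, hp'.1⟩, mem_univ _⟩
    · have h1 : ContDiffOn ℝ 1 (fun p : ℝ × ℝ => continuousVersion (u p.1) p.2)
          (Ico t₀ (t₀ + T) ×ˢ univ) := by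
        have h2 := h'.contDiffOn.comp (f := fun p : ℝ × ℝ => (p.1 - t₀, p.2))
          (s := Ico t₀ (t₀ + T) ×ˢ univ) (by fun_prop)
          fun p hp => ⟨⟨by simpa using hp.1.1, by simpa [sub_lt_iff_lt_add'] using hp.1.2⟩, mem_univ _⟩
        simpa only [Function.comp_def, add_sub_cancel] using h2
      refine (h1 (t, x) ⟨⟨h₀S.le.trans hS, ht.2⟩, mem_univ _⟩).mono_of_mem_nhdsWithin ?_
      filter_upwards [self_mem_nhdsWithin, mem_nhdsWithin_of_mem_nhds
        (prod_mem_nhds (Ioi_mem_nhds (h₀S.trans_le hS)) univ_mem)] with p hp hp'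
        using ⟨⟨le_of_lt hp'.1, hp.1.2⟩, mem_univ _⟩
  · rcases lt_or_ge t S with hS | hS
    · exact h.ae_eq t ⟨ht.1, hS⟩
    · simpa only [add_sub_cancel] using h'.ae_eq (t - t₀) (hsh0 hS ht.2)
  · obtain ⟨K, hK⟩ := h.slopeBoundedOn.1
    obtain ⟨K', hK'⟩ := h'.slopeBoundedOn.1
    refine ⟨max K K', fun t ht x => ?_⟩
    rcases lt_or_ge t S with hS | hS
    · exact (neg_le_neg (le_max_left _ _)).trans (hK t ⟨ht.1, hS⟩ x)
    · have := hK' (t - t₀) (hsh0 hS ht.2) x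
      simp only [add_sub_cancel] at this
      exact (neg_le_neg (le_max_right _ _)).trans this
  · obtain ⟨K, hK⟩ := h.slopeBoundedOn.2.1 τ hτ
    -- Times beyond `S` lie at least `S - t₀ > 0` after the restart, where the two-sided bound holds
    -- regardless of the slope at `t₀`.
    obtain ⟨K', hK'⟩ := h'.slopeBoundedOn.2.1 (S - t₀) (sub_pos.2 h₀S)
    refine ⟨max K K', fun t ht x => ?_⟩
    rcases lt_or_ge t S with hS | hS
    · exact (hK t ⟨ht.1, hS⟩ x).trans (le_max_left _ _)
    · have := hK' (t - t₀) (hsh hS ht.2) x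
      simp only [add_sub_cancel] at this
      exact this.trans (le_max_right _ _)
  · obtain ⟨K, hK⟩ := h.slopeBoundedOn.2.2 hb
    obtain ⟨K', hK'⟩ := h'.slopeBoundedOn.2.1 (S - t₀) (sub_pos.2 h₀S)
    refine ⟨max K K', fun t ht x => ?_⟩
    rcases lt_or_ge t S with hS | hS
    · exact (hK t ⟨ht.1, hS⟩ x).trans (le_max_left _ _)
    · have := hK' (t - t₀) (hsh hS ht.2) x
      simp only [add_sub_cancel] at this
      exact this.trans (le_max_right _ _)
  · intro Z Z' t₁ t₂ h1 h12 h2 hZ hx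
    have second : ∀ s, t₀ ≤ s → s ≤ t₂ → t₁ ≤ s → (∃ x, deriv (continuousVersion (u s)) x ≤ -Z s) →
        ∃ x, deriv (continuousVersion (u t₂)) x ≤ -Z t₂ := fun s hs hst hs1 hsx => by
      have := h'.propagates (fun t => Z (t₀ + t)) (fun t => Z' (t₀ + t)) (s - t₀) (t₂ - t₀)
        (by linarith) (by linarith) (by linarith) (fun t ht => by
          have h3 := hZ (t₀ + t) ⟨by linarith [ht.1], by linarith [ht.2]⟩
          exact ⟨h3.1.comp_const_add t₀ t, h3.2⟩) (by simpa only [add_sub_cancel] using hsx)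
      simpa only [add_sub_cancel] using this
    rcases lt_or_ge t₂ S with hS | hS
    · exact h.propagates Z Z' t₁ t₂ h1 h12 hS hZ hx
    · rcases le_total t₀ t₁ with h3 | h3
      · exact second t₁ h3 h12 le_rfl hx
      · exact second t₀ le_rfl (h₀S.le.trans hS) h3 (h.propagates Z Z' t₁ t₀ h1 h3 h₀S
          (fun t ht => hZ t ⟨ht.1, ht.2.trans (h₀S.le.trans hS)⟩) hx)

end IsRegularOn

namespace IsWeakEntropySolution

variable {ubar : ℝ → ℝ} {u : ℝ → ℝ → ℝ}

/-- At the end of a maximal interval of regularity the slope tends to `-∞`. -/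
theorem slope_blowup (hu : IsWeakEntropySolution ubar u) {F : ℝ → ℝ} {T : ℝ} (hT : 0 < T)
    (hF : SourceSlopeBound u F) (hFc : Continuous F) (hreg : ∀ S < T, IsRegularOn ubar u F S)
    (hmax : ∀ S, T < S → ¬ IsRegularOn ubar u F S) (K : ℝ) :
    ∀ᶠ t in 𝓝[<] T, ∃ x, deriv (continuousVersion (u t)) x < -K := by
  obtain ⟨D, hD⟩ := (isCompact_Icc (a := 0) (b := T + 1)).exists_bound_of_continuousOn
    hFc.continuousOn
  have hD0 : 0 ≤ D := (norm_nonneg _).trans (hD 0 ⟨le_rfl, by linarith⟩)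
  -- Large enough to exceed `K` strictly and to have `κ² ≥ F`, so that the constant `κ` is a Riccati
  -- subsolution.
  set κ := max (K + 1) (D + 1) with hκ
  have hκD : D + 1 ≤ κ := le_max_right _ _
  have hκK : K + 1 ≤ κ := le_max_left _ _
  have hκ1 : 1 ≤ κ := by linarith
  have hFκ : ∀ t ∈ Icc 0 (T + 1), F t ≤ κ ^ 2 := fun t ht => by
    have := (le_abs_self _).trans (hD t ht)
    nlinarith
  -- If the slopes stayed above `-κ`, a restart close to `T` would live for a time `l` depending on
  -- `κ` only, and carry regularity past `T`.
  have hex : ∃ t₀ ∈ Ioo 0 T, ∃ x, deriv (continuousVersion (u t₀)) x ≤ -κ := by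
    by_contra! hno
    set l := 1 / (8 * κ) with hl
    have hl0 : 0 < l := by positivity
    have hlκ : κ * l = 1 / 8 := by rw [hl]; field_simp
    have hl1 : l ≤ 1 / 8 := by rw [← hlκ]; nlinarith
    set t₀ := max (T / 2) (T - l / 2) with ht₀
    have h1 : T / 2 ≤ t₀ := le_max_left _ _
    have h2 : T - l / 2 ≤ t₀ := le_max_right _ _
    have h3 : t₀ < T := max_lt (by linarith) (by linarith)
    have hr := hreg ((t₀ + T) / 2) (by linarith)
    have hmem : t₀ ∈ Ico 0 ((t₀ + T) / 2) := ⟨by linarith, by linarith⟩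
    have hsh := hu.shift (by linarith : 0 ≤ t₀) (hr.ae_eq t₀ hmem)
    have hpos : ∀ t ∈ Icc 0 (2 * l), 0 < 1 - 2 * κ * t := fun t ht => by
      have := mul_le_mul_of_nonneg_left ht.2 (by linarith : 0 ≤ κ)
      linarith
    -- `Y = κ / (1 - 2κt)` satisfies `Y' = 2 Y²`, and one of the two copies of `Y² ≥ κ²` pays for
    -- `F`. On `[0, 2l]` the denominator is at least `1 / 2`.
    have hreg' := hsh.isRegularOn (hr.slice hmem) (F := fun t => F (t₀ + t)) (T := 2 * l) (T₁ := l)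
      (Y := fun t => κ / (1 - 2 * κ * t)) (Y' := fun t => 2 * (κ / (1 - 2 * κ * t)) ^ 2) hl0
      (by linarith) (fun t ht => hF (t₀ + t) (by linarith)) (by fun_prop) (fun t ht => by
        have hp := hpos t ht
        refine ⟨?_, ?_⟩
        · have e1 : HasDerivAt (fun t : ℝ => 1 - 2 * κ * t) (-(2 * κ)) t := by
            simpa using ((hasDerivAt_id t).const_mul (2 * κ)).const_sub 1
          refine ((hasDerivAt_const t κ).div e1 hp.ne').congr_deriv ?_
          field_simp
          ring
        · have e2 : κ ≤ κ / (1 - 2 * κ * t) := by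
            rw [le_div_iff₀ hp]
            have := mul_nonneg (by nlinarith : 0 ≤ κ * κ) ht.1
            nlinarith
          have e3 := hFκ (t₀ + t) ⟨by linarith [ht.1], by linarith [ht.2]⟩
          have e4 : κ ^ 2 ≤ (κ / (1 - 2 * κ * t)) ^ 2 := by gcongr
          linarith) (fun x => by
        simp only [mul_zero, sub_zero, div_one]
        exact (hno t₀ ⟨by linarith, h3⟩ x).le)
    exact hmax (t₀ + l) (by linarith) (hr.extend hmem.2 hreg')
  obtain ⟨t₀, ht₀, hx⟩ := hex
  filter_upwards [Ioo_mem_nhdsLT ht₀.2] with t ht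
  -- Once below `-κ`, some slope stays there until `T`, by comparison with the constant subsolution.
  have hr := hreg ((t + T) / 2) (by linarith [ht.2])
  obtain ⟨x, hx'⟩ := hr.propagates (fun _ => κ) (fun _ => 0) t₀ t ht₀.1.le ht.1.le
    (by linarith [ht.2]) (fun s hs => ⟨hasDerivAt_const _ _, by
      have := hFκ s ⟨by linarith [hs.1, ht₀.1], by linarith [hs.2, ht.2]⟩
      linarith⟩) hx
  exact ⟨x, by linarith⟩

end IsWeakEntropySolution


/-! ### Explicit Riccati barriers and the conclusion -/

/-- A supersolution of the Riccati equation `Y' = Y² + μ + M eᵗ` with `Y(0) = μ`. -/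
theorem exists_riccati_supersolution {μ M : ℝ} (hμ : 0 < μ) (hM : 0 < M) :
    ∃ T, lowerTime (-μ) M < T ∧ 0 < lowerTime (-μ) M ∧ ∃ Y Y' : ℝ → ℝ, Y 0 = μ ∧
      ∀ t ∈ Icc 0 T, HasDerivAt Y (Y' t) t ∧ Y t ^ 2 + (μ + M * Real.exp t) ≤ Y' t := by
  -- The function `Y = eᵗ c tan (c (eᵗ - 1) + α)` satisfies `Y' = Y + Y² + c² e²ᵗ`, and `c² e²ᵗ ≥ μ
  -- + M eᵗ` for `t ≥ 0`. The phase `α` gives `Y 0 = μ`.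
  set c := √(μ + 3 * M) with hc
  have hc0 : 0 < c := Real.sqrt_pos.2 (by positivity)
  have hc2 : c ^ 2 = μ + 3 * M := Real.sq_sqrt (by positivity)
  set α := Real.arctan (μ / c) with hα
  set β := Real.arctan (μ / √(2 * M)) with hβ
  -- Since `√(2M) < c`, the true phase `α` is below the `β` that appears in the lower time, so the
  -- tangent explodes strictly later. The midpoint of `α` and `β` gives a closed interval that is
  -- longer than required.
  have hαβ : α < β := by
    refine Real.arctan_strictMono ?_
    have : √(2 * M) < c := Real.sqrt_lt_sqrt (by positivity) (by linarith)
    exact div_lt_div_of_pos_left hμ (Real.sqrt_pos.2 (by positivity)) this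
  have hβ2 : β < Real.pi / 2 := Real.arctan_lt_pi_div_two _
  have hα0 : 0 ≤ α := Real.arctan_nonneg.2 (by positivity)
  have hlow : lowerTime (-μ) M = Real.log (1 + 1 / c * (Real.pi / 2 - β)) := by
    rw [lowerTime, abs_neg, abs_of_pos hμ]
  set γ := (α + β) / 2 with hγ
  have hx0 : 0 < 1 / c * (Real.pi / 2 - β) := mul_pos (by positivity) (by linarith)
  have hxx : 1 / c * (Real.pi / 2 - β) < 1 / c * (Real.pi / 2 - γ) :=
    mul_lt_mul_of_pos_left (by linarith) (by positivity)
  refine ⟨Real.log (1 + 1 / c * (Real.pi / 2 - γ)), ?_, ?_,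
    fun t => Real.exp t * (c * Real.tan (c * (Real.exp t - 1) + α)),
    fun t => Real.exp t * (c * Real.tan (c * (Real.exp t - 1) + α)) + Real.exp t * (c *
      (1 / Real.cos (c * (Real.exp t - 1) + α) ^ 2 * (c * Real.exp t))), ?_, fun t ht => ?_⟩
  · rw [hlow]
    exact Real.log_lt_log (by linarith) (by linarith)
  · rw [hlow]
    exact Real.log_pos (by linarith)
  · simp only [Real.exp_zero, sub_self, mul_zero, zero_add, one_mul, hα, Real.tan_arctan]
    field_simp
  · have hτ : 1 ≤ Real.exp t := Real.one_le_exp ht.1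
    have hτ2 : Real.exp t ≤ 1 + 1 / c * (Real.pi / 2 - γ) := by
      rw [← Real.exp_log (show 0 < 1 + 1 / c * (Real.pi / 2 - γ) by linarith)]
      exact Real.exp_le_exp.2 ht.2
    set y := c * (Real.exp t - 1) + α with hy
    have hy0 : 0 ≤ y := add_nonneg (mul_nonneg hc0.le (by linarith)) hα0
    have hy1 : y < Real.pi / 2 := by
      have h1 : c * (Real.exp t - 1) ≤ c * (1 / c * (Real.pi / 2 - γ)) :=
        mul_le_mul_of_nonneg_left (by linarith) hc0.le
      rw [← mul_assoc, mul_one_div_cancel hc0.ne', one_mul] at h1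
      linarith
    have hcos : 0 < Real.cos y := Real.cos_pos_of_mem_Ioo ⟨by linarith, hy1⟩
    refine ⟨?_, ?_⟩
    · have e1 : HasDerivAt (fun t => c * (Real.exp t - 1) + α) (c * Real.exp t) t :=
        (((Real.hasDerivAt_exp t).sub_const 1).const_mul c).add_const α
      have e2 := (Real.hasDerivAt_tan hcos.ne').comp t e1
      exact (Real.hasDerivAt_exp t).mul (e2.const_mul c)
    · have htan : 0 ≤ Real.tan y := Real.tan_nonneg_of_nonneg_of_le_pi_div_two hy0 hy1.le
      have e3 : 1 / Real.cos y ^ 2 = 1 + Real.tan y ^ 2 := by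
        rw [Real.tan_eq_sin_div_cos, div_pow]
        field_simp
        linarith [Real.sin_sq_add_cos_sq y]
      beta_reduce
      rw [← hy, e3]
      have e4 : 0 ≤ Real.exp t * (c * Real.tan y) := by positivity
      have e5 : μ + M * Real.exp t ≤ c ^ 2 * Real.exp t ^ 2 := by
        rw [hc2]
        have h1 : Real.exp t ≤ Real.exp t ^ 2 := by nlinarith
        have h2 := mul_le_mul_of_nonneg_left (hτ.trans h1) hμ.le
        have h3 := mul_le_mul_of_nonneg_left h1 hM.le
        nlinarith
      nlinarith

/-- A subsolution of the Riccati equation `Z' = Z² - μ - M eᵗ` that blows up at `log (1 + R)`. -/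
theorem riccati_subsolution {μ M b' R t : ℝ} (hμ : 0 < μ) (hM : 0 < M) (hb : 0 ≤ b')
    (hb' : b' ^ 2 = μ + M + 1 / 4) (ht : 0 ≤ t) (hR : Real.exp t < 1 + R) :
    HasDerivAt (fun t => Real.exp t * (1 / 2 + b' + (1 + R - Real.exp t)⁻¹))
      (Real.exp t * (1 / 2 + b' + (1 + R - Real.exp t)⁻¹)
        + Real.exp t * (Real.exp t * ((1 + R - Real.exp t)⁻¹) ^ 2)) t ∧
    Real.exp t * (1 / 2 + b' + (1 + R - Real.exp t)⁻¹)
        + Real.exp t * (Real.exp t * ((1 + R - Real.exp t)⁻¹) ^ 2)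
      ≤ (Real.exp t * (1 / 2 + b' + (1 + R - Real.exp t)⁻¹)) ^ 2 - (μ + M * Real.exp t) := by
  have hp : 0 < 1 + R - Real.exp t := by linarith
  refine ⟨?_, ?_⟩
  · have e1 := ((Real.hasDerivAt_exp t).const_sub (1 + R)).inv hp.ne'
    refine (Real.hasDerivAt_exp t).mul ((e1.const_add (1 / 2 + b')).congr_deriv ?_)
    rw [neg_neg, inv_pow, div_eq_mul_inv]
  · set g := (1 + R - Real.exp t)⁻¹ with hg
    have hg0 : 0 < g := inv_pos.2 hp
    set τ := Real.exp t with hτ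
    have hτ1 : 1 ≤ τ := Real.one_le_exp ht
    have h1 : τ ≤ τ ^ 2 := by nlinarith
    have h2 : 0 ≤ 1 / 2 + b' + g := by positivity
    have h3 := mul_le_mul_of_nonneg_right h1 h2
    have h4 := mul_le_mul_of_nonneg_left (hτ1.trans h1) hμ.le
    have h5 := mul_le_mul_of_nonneg_left h1 hM.le
    have h6 : 0 ≤ τ ^ 2 * (2 * g * b') := by positivity
    -- The summand `1 / 2` produces the linear term needed for the derivative of `eᵗ`, and `b'² -
    -- 1/4 = μ + M` pays for the source; the remaining `2 g b'` is nonnegative.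
    have h7 : (1 / 2 + b' + g) ^ 2 = (1 / 2 + b' + g) + g ^ 2 + μ + M + 2 * g * b' := by
      linear_combination hb'
    rw [mul_pow, h7]
    nlinarith

theorem mainTheorem3 (ubar : ℝ → ℝ) (hC1 : ContDiff ℝ 1 ubar) (hL1 : Integrable ubar volume)
    (hne : ubar ≠ 0) (m M : ℝ) (hm : IsGLB (range (deriv ubar)) m) (hM : M = ∫ x, |ubar x|)
    (u : ℝ → ℝ → ℝ) (hu : IsWeakEntropySolution ubar u) :
    (∃ w : ℝ → ℝ → ℝ, IsC1VersionOn u w (lowerTime m M) ∧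
      SlopeBoundedOn ubar w (lowerTime m M)) ∧
    (m < -1 - √(5 / 2 * M + 1) →
      ∃ tstar ∈ Ioo 0 (upperTime m M), ∃ w : ℝ → ℝ → ℝ,
        IsC1VersionOn u w tstar ∧
        (∀ T < tstar, SlopeBoundedOn ubar w T) ∧
        (∀ K : ℝ, ∀ᶠ t in 𝓝[<] tstar, ∃ x, deriv (w t) x < -K)) := by
  have hdiff := hC1.differentiable one_ne_zero
  have hmx : ∀ x, m ≤ deriv ubar x := fun x => hm.1 (mem_range_self x)
  have hm0 : m < 0 := by
    by_contra! h
    exact hne (eq_zero_of_forall_deriv_nonneg hdiff hL1 fun x => h.trans (hmx x))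
  obtain ⟨μ, rfl⟩ : ∃ μ, m = -μ := ⟨-m, by simp⟩
  have hμ : 0 < μ := by linarith
  have hM0 : 0 < M := by
    refine lt_of_le_of_ne (hM ▸ integral_nonneg fun x => abs_nonneg _) fun h => hne ?_
    ext x
    have := abs_le_sqrt_of_neg_le_deriv hdiff hL1 hμ hmx x
    rw [← hM, ← h, mul_zero, Real.sqrt_zero] at this
    exact abs_eq_zero.1 (this.antisymm (abs_nonneg _))
  set F : ℝ → ℝ := fun t => μ + M * Real.exp t with hFdef
  have hF : SourceSlopeBound u F := by
    have := hu.sourceSlopeBound hC1 hL1 hμ hmx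
    rwa [← hM] at this
  have hFc : Continuous F := by fun_prop
  obtain ⟨T, hT, hlow, Y, Y', hY0, hY⟩ := exists_riccati_supersolution hμ hM0
  have hreg := hu.isRegularOn hC1 hlow hT hF hFc hY fun x => by rw [hY0]; exact hmx x
  refine ⟨⟨_, ⟨hreg.contDiffOn, hreg.ae_eq⟩, hreg.slopeBoundedOn⟩, fun hsmall => ?_⟩
  set b := √(μ + 5 / 2 * M + 1 / 4) with hb
  set b' := √(μ + M + 1 / 4) with hb'
  have hb2 : b ^ 2 = μ + 5 / 2 * M + 1 / 4 := Real.sq_sqrt (by positivity)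
  have hb'2 : b' ^ 2 = μ + M + 1 / 4 := Real.sq_sqrt (by positivity)
  have hbb : b' < b := Real.sqrt_lt_sqrt (by positivity) (by linarith)
  have hb'0 : 0 ≤ b' := Real.sqrt_nonneg _
  -- Squaring the hypothesis gives `5/2 M + 1 < (μ - 1)²`, and adding `μ - 3/4` to both sides gives
  -- `b² < (μ - 1/2)²`. This makes the quantity inside the absolute value of the upper time
  -- negative.
  have hbμ : b < μ - 1 / 2 := by
    have h1 : √(5 / 2 * M + 1) < μ - 1 := by linarith
    have h2 := (Real.sqrt_lt' ((Real.sqrt_nonneg _).trans_lt h1)).1 h1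
    refine (Real.sqrt_lt' ?_).2 (by nlinarith)
    linarith [(Real.sqrt_nonneg (5 / 2 * M + 1))]
  set R := upperTime (-μ) M with hR
  have hRinv : R⁻¹ = μ - 1 / 2 - b := by
    rw [hR, upperTime, abs_neg, abs_of_pos hμ, ← hb, inv_div, abs_of_neg (by linarith)]
    ring
  have hR0 : 0 < R := inv_pos.1 (by rw [hRinv]; linarith)
  -- The subsolution starts at `1/2 + b' + 1/R = μ - (b - b')`, strictly below `μ`, and explodes at
  -- `log (1 + R)`; regularity beyond that time would contradict the lower bound on the slope.
  have hmax : ∀ S, IsRegularOn ubar u F S → S ≤ Real.log (1 + R) := by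
    intro S hS
    by_contra! hlt
    obtain ⟨K, hK⟩ := hS.slopeBoundedOn.1
    -- Stopping when the denominator equals `η` makes the subsolution at least `1 / η ≥ |K| + 1`,
    -- while `η ≤ R` keeps the stopping time nonnegative.
    set η := min R (|K| + 1)⁻¹ with hη
    have hη0 : 0 < η := lt_min hR0 (by positivity)
    have hηR : η ≤ R := min_le_left _ _
    have hηK : |K| + 1 ≤ η⁻¹ := by
      rw [le_inv_comm₀ (by positivity) hη0]
      exact min_le_right _ _
    set t₂ := Real.log (1 + R - η) with ht₂
    have hexp : Real.exp t₂ = 1 + R - η := Real.exp_log (by linarith)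
    have ht0 : 0 ≤ t₂ := Real.log_nonneg (by linarith)
    have ht2 : t₂ < S := (Real.log_lt_log (by linarith) (by linarith)).trans hlt
    -- The infimum need not be attained; the gap `b - b' > 0` leaves room for an actual point.
    have hx0 : ∃ x, deriv ubar x < -μ + (b - b') := by
      by_contra! h
      have := hm.2 (by rintro _ ⟨x, rfl⟩; exact h x : -μ + (b - b') ∈ lowerBounds _)
      linarith
    have hW0 : continuousVersion (u 0) = ubar := continuousVersion_eq hC1.continuous hu.initial
    obtain ⟨x, hx⟩ := hS.propagates _ _ 0 t₂ le_rfl ht0 ht2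
      (fun t ht => riccati_subsolution (R := R) hμ hM0 hb'0 hb'2 ht.1 (by
        have := Real.exp_le_exp.2 ht.2
        linarith)) (by
        obtain ⟨x, hx⟩ := hx0
        refine ⟨x, ?_⟩
        simp only [hW0, Real.exp_zero, one_mul, add_sub_cancel_left, hRinv]
        linarith)
    have h1 := hK t₂ ⟨ht0, ht2⟩ x
    have h2 : (1 : ℝ) ≤ Real.exp t₂ := Real.one_le_exp ht0
    have h3 : η⁻¹ ≤ Real.exp t₂ * (1 / 2 + b' + (1 + R - Real.exp t₂)⁻¹) := by
      have e : 1 + R - Real.exp t₂ = η := by rw [hexp]; ring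
      rw [e]
      have := inv_pos.2 hη0
      nlinarith
    have h4 := le_abs_self K
    simp only at hx h1
    linarith
  set S : Set ℝ := {T | IsRegularOn ubar u F T} with hS
  have hbdd : BddAbove S := ⟨Real.log (1 + R), fun T hT => hmax T hT⟩
  have hne : S.Nonempty := ⟨_, hreg⟩
  set tstar := sSup S with htstar
  have htpos : 0 < tstar := hlow.trans_le (le_csSup hbdd hreg)
  have htle : tstar ≤ Real.log (1 + R) := csSup_le hne hmax
  -- The barrier explodes strictly before `R`, which gives the strict inequality for the breaking
  -- time.
  have hlog : Real.log (1 + R) < R := by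
    have := Real.log_lt_sub_one_of_pos (show 0 < 1 + R by linarith) (by linarith)
    linarith
  have hlt : ∀ T < tstar, IsRegularOn ubar u F T := fun T hT => by
    obtain ⟨T', hT', hTT'⟩ := exists_lt_of_lt_csSup hne hT
    exact IsRegularOn.mono hT' hTT'.le
  refine ⟨tstar, ⟨htpos, htle.trans_lt hlog⟩, fun t => continuousVersion (u t), ⟨?_, ?_⟩,
    fun T hT => (hlt T hT).slopeBoundedOn, hu.slope_blowup htpos hF hFc hlt fun T hT hreg =>
      absurd (le_csSup hbdd hreg) (not_le.2 hT)⟩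
  · rintro ⟨t, x⟩ ⟨ht, -⟩
    have h1 : t < (t + tstar) / 2 := by linarith [ht.2]
    refine ((hlt ((t + tstar) / 2) (by linarith [ht.2])).contDiffOn (t, x)
      ⟨⟨ht.1, h1⟩, mem_univ _⟩).mono_of_mem_nhdsWithin ?_
    filter_upwards [self_mem_nhdsWithin, mem_nhdsWithin_of_mem_nhds
      (prod_mem_nhds (Iio_mem_nhds h1) univ_mem)] with p hp hp' using ⟨⟨hp.1.1, hp'.1⟩, mem_univ _⟩
  · intro t ht
    exact (hlt ((t + tstar) / 2) (by linarith [ht.2])).ae_eq t ⟨ht.1, by linarith [ht.2]⟩
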